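/- Let $p\ge 5$ be a prime and let $\mathbb{Z}_{(p)}\subset\mathbb{Q}$ be the ring of $p$-integral rational numbers. For an integer $k\ge 0$ let $\mathrm{M}_k$ be the space of holomorphic modular forms of weight $k$ on $\mathrm{SL}_2(\mathbb{Z})$ whose Fourier coefficients lie in $\mathbb{Z}_{(p)}$, each form being identified with its Fourier expansion in $\mathbb{Z}_{(p)}[[q]]$. For $m\ge 1$ and $f\in\mathbb{Z}_{(p)}[[q]]$ let $$\omega_{p^m}(f)=\inf\{\,k\ge 0 : f\equiv g \pmod{p^m}\text{ for some } g\in \mathrm{M}_k\,\}$$ be the weight filtration of $f$ modulo $p^m$ (with $\inf\emptyset=\infty$), where congruences are coefficientwise, and let $\theta=q\,\frac{d}{dq}$, so that $\theta\big(\sum a(n)q^n\big)=\sum n\,a(n)q^n$. Suppose that $f\in \mathrm{M}_k$ with $0<k<p$ satisfies $\omega_p(f)=k$. Then $$\omega_{p^2}(\theta^i f)=\begin{cases} k & \text{if } i=0,\\ k+2i+2p(p-1) & \text{if } 0<i<p-k+1,\\ k+2i+p(p-1) & \text{if } i=p-k+1,\\ k+2i+2p(p-1) & \text{if } p-k+1<i<p,\\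 k+2i+p(p-1) & \text{if } i=p.\end{cases}$$ -/

import Mathlib

open scoped MatrixGroups PowerSeries

/-- The ring of `p`-integral rational numbers: fractions whose reduced denominator is prime
to `p`. For `p` prime this is the localization of `ℤ` at the prime ideal `(p)`. -/
def pIntegralRationals (p : ℕ) : Subring ℚ where
  carrier := {x | x.den.Coprime p}
  mul_mem' := fun {a b} ha hb =>
    Nat.Coprime.coprime_dvd_left (Rat.mul_den_dvd a b) (Nat.Coprime.mul_left ha hb)
  one_mem' := by simp
  add_mem' := fun {a b} ha hb =>
    Nat.Coprime.coprime_dvd_left (Rat.add_den_dvd a b) (Nat.Coprime.mul_left ha hb)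
  zero_mem' := by simp
  neg_mem' := fun {a} ha => by simpa using ha

/-- The inclusion of the `p`-integral rationals into `ℂ`. -/
noncomputable def pIntegralToComplex (p : ℕ) : pIntegralRationals p →+* ℂ :=
  (algebraMap ℚ ℂ).comp (pIntegralRationals p).subtype

/-- The space `M_k` of holomorphic modular forms of weight `k` on `SL₂(ℤ)` with `p`-integral
rational Fourier coefficients, each form being identified with its Fourier expansion in `q`. -/
def pIntegralModularForms (p k : ℕ) : Set (pIntegralRationals p)⟦X⟧ :=
  {f | ∃ F : ModularForm 𝒮ℒ (k : ℤ),
    UpperHalfPlane.qExpansion 1 F = PowerSeries.map (pIntegralToComplex p) f}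

/-- Congruence of power series: `f ≡ g (mod p ^ m)` coefficient by coefficient, in the ring of
`p`-integral rationals. -/
def PowerSeriesCongr (p m : ℕ) (f g : (pIntegralRationals p)⟦X⟧) : Prop :=
  ∀ n : ℕ, (p : pIntegralRationals p) ^ m ∣ PowerSeries.coeff n f - PowerSeries.coeff n g

/-- The weight filtration of `f` modulo `p ^ m`: the infimum of all weights `k ≥ 0` such that
`f` is congruent modulo `p ^ m` to an element of `M_k`. The infimum is taken in `ℕ∞`, so it
equals `⊤` exactly if `f` is not congruent to any modular form; otherwise it is attained.
(There are no nonzero modular forms of negative weight.) -/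
noncomputable def weightFiltration (p m : ℕ) (f : (pIntegralRationals p)⟦X⟧) : ℕ∞ :=
  ⨅ (k : ℕ) (_ : ∃ g ∈ pIntegralModularForms p k, PowerSeriesCongr p m f g), (k : ℕ∞)

/-- The theta operator `q d/dq`, which sends `∑ a(n) q ^ n` to `∑ n a(n) q ^ n`. -/
noncomputable def thetaOperator {R : Type*} [CommRing R] (f : R⟦X⟧) : R⟦X⟧ :=
  PowerSeries.mk fun n => (n : R) * PowerSeries.coeff n f

/-! Forms of weight w with p-integral coefficients are the isobaric polynomials of weight w in Q =
E₄ and R = E₆ (`mem_pIntegralModularForms_iff`), so filtrations become questions of divisibility in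
F_p[Q, R]. Let A be the polynomial with q-expansion E_{p-1} = 1 + pcS, where c is a unit and S = ∑
σ_{p-2}(n) qⁿ. Then A = 1 mod p and A^p = 1 mod p² as q-expansions. Let ∂ be the derivation with 12θ
= ∂ + wE₂ in weight w. Modulo p the form B = ∂A represents E₂, and ∂B = -QA makes A and B relatively
prime (`isRelPrime_hasse`).

One has 12^i θ^i f = ∑ t_r E₂^{i-r} f_r with t_r = `thetaCoeff k i r` and f_r of weight k + 2r
(`thetaOperator_iterate_qEval`). Modulo p², with B lifted suitably, E₂^j = A^{p-j} B^j - 12jp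
A^{p-1-j} B^{j-1} D, where pD = θA and D is prime to A modulo p (`exists_e2Series_pow`). So θ^i f
is, up to a unit, of the shape G + pH with G of some weight W and H of weight W + p(p-1), and A^p G
+ pH is a form of the latter weight.

If G ≠ 0 and A^p does not divide H modulo p, the filtration is exactly W + p(p-1)
(`weightFiltration_two_eq`): a form of smaller weight would differ in weight by a multiple of
p(p-1), and subtraction would give A^p | H. That weights are determined modulo p(p-1)
(`dvd_weight_sub_of_sq_dvd`) holds because S is not a quotient of forms modulo p of the weights that
would occur: S satisfies the Artin–Schreier equation 24(S^p - S) = θ^{p-2} E₂, whose right side is a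
form prime to A, and orders at a simple prime factor of A do not match (`sigmaSeries_mul_qEval_ne`).

For i < p the test becomes whether A^{i+1} divides `thetaObstruction`. If i ≤ p-k, then t_0 is a
unit and the term r = 0 is not divisible by A. If p-k+1 < i < p, the first surviving term has r =
p-k+1, and divisibility would force A² | f_r, which is excluded by weights (`sq_not_dvd_serreSeq`).
If i = p-k+1 or i = p, every t_r with r < i is divisible by p, and t_0 exactly once; now G = f_i has
weight only k + 2i, which is the drop by p(p-1). -/

namespace pIntegralRationals

/-! ### Arithmetic of the p-integral rationals -/

variable {p : ℕ}

lemma mem_iff {x : ℚ} : x ∈ pIntegralRationals p ↔ x.den.Coprime p := Iff.rfl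

lemma den_ne_zero [Fact p.Prime] (x : pIntegralRationals p) : ((x : ℚ).den : ZMod p) ≠ 0 := by
  rw [Ne, ZMod.natCast_eq_zero_iff, ← (Fact.out : p.Prime).coprime_iff_not_dvd, Nat.coprime_comm]
  exact mem_iff.1 x.2

/-- Reduction modulo `p` of a `p`-integral rational number. -/
def reduction (p : ℕ) [Fact p.Prime] : pIntegralRationals p →+* ZMod p where
  toFun x := ((x : ℚ) : ZMod p)
  map_one' := by simp
  map_zero' := by simp
  map_mul' x y := by
    simpa using Rat.cast_mul_of_ne_zero (den_ne_zero x) (den_ne_zero y)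
  map_add' x y := by
    simpa using Rat.cast_add_of_ne_zero (den_ne_zero x) (den_ne_zero y)

lemma reduction_apply [Fact p.Prime] (x : pIntegralRationals p) :
    reduction p x = ((x : ℚ) : ZMod p) := rfl

lemma mem_of_mul_eq [Fact p.Prime] {x : ℚ} {n m : ℤ} (hm : (m : ZMod p) ≠ 0)
    (h : x * m = n) : x ∈ pIntegralRationals p := by
  have hm0 : m ≠ 0 := by rintro rfl; simp at hm
  have hx : x = Rat.divInt n m := by
    rw [Rat.divInt_eq_div, eq_div_iff (by exact_mod_cast hm0), h]
  have hd : ((x.den : ℤ)) ∣ m := by rw [hx]; exact Rat.den_dvd n m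
  rw [mem_iff, Nat.coprime_comm, Nat.Prime.coprime_iff_not_dvd Fact.out]
  intro hp
  exact hm ((ZMod.intCast_zmod_eq_zero_iff_dvd _ _).2 ((Int.natCast_dvd_natCast.2 hp).trans hd))

lemma dvd_of_reduction_eq_zero [Fact p.Prime] {x : pIntegralRationals p}
    (h : reduction p x = 0) : (p : pIntegralRationals p) ∣ x := by
  rw [reduction_apply, Rat.cast_def, div_eq_zero_iff, or_iff_left (den_ne_zero x),
    ZMod.intCast_zmod_eq_zero_iff_dvd] at h
  obtain ⟨m, hm⟩ := h
  have hd : ((x : ℚ).den : ℚ) ≠ 0 := by exact_mod_cast (x : ℚ).den_nz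
  have hx : (x : ℚ) = p * (m / (x : ℚ).den) := by
    conv_lhs => rw [← Rat.num_div_den (x : ℚ), hm]
    push_cast; ring
  refine ⟨⟨m / (x : ℚ).den, ?_⟩, Subtype.ext (by simpa using hx)⟩
  refine mem_of_mul_eq (n := m) (m := ((x : ℚ).den : ℤ)) (by exact_mod_cast den_ne_zero x) ?_
  push_cast
  field_simp

lemma reduction_eq_zero_iff [Fact p.Prime] {x : pIntegralRationals p} :
    reduction p x = 0 ↔ (p : pIntegralRationals p) ∣ x := by
  refine ⟨dvd_of_reduction_eq_zero, ?_⟩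
  rintro ⟨y, rfl⟩
  simp

lemma reduction_surjective [Fact p.Prime] : Function.Surjective (reduction p) := fun y =>
  ⟨(y.val : pIntegralRationals p), by simp⟩

lemma isUnit_of_reduction_ne_zero [Fact p.Prime] {x : pIntegralRationals p}
    (h : reduction p x ≠ 0) : IsUnit x := by
  have hnum : ((x : ℚ).num : ZMod p) ≠ 0 := by
    intro h0; apply h; rw [reduction_apply, Rat.cast_def, h0, zero_div]
  have hx0 : (x : ℚ) ≠ 0 := by rintro h0; simp [h0] at hnum
  refine IsUnit.of_mul_eq_one ⟨(x : ℚ)⁻¹, ?_⟩ (Subtype.ext (by simpa using mul_inv_cancel₀ hx0))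
  refine mem_of_mul_eq (n := (x : ℚ).den) (m := (x : ℚ).num) hnum ?_
  have : (x : ℚ).num = (x : ℚ) * (x : ℚ).den := (Rat.mul_den_eq_num _).symm
  rw [this, inv_mul_cancel_left₀ hx0]
  simp

lemma natCast_self_ne_zero [Fact p.Prime] : (p : pIntegralRationals p) ≠ 0 := by
  have := (Fact.out : p.Prime).ne_zero
  exact_mod_cast this

end pIntegralRationals

lemma ZMod.natCast_ne_zero_of_coprime {p n : ℕ} [Fact p.Prime] (h : ¬ p ∣ n) : (n : ZMod p) ≠ 0 := by
  rwa [Ne, ZMod.natCast_eq_zero_iff]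

/-- The residue characteristic `p ≥ 5` does not divide `1728`. -/
lemma ZMod.natCast_1728_ne_zero {p : ℕ} [Fact p.Prime] (hp5 : 5 ≤ p) : (1728 : ZMod p) ≠ 0 := by
  have h : ¬ p ∣ 1728 := by
    intro h
    have : p ∣ 2 ^ 6 * 3 ^ 3 := by simpa using h
    rcases (Fact.out : p.Prime).dvd_mul.1 this with h | h
    · have := Nat.le_of_dvd two_pos ((Fact.out : p.Prime).dvd_of_dvd_pow h); omega
    · have := Nat.le_of_dvd three_pos ((Fact.out : p.Prime).dvd_of_dvd_pow h); omega
  exact_mod_cast ZMod.natCast_ne_zero_of_coprime h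

/-! ### Formal properties of θ -/

section ThetaOperator

open MvPolynomial

variable {K L : Type*} [CommRing K] [CommRing L]

@[simp] lemma coeff_thetaOperator (f : K⟦X⟧) (n : ℕ) :
    PowerSeries.coeff n (thetaOperator f) = n * PowerSeries.coeff n f := by
  simp [thetaOperator]

@[simp] lemma constantCoeff_thetaOperator (f : K⟦X⟧) :
    PowerSeries.constantCoeff (thetaOperator f) = 0 := by
  rw [← PowerSeries.coeff_zero_eq_constantCoeff_apply, coeff_thetaOperator, Nat.cast_zero, zero_mul]

lemma thetaOperator_eq_X_mul (f : K⟦X⟧) :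
    thetaOperator f = PowerSeries.X * PowerSeries.derivative K f := by
  ext n
  rw [coeff_thetaOperator]
  cases n with
  | zero => simp
  | succ n => rw [PowerSeries.coeff_succ_X_mul, PowerSeries.coeff_derivative]; push_cast; ring

lemma thetaOperator_add (f g : K⟦X⟧) :
    thetaOperator (f + g) = thetaOperator f + thetaOperator g := by
  simp only [thetaOperator_eq_X_mul, map_add]; ring

lemma thetaOperator_mul (f g : K⟦X⟧) :
    thetaOperator (f * g) = thetaOperator f * g + f * thetaOperator g := by
  simp only [thetaOperator_eq_X_mul, Derivation.leibniz, smul_eq_mul]; ring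

@[simp] lemma thetaOperator_C (c : K) : thetaOperator (PowerSeries.C c) = 0 := by
  ext n
  rw [coeff_thetaOperator, PowerSeries.coeff_C]
  split_ifs with h <;> simp [h]

@[simp] lemma thetaOperator_one : thetaOperator (1 : K⟦X⟧) = 0 := by
  simpa using thetaOperator_C (1 : K)

@[simp] lemma thetaOperator_zero : thetaOperator (0 : K⟦X⟧) = 0 := by
  simpa using thetaOperator_C (0 : K)

lemma thetaOperator_C_mul (c : K) (f : K⟦X⟧) :
    thetaOperator (PowerSeries.C c * f) = PowerSeries.C c * thetaOperator f := by
  simp [thetaOperator_mul]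

@[simp] lemma thetaOperator_natCast (n : ℕ) : thetaOperator (n : K⟦X⟧) = 0 := by
  simpa using thetaOperator_C (n : K)

lemma thetaOperator_natCast_mul (c : ℕ) (f : K⟦X⟧) :
    thetaOperator ((c : K⟦X⟧) * f) = c * thetaOperator f := by
  simp [thetaOperator_mul]

lemma thetaOperator_sum {ι : Type*} (s : Finset ι) (f : ι → K⟦X⟧) :
    thetaOperator (∑ i ∈ s, f i) = ∑ i ∈ s, thetaOperator (f i) := by
  simp only [thetaOperator_eq_X_mul, map_sum, Finset.mul_sum]

lemma thetaOperator_pow (f : K⟦X⟧) (n : ℕ) :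
    thetaOperator (f ^ n) = n * f ^ (n - 1) * thetaOperator f := by
  simp only [thetaOperator_eq_X_mul, Derivation.leibniz_pow, smul_eq_mul, nsmul_eq_mul]; ring

lemma map_thetaOperator (φ : K →+* L) (f : K⟦X⟧) :
    PowerSeries.map φ (thetaOperator f) = thetaOperator (PowerSeries.map φ f) := by
  ext n; simp

lemma map_thetaOperator_iterate (φ : K →+* L) (f : K⟦X⟧) (i : ℕ) :
    PowerSeries.map φ (thetaOperator^[i] f) = thetaOperator^[i] (PowerSeries.map φ f) := by
  induction i with
  | zero => rfl
  | succ i ih => rw [Function.iterate_succ_apply', map_thetaOperator, ih,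
      Function.iterate_succ_apply']

lemma coeff_thetaOperator_iterate (f : K⟦X⟧) (i n : ℕ) :
    PowerSeries.coeff n (thetaOperator^[i] f) = n ^ i * PowerSeries.coeff n f := by
  induction i with
  | zero => simp
  | succ i ih => rw [Function.iterate_succ_apply', coeff_thetaOperator, ih]; ring

end ThetaOperator

/-! ### Isobaric polynomials in Q and R, and the Serre derivation -/

section Isobaric

open MvPolynomial

/-- A polynomial in `Q = X 0` and `R = X 1` is isobaric of weight `w` if it is weighted
homogeneous of degree `w`, where `Q` has weight `4` and `R` has weight `6`. -/
abbrev Isobaric {K : Type*} [CommSemiring K] (P : MvPolynomial (Fin 2) K) (w : ℕ) : Prop :=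
  IsWeightedHomogeneous ![4, 6] P w

variable {K L : Type*} [CommRing K] [CommRing L]

lemma isobaric_Q : Isobaric (X 0 : MvPolynomial (Fin 2) K) 4 :=
  isWeightedHomogeneous_X K _ 0

lemma isobaric_R : Isobaric (X 1 : MvPolynomial (Fin 2) K) 6 :=
  isWeightedHomogeneous_X K _ 1

lemma isobaric_zero (w : ℕ) : Isobaric (0 : MvPolynomial (Fin 2) K) w :=
  isWeightedHomogeneous_zero K _ w

lemma Isobaric.map {P : MvPolynomial (Fin 2) K} {w : ℕ} (h : Isobaric P w) (φ : K →+* L) :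
    Isobaric (MvPolynomial.map φ P) w := by
  intro d hd
  apply h
  rintro h0
  simp [coeff_map, h0] at hd

lemma Isobaric.cast {P : MvPolynomial (Fin 2) K} {v w : ℕ} (h : Isobaric P v) (e : v = w) :
    Isobaric P w := e ▸ h

lemma Isobaric.add {P P' : MvPolynomial (Fin 2) K} {w : ℕ} (h : Isobaric P w)
    (h' : Isobaric P' w) : Isobaric (P + P') w :=
  IsWeightedHomogeneous.add h h'

lemma Isobaric.sub {P P' : MvPolynomial (Fin 2) K} {w : ℕ} (h : Isobaric P w)
    (h' : Isobaric P' w) : Isobaric (P - P') w :=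
  IsWeightedHomogeneous.sub h h'

lemma Isobaric.mul {P P' : MvPolynomial (Fin 2) K} {v w : ℕ} (h : Isobaric P v)
    (h' : Isobaric P' w) : Isobaric (P * P') (v + w) :=
  IsWeightedHomogeneous.mul h h'

lemma Isobaric.pow {P : MvPolynomial (Fin 2) K} {w : ℕ} (h : Isobaric P w) (n : ℕ) :
    Isobaric (P ^ n) (n * w) :=
  IsWeightedHomogeneous.pow h n

lemma Isobaric.C_mul {P : MvPolynomial (Fin 2) K} {w : ℕ} (h : Isobaric P w) (c : K) :
    Isobaric (C c * P) w :=
  IsWeightedHomogeneous.C_mul h c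

lemma Isobaric.natCast_mul {P : MvPolynomial (Fin 2) K} {w : ℕ} (h : Isobaric P w) (n : ℕ) :
    Isobaric ((n : MvPolynomial (Fin 2) K) * P) w := by
  simpa using h.C_mul (n : K)

lemma Isobaric.intCast_mul {P : MvPolynomial (Fin 2) K} {w : ℕ} (h : Isobaric P w) (n : ℤ) :
    Isobaric ((n : MvPolynomial (Fin 2) K) * P) w := by
  simpa using h.C_mul (n : K)

lemma Isobaric.sum {ι : Type*} {s : Finset ι} {f : ι → MvPolynomial (Fin 2) K} {w : ℕ}
    (h : ∀ i ∈ s, Isobaric (f i) w) : Isobaric (∑ i ∈ s, f i) w :=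
  IsWeightedHomogeneous.sum s f w h

lemma weight_fin_two (d : Fin 2 →₀ ℕ) :
    Finsupp.weight ![4, 6] d = 4 * d 0 + 6 * d 1 := by
  rw [Finsupp.weight_apply, Finsupp.sum_fintype _ _ (by simp), Fin.sum_univ_two]
  simp [mul_comm]

lemma Isobaric.eq_zero_of_forall {P : MvPolynomial (Fin 2) K} {w : ℕ} (h : Isobaric P w)
    (hw : ∀ a b : ℕ, 4 * a + 6 * b ≠ w) : P = 0 := by
  ext d
  by_contra hd
  have := h hd
  rw [weight_fin_two] at this
  exact hw _ _ this

lemma Isobaric.eq_C {P : MvPolynomial (Fin 2) K} (h : Isobaric P 0) : P = C (coeff 0 P) := by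
  ext d
  rw [coeff_C]
  split_ifs with hd
  · rw [hd]
  · by_contra h0
    have := h h0
    rw [weight_fin_two] at this
    apply hd
    ext i
    fin_cases i <;> simp <;> omega

/-- Every isobaric polynomial is a sum of isobaric monomials, in the form of an induction
principle. -/
lemma Isobaric.induction {w : ℕ} {motive : MvPolynomial (Fin 2) K → Prop}
    (zero : motive 0) (add : ∀ P P', motive P → motive P' → motive (P + P'))
    (monomial : ∀ (a b : ℕ) (c : K), 4 * a + 6 * b = w → motive (C c * X 0 ^ a * X 1 ^ b))
    {P : MvPolynomial (Fin 2) K} (h : Isobaric P w) : motive P := by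
  rw [P.as_sum]
  refine Finset.sum_induction _ motive add zero fun d hd => ?_
  have hw := h (mem_support_iff.1 hd)
  rw [weight_fin_two] at hw
  have := monomial (d 0) (d 1) (coeff d P) hw
  rwa [monomial_eq, Finsupp.prod_fintype _ _ (by simp), Fin.prod_univ_two, ← mul_assoc]

/-- The derivation of `K[Q, R]` with `Q ↦ -4R` and `R ↦ -6Q²`. It raises weights by `2`. -/
noncomputable def serreDer (K : Type*) [CommRing K] :
    Derivation K (MvPolynomial (Fin 2) K) (MvPolynomial (Fin 2) K) :=
  mkDerivation K ![-4 * X 1, -6 * X 0 ^ 2]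

@[simp] lemma serreDer_Q : serreDer K (X 0) = -4 * X 1 := by simp [serreDer, mkDerivation_X]
@[simp] lemma serreDer_R : serreDer K (X 1) = -6 * X 0 ^ 2 := by simp [serreDer, mkDerivation_X]

lemma serreDer_monomial (a b : ℕ) (c : K) :
    serreDer K (C c * X 0 ^ a * X 1 ^ b) =
      C c * (X 0 ^ a * ((b : MvPolynomial (Fin 2) K) * X 1 ^ (b - 1) * (-6 * X 0 ^ 2)) +
        X 1 ^ b * ((a : MvPolynomial (Fin 2) K) * X 0 ^ (a - 1) * (-4 * X 1))) := by
  rw [mul_assoc, Derivation.leibniz, Derivation.leibniz, Derivation.leibniz_pow,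
    Derivation.leibniz_pow]
  simp only [serreDer_Q, serreDer_R, smul_eq_mul, nsmul_eq_mul]
  rw [← algebraMap_eq, Derivation.map_algebraMap]
  ring

lemma isobaric_serreDer {P : MvPolynomial (Fin 2) K} {w : ℕ} (h : Isobaric P w) :
    Isobaric (serreDer K P) (w + 2) := by
  refine h.induction (motive := fun P => Isobaric (serreDer K P) (w + 2)) ?_ ?_ ?_
  · rw [map_zero]; exact isobaric_zero _
  · intro P P' h h'; rw [map_add]; exact Isobaric.add h h'
  · intro a b c hw
    rw [serreDer_monomial]
    refine Isobaric.C_mul (Isobaric.add ?_ ?_) c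
    · rcases b with _ | b
      · simpa using isobaric_zero _
      · have h1 : Isobaric (((X 0 : MvPolynomial (Fin 2) K) ^ a * X 1 ^ b * X 0 ^ 2)) (w + 2) :=
          (((isobaric_Q.pow a).mul (isobaric_R.pow b)).mul (isobaric_Q.pow 2)).cast
            (by omega)
        have := (Isobaric.natCast_mul h1 (b + 1)).intCast_mul (-6)
        convert this using 1
        push_cast; simp; ring
    · rcases a with _ | a
      · simpa using isobaric_zero _
      · have h1 : Isobaric (((X 0 : MvPolynomial (Fin 2) K) ^ a * X 1 ^ b * X 1)) (w + 2) :=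
          (((isobaric_Q.pow a).mul (isobaric_R.pow b)).mul isobaric_R).cast
            (by omega)
        have := (Isobaric.natCast_mul h1 (a + 1)).intCast_mul (-4)
        convert this using 1
        push_cast; simp; ring

lemma map_serreDer (φ : K →+* L) (P : MvPolynomial (Fin 2) K) :
    MvPolynomial.map φ (serreDer K P) = serreDer L (MvPolynomial.map φ P) := by
  induction P using MvPolynomial.induction_on with
  | C a => rw [← algebraMap_eq, Derivation.map_algebraMap, algebraMap_eq, map_C, ← algebraMap_eq,
      Derivation.map_algebraMap, map_zero]
  | add P P' h h' => simp [h, h']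
  | mul_X P i h =>
    rw [Derivation.leibniz, map_mul, Derivation.leibniz, map_X]
    simp only [map_add, smul_eq_mul, map_mul, h, map_X]
    fin_cases i <;> simp [map_ofNat]

end Isobaric

/-! ### q-expansions of isobaric polynomials -/

section EisensteinSeries

open MvPolynomial

/-- The power series `1 + c ∑ σ_j(n) q ^ n`. -/
noncomputable def eisSeries (K : Type*) [CommRing K] (c : K) (j : ℕ) : K⟦X⟧ :=
  PowerSeries.mk fun n => if n = 0 then 1 else c * (ArithmeticFunction.sigma j n : ℕ)

variable {K L : Type*} [CommRing K] [CommRing L]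

lemma coeff_eisSeries (c : K) (j n : ℕ) : PowerSeries.coeff n (eisSeries K c j) =
    if n = 0 then 1 else c * (ArithmeticFunction.sigma j n : ℕ) := by
  simp [eisSeries]

@[simp] lemma constantCoeff_eisSeries (c : K) (j : ℕ) :
    PowerSeries.constantCoeff (eisSeries K c j) = 1 := by
  rw [← PowerSeries.coeff_zero_eq_constantCoeff_apply, coeff_eisSeries, if_pos rfl]

lemma map_eisSeries (φ : K →+* L) (c : K) (j : ℕ) :
    PowerSeries.map φ (eisSeries K c j) = eisSeries L (φ c) j := by
  ext n
  rw [PowerSeries.coeff_map, coeff_eisSeries, coeff_eisSeries]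
  split_ifs <;> simp

/-- The `q`-expansion of the quasi-modular Eisenstein series of weight `2`. -/
noncomputable abbrev e2Series (K : Type*) [CommRing K] : K⟦X⟧ := eisSeries K (-24) 1
/-- The `q`-expansion of the Eisenstein series of weight `4`. -/
noncomputable abbrev e4Series (K : Type*) [CommRing K] : K⟦X⟧ := eisSeries K 240 3
/-- The `q`-expansion of the Eisenstein series of weight `6`. -/
noncomputable abbrev e6Series (K : Type*) [CommRing K] : K⟦X⟧ := eisSeries K (-504) 5

/-- Evaluation of polynomials in `Q` and `R` at the `q`-expansions of the Eisenstein series of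
weights `4` and `6`. -/
noncomputable def qEval (K : Type*) [CommRing K] : MvPolynomial (Fin 2) K →ₐ[K] K⟦X⟧ :=
  aeval ![e4Series K, e6Series K]

@[simp] lemma qEval_Q : qEval K (X 0) = e4Series K := by simp [qEval]
@[simp] lemma qEval_R : qEval K (X 1) = e6Series K := by simp [qEval]
@[simp] lemma qEval_C (c : K) : qEval K (C c) = PowerSeries.C c := by
  simp [qEval]

lemma map_qEval (φ : K →+* L) (P : MvPolynomial (Fin 2) K) :
    PowerSeries.map φ (qEval K P) = qEval L (MvPolynomial.map φ P) := by
  induction P using MvPolynomial.induction_on with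
  | C a => simp
  | add P P' h h' => simp [h, h']
  | mul_X P i h =>
    rw [map_mul, map_mul, map_mul, map_mul, map_X, h]
    fin_cases i <;> simp [map_eisSeries, map_ofNat]

/-- The monomial `Q ^ a R ^ b` of even weight `w` with `b ≤ 1` (for `w ≠ 2`). -/
noncomputable def normalMonomial (K : Type*) [CommRing K] (w : ℕ) : MvPolynomial (Fin 2) K :=
  X 0 ^ ((w - 6 * (w / 2 % 2)) / 4) * X 1 ^ (w / 2 % 2)

lemma constantCoeff_qEval_normalMonomial (w : ℕ) :
    PowerSeries.constantCoeff (qEval K (normalMonomial K w)) = 1 := by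
  simp [normalMonomial]

lemma isobaric_normalMonomial {w : ℕ} (hw : Even w) (h2 : w ≠ 2) :
    Isobaric (normalMonomial K w) w := by
  refine ((isobaric_Q.pow _).mul (isobaric_R.pow _)).cast ?_
  obtain ⟨v, rfl⟩ := hw
  omega

/-- The relation R² = Q³ - (Q³ - R²) lowers the exponent of R by two until it is 0 or 1. In weight
below 12 the subtraction w - 12 truncates, so the vanishing of the cofactor is recorded separately.
-/
lemma exists_monomial_eq (a b : ℕ) :
    ∃ P : MvPolynomial (Fin 2) K, (X 0 : MvPolynomial (Fin 2) K) ^ a * X 1 ^ b =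
        normalMonomial K (4 * a + 6 * b) + (X 0 ^ 3 - X 1 ^ 2) * P ∧
      Isobaric P (4 * a + 6 * b - 12) ∧ (4 * a + 6 * b < 12 → P = 0) := by
  induction b using Nat.twoStepInduction generalizing a with
  | zero =>
    refine ⟨0, ?_, isobaric_zero _, fun _ => rfl⟩
    have h1 : (4 * a + 6 * 0) / 2 % 2 = 0 := by omega
    have h2 : (4 * a + 6 * 0 - 6 * 0) / 4 = a := by omega
    simp only [normalMonomial, h1, h2]; ring
  | one =>
    refine ⟨0, ?_, isobaric_zero _, fun _ => rfl⟩
    have h1 : (4 * a + 6 * 1) / 2 % 2 = 1 := by omega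
    have h2 : (4 * a + 6 * 1 - 6 * 1) / 4 = a := by omega
    simp only [normalMonomial, h1, h2]; ring
  | more b ih _ =>
    obtain ⟨P, hP, hP', -⟩ := ih (a + 3)
    have hw : 4 * (a + 3) + 6 * b = 4 * a + 6 * (b + 2) := by ring
    rw [hw] at hP hP'
    refine ⟨P - X 0 ^ a * X 1 ^ b, ?_, hP'.sub ?_, by omega⟩
    · linear_combination hP
    · exact ((isobaric_Q.pow a).mul (isobaric_R.pow b)).cast (by omega)

lemma Isobaric.exists_eq_normalMonomial {P : MvPolynomial (Fin 2) K} {w : ℕ} (h : Isobaric P w) :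
    ∃ (c : K) (P' : MvPolynomial (Fin 2) K),
      P = C c * normalMonomial K w + (X 0 ^ 3 - X 1 ^ 2) * P' ∧
      Isobaric P' (w - 12) ∧ (w < 12 → P' = 0) := by
  refine h.induction (motive := fun P => ∃ (c : K) (P' : MvPolynomial (Fin 2) K),
      P = C c * normalMonomial K w + (X 0 ^ 3 - X 1 ^ 2) * P' ∧
      Isobaric P' (w - 12) ∧ (w < 12 → P' = 0)) ?_ ?_ ?_
  · exact ⟨0, 0, by simp, isobaric_zero _, fun _ => rfl⟩
  · rintro _ _ ⟨c, P, rfl, hP, hP0⟩ ⟨c', P', rfl, hP', hP0'⟩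
    refine ⟨c + c', P + P', by rw [map_add]; ring, hP.add hP', fun hw => ?_⟩
    rw [hP0 hw, hP0' hw, add_zero]
  · rintro a b c rfl
    obtain ⟨P, hP, hP', hP0⟩ := exists_monomial_eq (K := K) a b
    refine ⟨c, C c * P, by rw [mul_assoc, hP]; ring, hP'.C_mul c, fun hw => by simp [hP0 hw]⟩

lemma exists_qEval_discriminant (h : IsUnit (1728 : K)) :
    ∃ u : K⟦X⟧, IsUnit u ∧ qEval K (X 0 ^ 3 - X 1 ^ 2) = PowerSeries.X * u := by
  have h0 : PowerSeries.constantCoeff (qEval K (X 0 ^ 3 - X 1 ^ 2)) = 0 := by simp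
  obtain ⟨u, hu⟩ := PowerSeries.X_dvd_iff.2 h0
  refine ⟨u, ?_, hu⟩
  rw [PowerSeries.isUnit_iff_constantCoeff, ← PowerSeries.coeff_zero_eq_constantCoeff_apply,
    ← PowerSeries.coeff_succ_X_mul, ← hu]
  -- The coefficient of q in E₄³ - E₆² is 3 · 240 + 2 · 504 = 1728.
  convert h using 1
  simp only [map_sub, pow_succ, pow_zero, one_mul]
  simp [PowerSeries.coeff_mul, Finset.Nat.antidiagonal_succ, coeff_eisSeries]
  ring

/-- An isobaric polynomial is determined by its `q`-expansion, as soon as `1728` is invertible. -/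
theorem Isobaric.eq_zero_of_qEval_eq_zero (h1728 : IsUnit (1728 : K))
    {P : MvPolynomial (Fin 2) K} {w : ℕ} (h : Isobaric P w) (hP : qEval K P = 0) : P = 0 := by
  induction w using Nat.strong_induction_on generalizing P with
  | _ w ih =>
    obtain ⟨c, P', rfl, hP', hP0⟩ := h.exists_eq_normalMonomial
    obtain ⟨u, hu, hu'⟩ := exists_qEval_discriminant h1728
    -- The discriminant has no constant term, and the normal monomial has constant term 1.
    have hc : c = 0 := by
      have := congrArg PowerSeries.constantCoeff hP
      rw [map_add, map_mul, map_mul, hu'] at this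
      simpa [constantCoeff_qEval_normalMonomial] using this
    subst hc
    rcases lt_or_ge w 12 with hw | hw
    · simp [hP0 hw]
    · rw [ih (w - 12) (by omega) hP']
      · simp
      · rw [map_zero, zero_mul, zero_add, map_mul, hu', mul_assoc] at hP
        have h1 := PowerSeries.X_mul_cancel (hP.trans (mul_zero _).symm)
        exact (hu.mul_right_eq_zero).1 h1

theorem Isobaric.ext_qEval (h1728 : IsUnit (1728 : K)) {P P' : MvPolynomial (Fin 2) K} {w : ℕ}
    (h : Isobaric P w) (h' : Isobaric P' w) (he : qEval K P = qEval K P') : P = P' :=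
  sub_eq_zero.1 <| (h.sub h').eq_zero_of_qEval_eq_zero h1728
    (by rw [map_sub, he, sub_self])

end EisensteinSeries

/-! ### Holomorphic q-expansions and Ramanujan's equations over ℂ -/

section Analysis

open UpperHalfPlane hiding I
open Complex Function Derivative ModularForm EisensteinSeries
open scoped Manifold Real

/-- The normalized derivative acts on `q`-expansions as `q d/dq`. -/
lemma hasSum_normalizedDeriv {F : ℍ → ℂ} (hper : Periodic (F ∘ ofComplex) (1 : ℝ)) (hF : MDiff F)
    (hb : IsBoundedAtImInfty F) (τ : ℍ) :
    HasSum (fun m : ℕ => ((m : ℂ) * (qExpansion 1 F).coeff m) • Periodic.qParam 1 (τ : ℂ) ^ m)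
      (D F τ) := by
  set q := Periodic.qParam 1 (τ : ℂ) with hq
  have hq1 : ‖q‖ < 1 := Periodic.norm_qParam_lt_one one_pos τ.im_pos
  have hd := differentiableOn_cuspFunction_ball one_pos hper hF hb
  have hqb : q ∈ Metric.ball (0 : ℂ) 1 := by simpa using hq1
  have h1 := hasSum_taylorSeries_on_ball (hd.deriv Metric.isOpen_ball) hqb
  have h2 : D F τ = q * deriv (cuspFunction 1 F) q := by
    have hFc : F ∘ ofComplex = fun z => cuspFunction 1 F (Periodic.qParam 1 z) := by
      ext z
      exact (Periodic.eq_cuspFunction one_ne_zero hper z).symm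
    have hc : HasDerivAt (cuspFunction 1 F) (deriv (cuspFunction 1 F) q) q :=
      (hd.differentiableAt (Metric.isOpen_ball.mem_nhds hqb)).hasDerivAt
    have hqd : HasDerivAt (Periodic.qParam 1) (q * (2 * π * I)) (τ : ℂ) := by
      have : HasDerivAt (fun z : ℂ => 2 * π * I * z / (1 : ℝ)) (2 * π * I) (τ : ℂ) := by
        simpa using (hasDerivAt_id (τ : ℂ)).const_mul (2 * π * I)
      exact this.cexp
    rw [normalizedDerivOfComplex, hFc]
    have := hc.comp (τ : ℂ) hqd
    rw [show (fun z => cuspFunction 1 F (Periodic.qParam 1 z)) =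
      cuspFunction 1 F ∘ Periodic.qParam 1 from rfl, this.deriv]
    have h2pi := two_pi_I_ne_zero
    field_simp
  have h4 : ∀ m : ℕ, (((m + 1 : ℕ) : ℂ) * (qExpansion 1 F).coeff (m + 1)) • q ^ (m + 1) =
      q * ((m.factorial : ℂ)⁻¹ • (q - 0) ^ m • iteratedDeriv m (deriv (cuspFunction 1 F)) 0) := by
    intro m
    rw [qExpansion_coeff, ← iteratedDeriv_succ', Nat.factorial_succ]
    have := Nat.cast_ne_zero (R := ℂ).2 (Nat.factorial_ne_zero m)
    have := Nat.cast_add_one_ne_zero (R := ℂ) m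
    simp only [smul_eq_mul, sub_zero]
    push_cast
    field_simp
    ring
  rw [h2, ← hasSum_nat_add_iff' 1]
  simp only [h4, Finset.range_one, Finset.sum_singleton, Nat.cast_zero, zero_mul, zero_smul,
    sub_zero]
  simpa using h1.mul_left q

lemma periodic_comp_ofComplex_of_hasSum {F : ℍ → ℂ} {c : ℕ → ℂ}
    (h : ∀ τ : ℍ, HasSum (fun m : ℕ => c m • Periodic.qParam 1 (τ : ℂ) ^ m) (F τ)) :
    Periodic (F ∘ ofComplex) (1 : ℝ) := by
  intro z
  by_cases hz : 0 < z.im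
  · have hz' : 0 < (z + (1 : ℝ)).im := by simpa using hz
    have h1 := h ⟨z, hz⟩
    have h2 := h ⟨z + (1 : ℝ), hz'⟩
    rw [comp_apply, comp_apply, ofComplex_apply_of_im_pos hz, ofComplex_apply_of_im_pos hz']
    refine h2.unique ?_
    convert h1 using 4 with m
    simp [Periodic.qParam, mul_add, exp_add]
  · have hz' : ¬ 0 < (z + (1 : ℝ)).im := by simpa using hz
    rw [comp_apply, comp_apply, ofComplex_apply_of_im_nonpos (not_lt.1 hz),
      ofComplex_apply_of_im_nonpos (not_lt.1 hz')]

/-- A function with a convergent `q`-expansion: holomorphic, periodic, and bounded at `∞`. -/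
structure IsQHolomorphic (F : ℍ → ℂ) : Prop where
  mdiff : MDiff F
  periodic : Periodic (F ∘ ofComplex) (1 : ℝ)
  bounded : IsBoundedAtImInfty F

namespace IsQHolomorphic

variable {F G : ℍ → ℂ}

lemma analyticAt (hF : IsQHolomorphic F) : AnalyticAt ℂ (cuspFunction 1 F) 0 :=
  analyticAt_cuspFunction_zero one_pos hF.periodic hF.mdiff hF.bounded

lemma of_hasSum (hF : MDiff F) {c : ℕ → ℂ}
    (h : ∀ τ : ℍ, HasSum (fun m : ℕ => c m • Periodic.qParam 1 (τ : ℂ) ^ m) (F τ)) :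
    IsQHolomorphic F where
  mdiff := hF
  periodic := periodic_comp_ofComplex_of_hasSum h
  bounded := isBoundedAtImInfty_of_hasSum_qExpansion one_pos h

lemma coeff_eq (hF : IsQHolomorphic F) {c : ℕ → ℂ}
    (h : ∀ τ : ℍ, HasSum (fun m : ℕ => c m • Periodic.qParam 1 (τ : ℂ) ^ m) (F τ)) (m : ℕ) :
    (qExpansion 1 F).coeff m = c m := by
  have h1 := (hasFPowerSeriesOnBall_cuspFunction one_pos hF.analyticAt h).hasFPowerSeriesAt
  have h2 : HasFPowerSeriesAt (cuspFunction 1 F)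
      (.ofScalars ℂ fun m => (qExpansion 1 F).coeff m) 0 := by
    simpa [qExpansion_coeff, div_eq_mul_inv, mul_comm] using
      hF.analyticAt.hasFPowerSeriesAt
  simpa using congrArg (FormalMultilinearSeries.coeff · m) (h2.eq_formalMultilinearSeries h1)

lemma of_modularForm {k : ℤ} (f : ModularForm 𝒮ℒ k) : IsQHolomorphic f where
  mdiff := f.holo'
  periodic := SlashInvariantFormClass.periodic_comp_ofComplex f one_mem_strictPeriods_SL
  bounded := ModularFormClass.bdd_at_infty f

lemma deriv (hF : IsQHolomorphic F) : IsQHolomorphic (D F) :=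
  of_hasSum (normalizedDerivOfComplex_mdifferentiable hF.mdiff)
    (hasSum_normalizedDeriv hF.periodic hF.mdiff hF.bounded)

lemma qExpansion_deriv (hF : IsQHolomorphic F) :
    qExpansion 1 (D F) = thetaOperator (qExpansion 1 F) := by
  ext m
  rw [hF.deriv.coeff_eq (hasSum_normalizedDeriv hF.periodic hF.mdiff hF.bounded),
    coeff_thetaOperator]

lemma mul (hF : IsQHolomorphic F) (hG : IsQHolomorphic G) : IsQHolomorphic (F * G) where
  mdiff := hF.mdiff.mul hG.mdiff
  periodic := fun z => by
    have h1 := hF.periodic z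
    have h2 := hG.periodic z
    simp only [comp_apply] at h1 h2
    simp only [comp_apply, Pi.mul_apply, h1, h2]
  bounded := by
    have := hF.bounded.mul hG.bounded
    simpa using! this

lemma sub (hF : IsQHolomorphic F) (hG : IsQHolomorphic G) : IsQHolomorphic (F - G) where
  mdiff := hF.mdiff.sub hG.mdiff
  periodic := fun z => by
    have h1 := hF.periodic z
    have h2 := hG.periodic z
    simp only [comp_apply] at h1 h2
    simp only [comp_apply, Pi.sub_apply, h1, h2]
  bounded := Asymptotics.IsBigO.sub hF.bounded hG.bounded

lemma smul (hF : IsQHolomorphic F) (c : ℂ) : IsQHolomorphic (c • F) where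
  mdiff := hF.mdiff.const_smul c
  periodic := fun z => by
    have h1 := hF.periodic z
    simp only [comp_apply] at h1
    simp only [comp_apply, Pi.smul_apply, h1]
  bounded := Asymptotics.IsBigO.const_smul_left hF.bounded c

/-- A holomorphic function bounded at `∞` and invariant under `SL₂(ℤ)` is a modular form. -/
def toModularForm (hF : IsQHolomorphic F) (k : ℤ) (h : ∀ γ : SL(2, ℤ), F ∣[k] γ = F) :
    ModularForm 𝒮ℒ k where
  toFun := F
  slash_action_eq' := fun _ ⟨γ, hγ⟩ => hγ ▸ h γ
  holo' := hF.mdiff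
  bdd_at_cusps' {c} hc := by
    rw [Subgroup.IsArithmetic.isCusp_iff_isCusp_SL2Z] at hc
    rw [OnePoint.isBoundedAt_iff_forall_SL2Z hc]
    intro γ _
    rw [h γ]
    exact hF.bounded

end IsQHolomorphic

lemma isQHolomorphic_E2 : IsQHolomorphic E2 :=
  .of_hasSum E2_mdifferentiable (c := fun m => (if m = 0 then 1 else -24 * (ArithmeticFunction.sigma 1 m : ℕ) : ℂ))
    fun τ => by simpa only [Function.Periodic.qParam, ofReal_one, div_one] using
      hasSum_qExpansion_E2 (z := τ)

lemma qExpansion_E2 : qExpansion 1 E2 = e2Series ℂ := by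
  ext m
  rw [isQHolomorphic_E2.coeff_eq (c := fun m => (if m = 0 then 1 else -24 * (ArithmeticFunction.sigma 1 m : ℕ) : ℂ))
    (fun τ => by simpa only [Function.Periodic.qParam, ofReal_one, div_one] using
      hasSum_qExpansion_E2 (z := τ)), coeff_eisSeries]

lemma qExpansion_E4 : qExpansion 1 E₄ = e4Series ℂ := by
  ext m
  rw [E_qExpansion_coeff _ ⟨2, rfl⟩, coeff_eisSeries]
  norm_num [show bernoulli 4 = -1 / 30 by decide +kernel]

lemma qExpansion_E6 : qExpansion 1 E₆ = e6Series ℂ := by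
  ext m
  rw [E_qExpansion_coeff _ ⟨3, rfl⟩, coeff_eisSeries]
  norm_num [show bernoulli 6 = 1 / 42 by decide +kernel]

/-- The Serre derivative of a modular form, as a modular form. -/
noncomputable def serreDerivativeForm {k : ℤ} (f : ModularForm 𝒮ℒ k) : ModularForm 𝒮ℒ (k + 2) :=
  ((IsQHolomorphic.of_modularForm f).deriv.sub
    ((isQHolomorphic_E2.mul (.of_modularForm f)).smul ((k : ℂ) / 12))).toModularForm (k + 2) <| by
  intro γ
  have h : (⇑f) ∣[k] γ = ⇑f := SlashInvariantForm.slash_action_eqn f.toSlashInvariantForm _ ⟨γ, rfl⟩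
  have := serreDerivative_slash_invariant (γ := γ) f.holo' h
  convert this using 1
  · congr 1; ext z; simp; ring
  · ext z; simp; ring

lemma qExpansion_serreDerivativeForm {k : ℤ} (f : ModularForm 𝒮ℒ k) :
    qExpansion 1 (serreDerivativeForm f) = thetaOperator (qExpansion 1 f) -
      PowerSeries.C ((k : ℂ) / 12) * e2Series ℂ * qExpansion 1 f := by
  have hf := IsQHolomorphic.of_modularForm f
  have h2 := isQHolomorphic_E2.mul hf
  change qExpansion 1 (D f - ((k : ℂ) / 12) • (E2 * f)) = _
  rw [qExpansion_sub hf.deriv.analyticAt (h2.smul _).analyticAt, qExpansion_smul h2.analyticAt,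
    qExpansion_mul isQHolomorphic_E2.analyticAt hf.analyticAt, hf.qExpansion_deriv,
    qExpansion_E2, PowerSeries.smul_eq_C_mul]
  ring

lemma E2_slash (γ : SL(2, ℤ)) (z : ℍ) : (E2 ∣[(2 : ℤ)] γ) z =
    E2 z + 12 * ((2 * π * I)⁻¹ * (γ 1 0 / denom γ z)) := by
  have hd := denom_ne_zero γ z
  rw [E2_slash_action]
  simp only [Pi.sub_apply, Pi.smul_apply, smul_eq_mul, D2, riemannZeta_two]
  have : (π : ℂ) ≠ 0 := by exact_mod_cast Real.pi_ne_zero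
  field_simp
  linear_combination (-12 : ℂ) * (γ 1 0 : ℂ) * I_sq

lemma hasDerivAt_const_div_denom (γ : SL(2, ℤ)) (z : ℍ) :
    HasDerivAt ((fun z : ℍ => (2 * π * I)⁻¹ * ((γ 1 0 : ℂ) / denom γ z)) ∘ ofComplex)
      (-(2 * π * I) * ((2 * π * I)⁻¹ * (γ 1 0 / denom γ z)) ^ 2) z := by
  have hd := denom_ne_zero γ z
  have h1 := ((hasDerivAt_denom_zpow (γ : GL (Fin 2) ℝ) (-1) z).const_mul
    (γ 1 0 : ℂ)).const_mul (2 * π * I)⁻¹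
  refine (h1.congr_of_eventuallyEq ?_).congr_deriv ?_
  · filter_upwards [isOpen_upperHalfPlaneSet.mem_nhds z.im_pos] with w hw
    simp [ofComplex_apply_of_im_pos hw, div_eq_mul_inv]
  · have := two_pi_I_ne_zero
    simp only [zpow_sub₀ hd]
    simp
    field_simp
    linear_combination (γ 1 0 : ℂ) ^ 2 * I_sq

lemma mdifferentiable_const_div_denom (γ : SL(2, ℤ)) :
    MDiff (fun z : ℍ => (2 * π * I)⁻¹ * ((γ 1 0 : ℂ) / denom γ z)) := fun z =>
  mdifferentiableAt_iff.2 (hasDerivAt_const_div_denom γ z).differentiableAt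

/-- With u = c / (2πi(cτ + d)), the slash action turns E₂ into E₂ + 12u, and Du = -u². The resulting
error terms of DE₂ and of E₂²/12 cancel. Hence this combination is modular of weight 4 and is
determined by its constant term. -/
lemma D_E2_slash (γ : SL(2, ℤ)) :
    (D E2 - (12 : ℂ)⁻¹ • (E2 * E2)) ∣[(4 : ℤ)] γ = D E2 - (12 : ℂ)⁻¹ • (E2 * E2) := by
  set u : ℍ → ℂ := fun z : ℍ => (2 * π * I)⁻¹ * ((γ 1 0 : ℂ) / denom γ z) with hu
  have hE : E2 ∣[(2 : ℤ)] γ = E2 + (12 : ℂ) • u := by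
    ext z
    rw [E2_slash]
    simp [hu]
  have hD := normalizedDerivOfComplex_SL_slash (k := 2) E2_mdifferentiable (γ := γ)
  rw [hE, normalizedDerivOfComplex_add _ _ E2_mdifferentiable
    ((mdifferentiable_const_div_denom γ).const_smul _),
    normalizedDerivOfComplex_smul _ _ (mdifferentiable_const_div_denom γ)] at hD
  ext z
  have h1 := congrFun hD z
  have h2 : D u z = -(u z) ^ 2 := by
    rw [normalizedDerivOfComplex, (hasDerivAt_const_div_denom γ z).deriv]
    have := two_pi_I_ne_zero
    simp only [hu]
    field_simp
  have h3 : ((E2 * E2) ∣[(4 : ℤ)] γ) z = (E2 z + 12 * u z) ^ 2 := by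
    rw [show (4 : ℤ) = 2 + 2 by norm_num, mul_slash_SL2, hE]
    simp [sq]
  rw [sub_eq_add_neg, SlashAction.add_slash, SlashAction.neg_slash, SL_smul_slash]
  simp only [Pi.add_apply, Pi.neg_apply, Pi.smul_apply, Pi.sub_apply, smul_eq_mul, Pi.mul_apply] at h1 ⊢
  rw [h3]
  rw [h2] at h1
  rw [show (2 : ℤ) + 2 = 4 by norm_num, Int.cast_ofNat] at h1
  have hu' : u z = (2 * π * I)⁻¹ * ((γ 1 0 : ℂ) / denom γ z) := rfl
  linear_combination -h1 + 2 * (E2 z + 12 * u z) * hu'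

/-- Level one forms of weight less than `12` are determined by their constant terms. -/
lemma qExpansion_eq_of_coeff_zero_eq {k : ℤ} (hk : k < 12) (f g : ModularForm 𝒮ℒ k)
    (h : (qExpansion 1 f).coeff 0 = (qExpansion 1 g).coeff 0) : qExpansion 1 f = qExpansion 1 g := by
  have hsub : qExpansion 1 (f - g) = qExpansion 1 f - qExpansion 1 g :=
    ModularForm.qExpansion_sub one_pos one_mem_strictPeriods_SL f g
  have h0 : (qExpansion 1 (f - g : ModularForm 𝒮ℒ k)).coeff 0 = 0 := by
    rw [FunLike.coe_sub, hsub, map_sub, h, sub_self]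
  have h1 := qExpansion_eq_qExpansion_discriminant_mul (f - g) h0
  rw [ModularFormClass.levelOne_neg_weight_eq_zero (k := k - 12) (by omega)
    (CuspForm.discriminantEquiv ((f - g).toCuspForm h0)), qExpansion_zero, mul_zero, FunLike.coe_sub, hsub,
    sub_eq_zero] at h1
  exact h1

lemma thetaOperator_e4Series_complex :
    3 * thetaOperator (e4Series ℂ) = e2Series ℂ * e4Series ℂ - e6Series ℂ := by
  have h := qExpansion_eq_of_coeff_zero_eq (k := 6) (by norm_num) (serreDerivativeForm E₄)
    ((-(1 / 3) : ℂ) • E₆) (by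
      rw [qExpansion_serreDerivativeForm, FunLike.coe_smul,
        ModularForm.qExpansion_smul one_pos one_mem_strictPeriods_SL, qExpansion_E4, qExpansion_E6]
      simp; norm_num)
  rw [qExpansion_serreDerivativeForm, FunLike.coe_smul,
    ModularForm.qExpansion_smul one_pos one_mem_strictPeriods_SL, qExpansion_E4, qExpansion_E6,
    PowerSeries.smul_eq_C_mul, show ((4 : ℤ) : ℂ) / 12 = 1 / 3 by norm_num, map_neg] at h
  have hc : 3 * PowerSeries.C (1 / 3 : ℂ) = 1 := by
    rw [← map_ofNat PowerSeries.C 3, ← map_mul]; norm_num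
  linear_combination 3 * h + (e2Series ℂ * e4Series ℂ - e6Series ℂ) * hc

lemma thetaOperator_e6Series_complex :
    2 * thetaOperator (e6Series ℂ) = e2Series ℂ * e6Series ℂ - e4Series ℂ ^ 2 := by
  have h := qExpansion_eq_of_coeff_zero_eq (k := 8) (by norm_num) (serreDerivativeForm E₆)
    ((-(1 / 2) : ℂ) • E₄.mul E₄) (by
      rw [qExpansion_serreDerivativeForm, FunLike.coe_smul,
        ModularForm.qExpansion_smul one_pos one_mem_strictPeriods_SL,
        ModularForm.qExpansion_mul one_pos one_mem_strictPeriods_SL, qExpansion_E4, qExpansion_E6]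
      simp; norm_num)
  rw [qExpansion_serreDerivativeForm, FunLike.coe_smul,
    ModularForm.qExpansion_smul one_pos one_mem_strictPeriods_SL,
    ModularForm.qExpansion_mul one_pos one_mem_strictPeriods_SL, qExpansion_E4, qExpansion_E6,
    PowerSeries.smul_eq_C_mul, show ((6 : ℤ) : ℂ) / 12 = 1 / 2 by norm_num, map_neg] at h
  have hc : 2 * PowerSeries.C (1 / 2 : ℂ) = 1 := by
    rw [← map_ofNat PowerSeries.C 2, ← map_mul]; norm_num
  linear_combination 2 * h + (e2Series ℂ * e6Series ℂ - e4Series ℂ ^ 2) * hc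

lemma thetaOperator_e2Series_complex :
    12 * thetaOperator (e2Series ℂ) = e2Series ℂ ^ 2 - e4Series ℂ := by
  have hq2 := isQHolomorphic_E2.mul isQHolomorphic_E2
  have hF := isQHolomorphic_E2.deriv.sub (hq2.smul (12 : ℂ)⁻¹)
  have hexp : qExpansion 1 (D E2 - (12 : ℂ)⁻¹ • (E2 * E2)) =
      thetaOperator (e2Series ℂ) - PowerSeries.C (12 : ℂ)⁻¹ * e2Series ℂ ^ 2 := by
    rw [qExpansion_sub isQHolomorphic_E2.deriv.analyticAt (hq2.smul _).analyticAt,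
      qExpansion_smul hq2.analyticAt, isQHolomorphic_E2.qExpansion_deriv,
      qExpansion_mul isQHolomorphic_E2.analyticAt isQHolomorphic_E2.analyticAt, qExpansion_E2,
      PowerSeries.smul_eq_C_mul, sq]
  have h := qExpansion_eq_of_coeff_zero_eq (k := 4) (by norm_num)
    (hF.toModularForm 4 D_E2_slash) ((-(12)⁻¹ : ℂ) • E₄) (by
      rw [FunLike.coe_smul, ModularForm.qExpansion_smul one_pos one_mem_strictPeriods_SL,
        qExpansion_E4]
      change (qExpansion 1 (D E2 - (12 : ℂ)⁻¹ • (E2 * E2))).coeff 0 = _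
      rw [hexp]
      simp)
  rw [FunLike.coe_smul, ModularForm.qExpansion_smul one_pos one_mem_strictPeriods_SL,
    qExpansion_E4, PowerSeries.smul_eq_C_mul, map_neg] at h
  replace h := hexp.symm.trans h
  have hc : 12 * PowerSeries.C ((12 : ℂ)⁻¹) = 1 := by
    rw [← map_ofNat PowerSeries.C 12, ← map_mul]; norm_num
  linear_combination 12 * h + (e2Series ℂ ^ 2 - e4Series ℂ) * hc

end Analysis

/-! ### Ramanujan's equations over an arbitrary ring, via ℤ -/

section Ramanujan

variable {K : Type*} [CommRing K]

lemma powerSeries_int_eq_of_complex {f g : ℤ⟦X⟧}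
    (h : PowerSeries.map (Int.castRingHom ℂ) f = PowerSeries.map (Int.castRingHom ℂ) g) : f = g :=
  PowerSeries.map_injective _ (RingHom.injective_int _) h

/-- Ramanujan's differential equation for the Eisenstein series of weight `2`. -/
theorem thetaOperator_e2Series :
    12 * thetaOperator (e2Series K) = e2Series K ^ 2 - e4Series K := by
  have h : 12 * thetaOperator (e2Series ℤ) = e2Series ℤ ^ 2 - e4Series ℤ :=
    powerSeries_int_eq_of_complex (by
      simpa [map_thetaOperator, map_eisSeries, map_ofNat] using thetaOperator_e2Series_complex)
  simpa [map_thetaOperator, map_eisSeries, map_ofNat] using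
    congrArg (PowerSeries.map (Int.castRingHom K)) h

/-- Ramanujan's differential equation for the Eisenstein series of weight `4`. -/
theorem thetaOperator_e4Series :
    3 * thetaOperator (e4Series K) = e2Series K * e4Series K - e6Series K := by
  have h : 3 * thetaOperator (e4Series ℤ) = e2Series ℤ * e4Series ℤ - e6Series ℤ :=
    powerSeries_int_eq_of_complex (by
      simpa [map_thetaOperator, map_eisSeries, map_ofNat] using thetaOperator_e4Series_complex)
  simpa [map_thetaOperator, map_eisSeries, map_ofNat] using
    congrArg (PowerSeries.map (Int.castRingHom K)) h

/-- Ramanujan's differential equation for the Eisenstein series of weight `6`. -/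
theorem thetaOperator_e6Series :
    2 * thetaOperator (e6Series K) = e2Series K * e6Series K - e4Series K ^ 2 := by
  have h : 2 * thetaOperator (e6Series ℤ) = e2Series ℤ * e6Series ℤ - e4Series ℤ ^ 2 :=
    powerSeries_int_eq_of_complex (by
      simpa [map_thetaOperator, map_eisSeries, map_ofNat] using thetaOperator_e6Series_complex)
  simpa [map_thetaOperator, map_eisSeries, map_ofNat] using
    congrArg (PowerSeries.map (Int.castRingHom K)) h

open MvPolynomial in
/-- The theta operator on isobaric polynomials in the Eisenstein series. -/
theorem thetaOperator_qEval {P : MvPolynomial (Fin 2) K} {w : ℕ} (h : Isobaric P w) :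
    12 * thetaOperator (qEval K P) =
      qEval K (serreDer K P) + w * e2Series K * qEval K P := by
  refine h.induction (motive := fun P => 12 * thetaOperator (qEval K P) =
      qEval K (serreDer K P) + w * e2Series K * qEval K P) ?_ ?_ ?_
  · simp
  · intro P P' h h'
    simp only [map_add, thetaOperator_add, mul_add, h, h']; ring
  · rintro a b c rfl
    have h4 := thetaOperator_e4Series (K := K)
    have h6 := thetaOperator_e6Series (K := K)
    rw [serreDer_monomial]
    simp only [map_mul, map_pow, map_add, qEval_C, qEval_Q, qEval_R, map_natCast, map_neg,
      map_ofNat, thetaOperator_mul, thetaOperator_C, thetaOperator_pow]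
    have key : ∀ (n : ℕ) (x : K⟦X⟧), (n : K⟦X⟧) * x ^ (n - 1) * x = n * x ^ n := by
      intro n x
      rcases n with _ | n
      · simp
      · rw [Nat.add_sub_cancel]; ring
    have ha := key a (e4Series K)
    have hb := key b (e6Series K)
    push_cast
    linear_combination 4 * PowerSeries.C c * (a * e4Series K ^ (a - 1)) * e6Series K ^ b * h4 +
      6 * PowerSeries.C c * (b * e6Series K ^ (b - 1)) * e4Series K ^ a * h6 +
      4 * PowerSeries.C c * e6Series K ^ b * e2Series K * ha +
      6 * PowerSeries.C c * e4Series K ^ a * e2Series K * hb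

end Ramanujan

lemma isUnit_1728_pIntegral {p : ℕ} [Fact p.Prime] (hp5 : 5 ≤ p) :
    IsUnit (1728 : pIntegralRationals p) :=
  pIntegralRationals.isUnit_of_reduction_ne_zero (by
    rw [map_ofNat]; exact ZMod.natCast_1728_ne_zero hp5)

lemma pIntegralToComplex_injective (p : ℕ) : Function.Injective (pIntegralToComplex p) :=
  (algebraMap ℚ ℂ).injective.comp Subtype.val_injective

/-! ### Integral structure theorem: forms are isobaric polynomials -/

section StructureTheorem

open MvPolynomial

open ModularForm EisensteinSeries UpperHalfPlane

lemma exists_modularForm_of_isobaric {P : MvPolynomial (Fin 2) ℂ} {w : ℕ} (h : Isobaric P w) :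
    ∃ F : ModularForm 𝒮ℒ (w : ℤ), qExpansion 1 F = qEval ℂ P := by
  refine h.induction
    (motive := fun P => ∃ F : ModularForm 𝒮ℒ (w : ℤ), qExpansion 1 F = qEval ℂ P) ?_ ?_ ?_
  · exact ⟨0, by simpa using! qExpansion_zero 1⟩
  · rintro P P' ⟨F, hF⟩ ⟨F', hF'⟩
    refine ⟨F + F', ?_⟩
    rw [FunLike.coe_add, ModularForm.qExpansion_add one_pos one_mem_strictPeriods_SL, hF, hF',
      map_add]
  · intro a b c hw
    refine ⟨c • mcast (by rw [← hw]; push_cast; ring) ((E₄.pow a).mul (E₆.pow b)), ?_⟩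
    rw [FunLike.coe_smul, ModularForm.qExpansion_smul one_pos one_mem_strictPeriods_SL,
      ModularForm.qExpansion_mcast, ModularForm.qExpansion_mul one_pos one_mem_strictPeriods_SL,
      ModularForm.qExpansion_pow one_pos one_mem_strictPeriods_SL,
      ModularForm.qExpansion_pow one_pos one_mem_strictPeriods_SL, qExpansion_E4, qExpansion_E6,
      PowerSeries.smul_eq_C_mul]
    simp [mul_assoc]

lemma qExpansion_weight_two (f : ModularForm 𝒮ℒ 2) : qExpansion 1 f = 0 := by
  have h := levelOne_weight_two_rank_zero
  rw [rank_zero_iff_forall_zero] at h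
  rw [h f]
  exact qExpansion_zero 1

lemma qExpansion_weight_zero (f : ModularForm 𝒮ℒ 0) :
    ∃ c : ℂ, qExpansion 1 f = PowerSeries.C c := by
  obtain ⟨c, hc⟩ := ModularFormClass.levelOne_weight_zero_const f
  refine ⟨c, ?_⟩
  have h1 : (f : ℍ → ℂ) = c • (1 : ModularForm 𝒮ℒ 0) := by
    rw [hc]; ext z; simp
  rw [h1, ModularForm.qExpansion_smul one_pos one_mem_strictPeriods_SL,
    ModularForm.qExpansion_one, PowerSeries.smul_eq_C_mul, mul_one]

lemma qExpansion_discriminant :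
    (1728 : ℂ⟦X⟧) * qExpansion 1 discriminant = e4Series ℂ ^ 3 - e6Series ℂ ^ 2 := by
  have h : ((1728 : ℂ) • (CuspForm.discriminant : ℍ → ℂ)) = ⇑(E₄.pow 3) - ⇑(E₆.pow 2) := by
    ext z
    have := discriminant_eq_E₄_cube_sub_E₆_sq z
    simp only [Pi.smul_apply, smul_eq_mul, Pi.sub_apply, ModularForm.coe_pow, Pi.pow_apply,
      CuspForm.coe_discriminant]
    rw [this]; ring
  have h1 := ModularForm.qExpansion_sub one_pos one_mem_strictPeriods_SL (E₄.pow 3) (E₆.pow 2)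
  rw [← h, ModularForm.qExpansion_smul one_pos one_mem_strictPeriods_SL,
    ModularForm.qExpansion_pow one_pos one_mem_strictPeriods_SL,
    ModularForm.qExpansion_pow one_pos one_mem_strictPeriods_SL, qExpansion_E4, qExpansion_E6,
    PowerSeries.smul_eq_C_mul, map_ofNat] at h1
  exact h1

variable {p : ℕ} [Fact p.Prime]

/-- The `q`-expansion of a level one form whose coefficients lie in a subring in which `1728` is
invertible is an isobaric polynomial in the Eisenstein series with coefficients in the subring. -/
lemma exists_isobaric_of_modularForm (hp5 : 5 ≤ p) {w : ℕ} (F : ModularForm 𝒮ℒ (w : ℤ))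
    {f : (pIntegralRationals p)⟦X⟧}
    (hF : qExpansion 1 F = PowerSeries.map (pIntegralToComplex p) f) :
    ∃ P, Isobaric P w ∧ qEval (pIntegralRationals p) P = f := by
  set ι := pIntegralToComplex p
  have hι := PowerSeries.map_injective ι (pIntegralToComplex_injective p)
  induction w using Nat.strong_induction_on generalizing f with
  | _ w ih =>
    have hzero : qExpansion 1 F = 0 → ∃ P, Isobaric P w ∧ qEval (pIntegralRationals p) P = f := by
      intro h0
      refine ⟨0, isobaric_zero w, ?_⟩
      rw [map_zero]
      apply hι
      rw [← hF, h0, map_zero]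
    rcases Nat.even_or_odd w with hw | hw
    swap
    · apply hzero
      rw [levelOne_odd_weight_eq_zero (by exact_mod_cast hw) F]
      exact qExpansion_zero 1
    by_cases h2 : w = 2
    · subst h2
      exact hzero (qExpansion_weight_two F)
    by_cases hw0 : w = 0
    · subst hw0
      obtain ⟨c, hc⟩ := qExpansion_weight_zero F
      refine ⟨C (PowerSeries.constantCoeff f), isWeightedHomogeneous_C _ _, ?_⟩
      apply hι
      rw [← hF, hc, qEval_C, PowerSeries.map_C]
      congr 1
      have := congrArg (PowerSeries.coeff 0) (hF.symm.trans hc)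
      rwa [PowerSeries.coeff_map, PowerSeries.coeff_zero_C,
        PowerSeries.coeff_zero_eq_constantCoeff_apply] at this
    have hiso := isobaric_normalMonomial (K := pIntegralRationals p) hw h2
    set M := normalMonomial (pIntegralRationals p) w
    set a := PowerSeries.constantCoeff f
    obtain ⟨G, hG⟩ := exists_modularForm_of_isobaric ((hiso.C_mul a).map ι)
    rw [← map_qEval] at hG
    have hFG : qExpansion 1 (F - G : ModularForm 𝒮ℒ (w : ℤ)) =
        PowerSeries.map ι (f - qEval _ (C a * M)) := by
      rw [FunLike.coe_sub, ModularForm.qExpansion_sub one_pos one_mem_strictPeriods_SL, hF, hG,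
        map_sub]
    have hc : PowerSeries.constantCoeff (f - qEval _ (C a * M)) = 0 := by
      rw [map_sub, map_mul, map_mul, constantCoeff_qEval_normalMonomial]
      simp [a]
    have hc' : (qExpansion 1 (F - G : ModularForm 𝒮ℒ (w : ℤ))).coeff 0 = 0 := by
      rw [hFG, PowerSeries.coeff_map, PowerSeries.coeff_zero_eq_constantCoeff_apply, hc, map_zero]
    rcases lt_or_ge w 12 with hw12 | hw12
    · refine ⟨C a * M, hiso.C_mul a, ?_⟩
      have := qExpansion_eq_of_coeff_zero_eq (k := w) (by omega) (F - G) 0 (by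
        rw [hc', FunLike.coe_zero, qExpansion_zero, map_zero])
      rw [FunLike.coe_zero, qExpansion_zero, hFG] at this
      have h0 := hι (this.trans (map_zero _).symm)
      exact (sub_eq_zero.1 h0).symm
    · obtain ⟨u, hu, hu'⟩ := exists_qEval_discriminant (isUnit_1728_pIntegral hp5)
      obtain ⟨g, hg⟩ := PowerSeries.X_dvd_iff.2 hc
      obtain ⟨u', huu'⟩ := hu.exists_right_inv
      have hΔ := qExpansion_eq_qExpansion_discriminant_mul (F - G) hc'
      set H := CuspForm.discriminantEquiv ((F - G).toCuspForm hc')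
      have hdisc : (1728 : ℂ⟦X⟧) * qExpansion 1 discriminant =
          PowerSeries.map ι (PowerSeries.X * u) := by
        rw [← hu', map_qEval]
        simp only [map_sub, map_pow, map_X, qEval_Q, qEval_R]
        exact qExpansion_discriminant
      have h1728 : (1728 : ℂ⟦X⟧) * PowerSeries.C ((1728 : ℂ)⁻¹) = 1 := by
        rw [← map_ofNat PowerSeries.C 1728, ← map_mul]; norm_num
      have hΔ0 : PowerSeries.map ι (PowerSeries.X * u) ≠ 0 := by
        rw [Ne, map_eq_zero_iff _ hι]
        exact mul_ne_zero PowerSeries.X_ne_zero hu.ne_zero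
      -- Here f - aM = Xg and Q³ - R² = Xu with u a unit, so the quotient has the integral expansion
      -- u⁻¹g. The factor 1728⁻¹ enters because Q³ - R² is 1728 times the discriminant.
      obtain ⟨P, hP, hP'⟩ := ih (w - 12) (by omega) (mcast (by omega) ((1728 : ℂ)⁻¹ • H))
        (f := u' * g) (by
          rw [ModularForm.qExpansion_mcast, FunLike.coe_smul,
            ModularForm.qExpansion_smul one_pos one_mem_strictPeriods_SL, PowerSeries.smul_eq_C_mul]
          apply mul_left_cancel₀ hΔ0
          rw [hFG, hg] at hΔ
          have h1 := congrArg (PowerSeries.map ι) huu'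
          simp only [map_mul, map_one] at hdisc h1 hΔ ⊢
          rw [← hdisc]
          linear_combination qExpansion 1 discriminant * qExpansion 1 H * h1728 - hΔ +
            PowerSeries.map ι u' * PowerSeries.map ι g * (-hdisc) -
            PowerSeries.map ι PowerSeries.X * PowerSeries.map ι g * h1)
      refine ⟨C a * M + (X 0 ^ 3 - X 1 ^ 2) * P, (hiso.C_mul a).add ?_, ?_⟩
      · exact (((isobaric_Q.pow 3).sub (isobaric_R.pow 2)).mul hP).cast (by omega)
      · rw [map_add, map_mul _ (X 0 ^ 3 - X 1 ^ 2), hu', hP']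
        linear_combination -hg + PowerSeries.X * g * huu'

/-- The modular forms with `p`-integral coefficients are exactly the isobaric polynomials in the
Eisenstein series of weights `4` and `6` with `p`-integral coefficients. -/
theorem mem_pIntegralModularForms_iff (hp5 : 5 ≤ p) {w : ℕ} {f : (pIntegralRationals p)⟦X⟧} :
    f ∈ pIntegralModularForms p w ↔ ∃ P, Isobaric P w ∧ qEval (pIntegralRationals p) P = f := by
  constructor
  · rintro ⟨F, hF⟩
    exact exists_isobaric_of_modularForm hp5 F hF
  · rintro ⟨P, hP, rfl⟩
    obtain ⟨F, hF⟩ := exists_modularForm_of_isobaric (hP.map (pIntegralToComplex p))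
    exact ⟨F, by rw [hF, map_qEval]⟩

end StructureTheorem

/-! ### The Eisenstein series of weight p - 1 -/

section HasseInvariant

open MvPolynomial

open ModularForm EisensteinSeries UpperHalfPlane

variable {p : ℕ} [Fact p.Prime]

lemma inv_prime_mem_pIntegralRationals {q : ℕ} (hq : q.Prime) (hqp : q ≠ p) :
    (1 / q : ℚ) ∈ pIntegralRationals p := by
  refine pIntegralRationals.mem_of_mul_eq (n := 1) (m := q) ?_ ?_
  · have : ((q : ℤ) : ZMod p) = (q : ZMod p) := by push_cast; rfl
    rw [this]
    apply ZMod.natCast_ne_zero_of_coprime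
    rwa [Nat.prime_dvd_prime_iff_eq Fact.out hq, eq_comm]
  · have : (q : ℚ) ≠ 0 := by exact_mod_cast hq.ne_zero
    push_cast; field_simp

/-- The `p`-part of the von Staudt–Clausen theorem in degree `p - 1`. -/
lemma exists_prime_mul_bernoulli_eq (hp5 : 5 ≤ p) :
    ∃ t : pIntegralRationals p, (p : ℚ) * bernoulli (p - 1) = ((-1 + p * t : pIntegralRationals p) : ℚ) := by
  have hp : p.Prime := Fact.out
  obtain ⟨k, hk⟩ : ∃ k, p - 1 = 2 * k := by
    obtain ⟨k, hk⟩ := hp.even_sub_one (by omega)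
    exact ⟨k, by omega⟩
  obtain ⟨n, hn⟩ := Bernoulli.vonStaudt_clausen k
  set S := (Finset.range (2 * k + 2)).filter fun q => q.Prime ∧ (q - 1) ∣ 2 * k
  have hpS : p ∈ S := by
    simp only [S, Finset.mem_filter, Finset.mem_range]
    exact ⟨by omega, hp, by rw [← hk]⟩
  have ht : (∑ q ∈ S.erase p, (1 : ℚ) / q) ∈ pIntegralRationals p := by
    refine sum_mem fun q hq => ?_
    rw [Finset.mem_erase] at hq
    simp only [S, Finset.mem_filter] at hq
    exact inv_prime_mem_pIntegralRationals hq.2.2.1 hq.1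
  refine ⟨n - ⟨_, ht⟩, ?_⟩
  rw [← Finset.add_sum_erase _ _ hpS] at hn
  have hp0 : (p : ℚ) ≠ 0 := by exact_mod_cast hp.ne_zero
  rw [hk]
  push_cast
  rw [hn]
  field_simp
  ring

/-- The Eisenstein series of weight `p - 1` is an isobaric polynomial with `p`-integral
coefficients, and it is congruent to `1` modulo `p`. -/
theorem exists_hasse (hp5 : 5 ≤ p) :
    ∃ (c : pIntegralRationals p) (A : MvPolynomial (Fin 2) (pIntegralRationals p)),
      pIntegralRationals.reduction p c ≠ 0 ∧ Isobaric A (p - 1) ∧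
      qEval _ A = eisSeries _ (p * c) (p - 2) := by
  have hp : p.Prime := Fact.out
  obtain ⟨t, ht⟩ := exists_prime_mul_bernoulli_eq (p := p) hp5
  have hu : IsUnit (-1 + p * t : pIntegralRationals p) :=
    pIntegralRationals.isUnit_of_reduction_ne_zero (by simp)
  obtain ⟨v, hv⟩ := hu.exists_right_inv
  have hp1 : ((p - 1 : ℕ) : pIntegralRationals p) = p - 1 := by
    rw [Nat.cast_sub hp.one_le, Nat.cast_one]
  refine ⟨-2 * (p - 1 : ℕ) * v, ?_⟩
  have hE : qExpansion 1 (E (k := p - 1) (by omega)) =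
      PowerSeries.map (pIntegralToComplex p)
        (eisSeries _ (p * (-2 * (p - 1 : ℕ) * v)) (p - 2)) := by
    ext m
    rw [E_qExpansion_coeff _ (hp.even_sub_one (by omega)), map_eisSeries, coeff_eisSeries]
    congr 2
    have hv' : (p : ℚ) * bernoulli (p - 1) * v = 1 := by
      rw [ht]; exact_mod_cast congrArg Subtype.val hv
    have hb : (bernoulli (p - 1) : ℚ) ≠ 0 := by
      intro h0; rw [h0] at hv'; simp at hv'
    have h1 : -(2 * ((p - 1 : ℕ) : ℚ) / bernoulli (p - 1)) =
        ((p * (-2 * (p - 1 : ℕ) * v) : pIntegralRationals p) : ℚ) := by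
      push_cast
      rw [neg_eq_iff_eq_neg, div_eq_iff hb, show ((2 : pIntegralRationals p) : ℚ) = 2 from rfl]
      linear_combination (-2 * ((p - 1 : ℕ) : ℚ)) * hv'
    have h2 := congrArg (algebraMap ℚ ℂ) h1
    rw [pIntegralToComplex, RingHom.comp_apply]
    rw [Subring.subtype_apply, ← h2]
    simp
  obtain ⟨A, hA, hA'⟩ := exists_isobaric_of_modularForm hp5 _ hE
  refine ⟨A, ?_, hA, hA'⟩
  -- Modulo p the inverse v of -1 + pt is -1, so c reduces to -2.
  rw [hp1]
  have hv0 := congrArg (pIntegralRationals.reduction p) hv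
  simp only [map_mul, map_add, map_neg, map_one, map_natCast, CharP.cast_eq_zero, zero_mul,
    add_zero, map_sub, map_ofNat] at hv0 ⊢
  rw [zero_sub, mul_assoc, hv0, mul_one, neg_ne_zero]
  have : ((2 : ℕ) : ZMod p) ≠ 0 :=
    ZMod.natCast_ne_zero_of_coprime fun h => by have := Nat.le_of_dvd two_pos h; omega
  exact_mod_cast this

end HasseInvariant

/-! ### Factors of isobaric polynomials -/

section IsobaricFactors

open MvPolynomial

variable {K : Type*} [CommRing K]

/-- The homomorphism `Q ↦ Q T ^ 4`, `R ↦ R T ^ 6`, whose coefficients are the isobaric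
components. -/
noncomputable def weightHom (K : Type*) [CommRing K] :
    MvPolynomial (Fin 2) K →ₐ[K] Polynomial (MvPolynomial (Fin 2) K) :=
  aeval fun i => Polynomial.C (X i) * Polynomial.X ^ (![4, 6] i : ℕ)

lemma weightHom_monomial (d : Fin 2 →₀ ℕ) (c : K) :
    weightHom K (monomial d c) =
      Polynomial.C (monomial d c) * Polynomial.X ^ (4 * d 0 + 6 * d 1) := by
  rw [weightHom, aeval_monomial, monomial_eq, Finsupp.prod_fintype _ _ (by simp),
    Finsupp.prod_fintype _ _ (by simp), Fin.prod_univ_two, Fin.prod_univ_two,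
    Polynomial.C_mul, Polynomial.C_mul, IsScalarTower.algebraMap_apply K (MvPolynomial (Fin 2) K)]
  simp only [Matrix.cons_val_zero, Matrix.cons_val_one, Polynomial.C_pow, mul_pow, ← pow_mul,
    algebraMap_eq, Polynomial.algebraMap_eq, pow_add]
  ring

lemma coeff_weightHom (P : MvPolynomial (Fin 2) K) (n : ℕ) :
    (weightHom K P).coeff n = weightedHomogeneousComponent ![4, 6] n P := by
  induction P using MvPolynomial.induction_on' with
  | monomial d c =>
    rw [weightHom_monomial, Polynomial.coeff_C_mul, Polynomial.coeff_X_pow]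
    have h : IsWeightedHomogeneous ![4, 6] (monomial d c) (4 * d 0 + 6 * d 1) :=
      isWeightedHomogeneous_monomial _ _ _ (weight_fin_two d)
    split_ifs with hn
    · rw [hn, h.weightedHomogeneousComponent_same, mul_one]
    · rw [h.weightedHomogeneousComponent_ne n hn, mul_zero]
  | add P P' h h' => rw [map_add, Polynomial.coeff_add, h, h', map_add]

lemma Isobaric.weightHom_eq {P : MvPolynomial (Fin 2) K} {w : ℕ} (h : Isobaric P w) :
    weightHom K P = Polynomial.C P * Polynomial.X ^ w := by
  ext1 n
  rw [coeff_weightHom, Polynomial.coeff_C_mul, Polynomial.coeff_X_pow]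
  split_ifs with hn
  · rw [hn, h.weightedHomogeneousComponent_same, mul_one]
  · rw [h.weightedHomogeneousComponent_ne n hn, mul_zero]

lemma isobaric_of_weightHom_coeff {P : MvPolynomial (Fin 2) K} {w : ℕ}
    (h : ∀ n, n ≠ w → (weightHom K P).coeff n = 0) : Isobaric P w := by
  intro d hd
  by_contra hne
  have := h _ hne
  rw [coeff_weightHom] at this
  apply hd
  have h1 := congrArg (coeff d) this
  rwa [coeff_weightedHomogeneousComponent, if_pos rfl, coeff_zero] at h1

/-- Degree and trailing degree are both additive over a domain. They agree on the product, so they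
agree on each factor. -/
lemma Polynomial.exists_forall_coeff_eq_zero_of_mul_eq {D : Type*} [CommRing D] [IsDomain D]
    {f g : Polynomial D} {a : D} {n : ℕ} (ha : a ≠ 0) (h : f * g = Polynomial.C a * Polynomial.X ^ n) :
    ∃ v v', v + v' = n ∧ (∀ m, m ≠ v → f.coeff m = 0) ∧ (∀ m, m ≠ v' → g.coeff m = 0) := by
  have hne : f * g ≠ 0 := by
    rw [h]; exact mul_ne_zero (Polynomial.C_ne_zero.2 ha) (pow_ne_zero _ Polynomial.X_ne_zero)
  have hf := left_ne_zero_of_mul hne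
  have hg := right_ne_zero_of_mul hne
  have h1 := Polynomial.natDegree_mul hf hg
  have h2 := Polynomial.natTrailingDegree_mul hf hg
  rw [h, Polynomial.natDegree_C_mul_X_pow n a ha] at h1
  rw [h, Polynomial.natTrailingDegree_mul_X_pow (Polynomial.C_ne_zero.2 ha),
    Polynomial.natTrailingDegree_C, zero_add] at h2
  have h3 := Polynomial.natTrailingDegree_le_natDegree f
  have h4 := Polynomial.natTrailingDegree_le_natDegree g
  refine ⟨f.natDegree, g.natDegree, h1.symm, fun m hm => ?_, fun m hm => ?_⟩
  · rcases lt_or_gt_of_ne hm with h | h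
    · exact Polynomial.coeff_eq_zero_of_lt_natTrailingDegree (by omega)
    · exact Polynomial.coeff_eq_zero_of_natDegree_lt h
  · rcases lt_or_gt_of_ne hm with h | h
    · exact Polynomial.coeff_eq_zero_of_lt_natTrailingDegree (by omega)
    · exact Polynomial.coeff_eq_zero_of_natDegree_lt h

/-- The factors of a nonzero isobaric polynomial are isobaric. -/
theorem Isobaric.exists_of_eq_mul [IsDomain K] {A P P' : MvPolynomial (Fin 2) K} {w : ℕ}
    (h : Isobaric A w) (hA : A ≠ 0) (e : A = P * P') :
    ∃ v v', v + v' = w ∧ Isobaric P v ∧ Isobaric P' v' := by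
  have h1 := h.weightHom_eq
  rw [e, map_mul, ← e] at h1
  obtain ⟨v, v', hv, hP, hP'⟩ := Polynomial.exists_forall_coeff_eq_zero_of_mul_eq hA h1
  exact ⟨v, v', hv, isobaric_of_weightHom_coeff hP, isobaric_of_weightHom_coeff hP'⟩

end IsobaricFactors

/-! ### Orders at a prime element -/

section PrimePowers

open MvPolynomial

variable {D : Type*} [CommRing D] [IsDomain D]

lemma Prime.eq_of_pow_mul_eq {π x y : D} (hπ : Prime π) {a b : ℕ} (h : π ^ a * x = π ^ b * y)
    (hx : ¬ π ∣ x) (hy : ¬ π ∣ y) : a = b := by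
  wlog hab : a ≤ b generalizing a b x y
  · exact (this h.symm hy hx (by omega)).symm
  obtain ⟨c, rfl⟩ := Nat.exists_eq_add_of_le hab
  rw [pow_add, mul_assoc] at h
  have h1 := mul_left_cancel₀ (pow_ne_zero a hπ.ne_zero) h
  rcases c with _ | c
  · rfl
  · exact absurd ⟨π ^ c * y, by rw [h1]; ring⟩ hx

lemma Prime.exists_eq_pow_mul [UniqueFactorizationMonoid D] {π x : D} (hπ : Prime π) (hx : x ≠ 0) :
    ∃ (a : ℕ) (y : D), x = π ^ a * y ∧ ¬ π ∣ y :=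
  let ⟨y, hy⟩ := (FiniteMultiplicity.of_prime_left hπ hx).exists_eq_pow_mul_and_not_dvd
  ⟨_, y, hy⟩

end PrimePowers

/-! ### The Hasse invariant modulo p and its derivative -/

section ModP

open MvPolynomial

variable {p : ℕ} [Fact p.Prime]

lemma isUnit_1728_zmod (hp5 : 5 ≤ p) : IsUnit (1728 : ZMod p) :=
  (ZMod.natCast_1728_ne_zero hp5).isUnit

lemma cast_sub_one_zmod : ((p - 1 : ℕ) : ZMod p) = -1 := by
  rw [Nat.cast_sub (Fact.out : p.Prime).one_le]; simp

variable {A : MvPolynomial (Fin 2) (ZMod p)}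

/-- The derivative of the Hasse invariant has the same `q`-expansion as the Eisenstein series of
weight `2`. -/
lemma qEval_serreDer_hasse (hA : Isobaric A (p - 1)) (hqA : qEval _ A = 1) :
    qEval _ (serreDer _ A) = e2Series (ZMod p) := by
  have h := thetaOperator_qEval hA
  have hc : ((p - 1 : ℕ) : (ZMod p)⟦X⟧) = -1 := by
    rw [← map_natCast (PowerSeries.C (R := ZMod p)), cast_sub_one_zmod]; simp
  rw [hqA, thetaOperator_one, hc] at h
  linear_combination -h

/-- Since ∂A represents E₂ modulo p and its weight p + 1 is 1 modulo p, the formula for θ on ∂A can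
be compared with Ramanujan's equation 12θE₂ = E₂² - E₄. This second-order equation plays the role of
the differential equation in Igusa's theorem that the Hasse invariant has simple zeros. -/
lemma serreDer_serreDer_hasse (hp5 : 5 ≤ p) (hA : Isobaric A (p - 1)) (hqA : qEval _ A = 1) :
    serreDer _ (serreDer _ A) = -X 0 * A := by
  have hB := isobaric_serreDer hA
  refine (isobaric_serreDer hB).ext_qEval (isUnit_1728_zmod hp5)
    (w := p - 1 + 2 + 2) ?_ ?_
  · rw [neg_mul, ← neg_one_mul]
    have := ((isobaric_Q (K := ZMod p)).mul hA).intCast_mul (-1)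
    simpa using this.cast (by omega)
  · have h := thetaOperator_qEval hB
    have h2 := thetaOperator_e2Series (K := ZMod p)
    have hc : ((p - 1 + 2 : ℕ) : (ZMod p)⟦X⟧) = 1 := by
      rw [← map_natCast (PowerSeries.C (R := ZMod p)), Nat.cast_add, cast_sub_one_zmod,
        ← map_one PowerSeries.C]
      congr 1; push_cast; ring
    rw [qEval_serreDer_hasse hA hqA, hc] at h
    rw [map_mul, map_neg, qEval_Q, hqA]
    linear_combination h2 - h

lemma hasse_ne_zero (hqA : qEval _ A = 1) : A ≠ 0 := by
  rintro rfl
  simp at hqA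

/-- A factor of weight 0 would be a nonzero constant, hence a unit. The bound v < p keeps v nonzero
in F_p and bounds the multiplicity of π in A. -/
lemma exists_isobaric_of_irreducible_dvd_hasse (hA : Isobaric A (p - 1))
    (hqA : qEval _ A = 1) {π : MvPolynomial (Fin 2) (ZMod p)} (hπ : Irreducible π) (h : π ∣ A) :
    ∃ v, 0 < v ∧ v < p ∧ Isobaric π v := by
  obtain ⟨P, hP⟩ := h
  obtain ⟨v, v', hv, hπv, -⟩ := hA.exists_of_eq_mul (hasse_ne_zero hqA) hP
  have := (Fact.out : p.Prime).one_le
  refine ⟨v, Nat.pos_of_ne_zero ?_, by omega, hπv⟩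
  rintro rfl
  have h1 := hπv.eq_C
  have h0 : coeff 0 π ≠ 0 := by
    intro h0
    rw [h0, map_zero] at h1
    exact hπ.ne_zero h1
  rw [h1] at hπ
  exact hπ.not_isUnit ((h0.isUnit).map C)

/-- A quotient of ∂π by π would have weight 2, where there are no monomials; so ∂π = 0 and 12θπ =
vE₂π. Constant terms then contradict v ≠ 0 in F_p, because π divides a form with constant term 1. -/
lemma not_dvd_serreDer_of_irreducible (hA : Isobaric A (p - 1))
    (hqA : qEval _ A = 1) {π : MvPolynomial (Fin 2) (ZMod p)} (hπ : Irreducible π) (h : π ∣ A) :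
    ¬ π ∣ serreDer _ π := by
  rintro ⟨u, hu⟩
  obtain ⟨v, hv0, hvp, hπv⟩ := exists_isobaric_of_irreducible_dvd_hasse hA hqA hπ h
  obtain ⟨P, hP⟩ := h
  have hder : serreDer _ π = 0 := by
    by_contra hne
    obtain ⟨a, b, hab, ha, hb⟩ := (isobaric_serreDer hπv).exists_of_eq_mul hne hu
    have hav : a = v := IsWeightedHomogeneous.inj_right hπ.ne_zero ha hπv
    have hu0 := hb.eq_zero_of_forall (fun x y => by omega)
    rw [hu, hu0, mul_zero] at hne
    exact hne rfl
  have h1 := thetaOperator_qEval hπv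
  rw [hder, map_zero, zero_add] at h1
  have h2 := congrArg PowerSeries.constantCoeff h1
  have h3 := congrArg PowerSeries.constantCoeff (congrArg (qEval _) hP)
  rw [hqA, map_mul, map_mul, map_one] at h3
  simp only [map_mul, constantCoeff_thetaOperator, mul_zero, constantCoeff_eisSeries, mul_one,
    map_natCast] at h2
  rcases mul_eq_zero.1 h2.symm with h4 | h4
  · rw [ZMod.natCast_eq_zero_iff] at h4
    exact absurd (Nat.le_of_dvd hv0 h4) (by omega)
  · rw [h4, zero_mul] at h3
    exact one_ne_zero h3

/-- Let m be the multiplicity of π in A. If m = 1, then ∂A is ∂π times the cofactor modulo π. If m ≥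
2, the leading term m(m-1)π^{m-2}(∂π)² of ∂∂A, times the cofactor, has order only m - 2, while ∂∂A =
-QA has order at least m; here 0 < m < p makes m(m-1) a unit. -/
lemma not_dvd_serreDer_of_irreducible_dvd_hasse (hp5 : 5 ≤ p) (hA : Isobaric A (p - 1))
    (hqA : qEval _ A = 1) {π : MvPolynomial (Fin 2) (ZMod p)} (hπ : Irreducible π) (h : π ∣ A) :
    ¬ π ∣ serreDer _ A := by
  have hprime := hπ.prime
  have hder := not_dvd_serreDer_of_irreducible hA hqA hπ h
  obtain ⟨n, P, hP, hPπ⟩ := hprime.exists_eq_pow_mul (hasse_ne_zero hqA)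
  have hd1 : serreDer _ A = n * π ^ (n - 1) * serreDer _ π * P + π ^ n * serreDer _ P := by
    rw [hP, Derivation.leibniz, Derivation.leibniz_pow]
    simp only [smul_eq_mul, nsmul_eq_mul]
    ring
  intro hB
  rcases n with _ | _ | n
  · rw [pow_zero, one_mul] at hP
    exact hPπ (hP ▸ h)
  · rw [hd1] at hB
    have h1 : π ∣ serreDer _ π * P := by
      have := (dvd_add_left (dvd_mul_right π (serreDer _ P))).1 (by simpa using hB)
      simpa using this
    exact (hprime.dvd_or_dvd h1).elim hder hPπ
  · obtain ⟨v₀, hv₀, -, hπv₀⟩ := exists_isobaric_of_irreducible_dvd_hasse hA hqA hπ h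
    obtain ⟨v, v', hv, hπv, -⟩ := hA.exists_of_eq_mul (hasse_ne_zero hqA) hP
    have hvv : v = (n + 1 + 1) * v₀ := IsWeightedHomogeneous.inj_right
      (pow_ne_zero _ hprime.ne_zero) hπv (hπv₀.pow (n + 1 + 1))
    have hnp : n + 2 < p := by
      have := (Fact.out : p.Prime).one_le
      have := Nat.le_mul_of_pos_right (n + 1 + 1) hv₀
      omega
    have hd2 : serreDer _ (serreDer _ A) = π ^ n * (((n + 2) * (n + 1) : ℕ) * ((serreDer _ π) ^ 2 * P)) +
        π ^ (n + 1) * (2 * (n + 2 : ℕ) * serreDer _ π * serreDer _ P +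
          (n + 2 : ℕ) * P * serreDer _ (serreDer _ π) + π * serreDer _ (serreDer _ P)) := by
      rw [hd1]
      simp only [map_add, Derivation.leibniz, Derivation.leibniz_pow, smul_eq_mul, nsmul_eq_mul,
        Derivation.map_natCast]
      push_cast
      ring
    rw [serreDer_serreDer_hasse hp5 hA hqA] at hd2
    have h1 : π ^ (n + 1) ∣ π ^ n * (((n + 2) * (n + 1) : ℕ) * ((serreDer _ π) ^ 2 * P)) := by
      have h5 : π ^ (n + 1) ∣ -X 0 * A := by
        refine Dvd.dvd.mul_left ?_ _
        rw [hP]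
        exact (pow_dvd_pow π (by omega)).mul_right P
      rw [hd2] at h5
      exact (dvd_add_left (dvd_mul_right _ _)).1 h5
    rw [pow_succ] at h1
    have h2 := (mul_dvd_mul_iff_left (pow_ne_zero n hprime.ne_zero)).1 h1
    rcases hprime.dvd_or_dvd h2 with h3 | h3
    · have h0 : (((n + 2) * (n + 1) : ℕ) : ZMod p) ≠ 0 := by
        refine ZMod.natCast_ne_zero_of_coprime fun hd => ?_
        rcases (Fact.out : p.Prime).dvd_mul.1 hd with hd | hd <;>
          exact absurd (Nat.le_of_dvd (by omega) hd) (by omega)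
      rw [← map_natCast (C (σ := Fin 2) (R := ZMod p))] at h3
      exact hprime.not_isUnit (isUnit_of_dvd_unit h3 (h0.isUnit.map C))
    · rcases hprime.dvd_or_dvd h3 with h4 | h4
      · exact hder (hprime.dvd_of_dvd_pow h4)
      · exact hPπ h4

/-- The Hasse invariant is relatively prime to its derivative. -/
theorem isRelPrime_hasse (hp5 : 5 ≤ p) (hA : Isobaric A (p - 1))
    (hqA : qEval _ A = 1) : IsRelPrime A (serreDer _ A) :=
  WfDvdMonoid.isRelPrime_of_no_irreducible_factors
    (fun h => hasse_ne_zero hqA h.1)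
    fun _ hπ h => not_dvd_serreDer_of_irreducible_dvd_hasse hp5 hA hqA hπ h

end ModP

lemma Prime.not_dvd_pow {D : Type*} [CommRing D] {π x : D} (hπ : Prime π) (hx : ¬ π ∣ x) (n : ℕ) :
    ¬ π ∣ x ^ n :=
  fun h => hx (hπ.dvd_of_dvd_pow h)

lemma ZMod.twelve_ne_zero {p : ℕ} [Fact p.Prime] (hp5 : 5 ≤ p) : (12 : ZMod p) ≠ 0 := fun h =>
  ZMod.natCast_1728_ne_zero hp5 (by linear_combination 144 * h)

lemma ZMod.ofNat_24_ne_zero {p : ℕ} [Fact p.Prime] (hp5 : 5 ≤ p) : (24 : ZMod p) ≠ 0 := fun h =>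
  ZMod.natCast_1728_ne_zero hp5 (by linear_combination 72 * h)

/-! ### Weights modulo p - 1 -/

section WeightsModP

open MvPolynomial

variable {p : ℕ} [Fact p.Prime] {A : MvPolynomial (Fin 2) (ZMod p)}

/-- A prime divisor of the Hasse invariant is a simple one. -/
lemma exists_prime_hasse (hp5 : 5 ≤ p) (hA : Isobaric A (p - 1)) (hqA : qEval _ A = 1) :
    ∃ π A₁, Prime π ∧ A = π * A₁ ∧ ¬ π ∣ A₁ ∧ ¬ π ∣ serreDer _ A := by
  have hnu : ¬ IsUnit A := by
    rintro ⟨u, hu⟩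
    obtain ⟨v, v', hv, hAv, -⟩ := Isobaric.exists_of_eq_mul (A := 1) (w := 0)
      (isWeightedHomogeneous_one _ _) one_ne_zero (P := A)
      (P' := (↑u⁻¹ : MvPolynomial (Fin 2) (ZMod p))) (by rw [← hu]; simp)
    have := IsWeightedHomogeneous.inj_right (hasse_ne_zero hqA) hA hAv
    omega
  obtain ⟨π, hπ, hd⟩ := WfDvdMonoid.exists_irreducible_factor hnu (hasse_ne_zero hqA)
  have hB := not_dvd_serreDer_of_irreducible_dvd_hasse hp5 hA hqA hπ hd
  obtain ⟨A₁, hA₁⟩ := hd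
  refine ⟨π, A₁, hπ.prime, hA₁, ?_, hB⟩
  rintro ⟨T, rfl⟩
  refine hB ⟨2 * T * serreDer _ π + π * serreDer _ T, ?_⟩
  rw [hA₁, Derivation.leibniz, Derivation.leibniz]
  simp only [smul_eq_mul]
  ring

/-- Forms modulo `p` with the same nonzero `q`-expansion have weights congruent modulo `p - 1`. -/
theorem dvd_weight_sub_of_qEval_eq (hp5 : 5 ≤ p) (hA : Isobaric A (p - 1)) (hqA : qEval _ A = 1)
    {P P' : MvPolynomial (Fin 2) (ZMod p)} {w t : ℕ} (hP : Isobaric P (w + t))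
    (hP' : Isobaric P' w) (h : qEval _ P = qEval _ P') (h0 : P ≠ 0) : p - 1 ∣ t := by
  obtain ⟨π, A₁, hπ, hA₁, hπA, -⟩ := exists_prime_hasse hp5 hA hqA
  have h0' : P' ≠ 0 := by
    rintro rfl
    rw [map_zero] at h
    exact h0 (hP.eq_zero_of_qEval_eq_zero (isUnit_1728_zmod hp5) h)
  -- Raising to the power p - 1 makes the weight gap t(p-1), which A^t fills exactly. Comparing
  -- orders at the simple factor π then shows that t is divisible by p - 1.
  have key : P ^ (p - 1) = P' ^ (p - 1) * A ^ t := by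
    refine (hP.pow (p - 1)).ext_qEval (isUnit_1728_zmod hp5)
      (((hP'.pow (p - 1)).mul (hA.pow t)).cast (by ring)) ?_
    simp only [map_mul, map_pow, h, hqA, one_pow, mul_one]
  obtain ⟨a, Q, rfl, hQ⟩ := hπ.exists_eq_pow_mul h0
  obtain ⟨b, Q', rfl, hQ'⟩ := hπ.exists_eq_pow_mul h0'
  have h1 : π ^ (a * (p - 1)) * Q ^ (p - 1) =
      π ^ (b * (p - 1) + t) * (Q' ^ (p - 1) * A₁ ^ t) := by
    rw [hA₁] at key
    simp only [mul_pow, ← pow_mul] at key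
    rw [key, pow_add]; ring
  have h2 := hπ.eq_of_pow_mul_eq h1 (hπ.not_dvd_pow hQ _)
    (hπ.not_dvd_mul (hπ.not_dvd_pow hQ' _) (hπ.not_dvd_pow hπA _))
  exact (Nat.dvd_add_right (dvd_mul_left _ b)).1 (h2 ▸ dvd_mul_left _ a)

end WeightsModP

/-! ### Congruences for divisor sums modulo p -/

section SigmaCongruences

open MvPolynomial

open ArithmeticFunction

variable {p : ℕ} [Fact p.Prime]

/-- Divisors that are multiples of p contribute 0, and m and pm have the same divisors prime to p.
-/
lemma natCast_sigma_prime_mul (j : ℕ) (hj : j ≠ 0) {m : ℕ} (hm : m ≠ 0) :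
    ((sigma j (p * m) : ℕ) : ZMod p) = (sigma j m : ℕ) := by
  have key : ∀ n : ℕ, ((sigma j n : ℕ) : ZMod p) =
      ∑ d ∈ n.divisors.filter fun d => ¬ p ∣ d, (d : ZMod p) ^ j := by
    intro n
    rw [sigma_apply, Finset.sum_filter, Nat.cast_sum]
    refine Finset.sum_congr rfl fun d _ => ?_
    split_ifs with hd
    · rw [Nat.cast_pow, (ZMod.natCast_eq_zero_iff d p).2 hd, zero_pow hj]
    · push_cast; rfl
  rw [key, key]
  congr 1
  ext d
  have hp : p.Prime := Fact.out
  simp only [Finset.mem_filter, Nat.mem_divisors]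
  constructor
  · rintro ⟨⟨h1, h2⟩, h3⟩
    exact ⟨⟨(Nat.Coprime.symm ((hp.coprime_iff_not_dvd).2 h3)).dvd_of_dvd_mul_left h1, hm⟩, h3⟩
  · rintro ⟨⟨h1, h2⟩, h3⟩
    exact ⟨⟨h1.mul_left p, mul_ne_zero hp.ne_zero hm⟩, h3⟩

/-- By Fermat d^{p-2} = d⁻¹ = n⁻¹(n/d) for every divisor d of n, and n/d runs through the divisors
of n again. -/
lemma natCast_sigma_sub_two (hp5 : 5 ≤ p) {n : ℕ} (hn : ¬ p ∣ n) :
    ((sigma (p - 2) n : ℕ) : ZMod p) = n ^ (p - 2) * (sigma 1 n : ℕ) := by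
  rw [sigma_apply, sigma_one_apply, ← Nat.sum_div_divisors n (fun d => d ^ (p - 2)), Nat.cast_sum,
    Nat.cast_sum, Finset.mul_sum]
  refine Finset.sum_congr rfl fun d hd => ?_
  obtain ⟨e, rfl⟩ := Nat.dvd_of_mem_divisors hd
  have hd0 : d ≠ 0 := by rintro rfl; simp at hn
  rw [Nat.mul_div_cancel_left _ (Nat.pos_of_ne_zero hd0)]
  have hdp : (d : ZMod p) ≠ 0 :=
    ZMod.natCast_ne_zero_of_coprime fun h => hn (h.mul_right e)
  have h1 := ZMod.pow_card_sub_one_eq_one hdp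
  rw [show p - 1 = p - 2 + 1 by omega, pow_succ] at h1
  push_cast
  rw [mul_pow, mul_right_comm, h1, one_mul]

/-- The series `∑ σ_j(n) q ^ n` without constant term. -/
noncomputable def sigmaSeries (K : Type*) [CommRing K] (j : ℕ) : K⟦X⟧ :=
  PowerSeries.mk fun n => ((sigma j n : ℕ) : K)

lemma coeff_sigmaSeries (K : Type*) [CommRing K] (j n : ℕ) :
    PowerSeries.coeff n (sigmaSeries K j) = ((sigma j n : ℕ) : K) := by simp [sigmaSeries]

lemma map_sigmaSeries {K L : Type*} [CommRing K] [CommRing L] (φ : K →+* L) (j : ℕ) :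
    PowerSeries.map φ (sigmaSeries K j) = sigmaSeries L j := by
  ext n; simp [coeff_sigmaSeries]

lemma eisSeries_eq {K : Type*} [CommRing K] (c : K) (j : ℕ) :
    eisSeries K c j = 1 + PowerSeries.C c * sigmaSeries K j := by
  ext n
  rw [coeff_eisSeries, map_add, PowerSeries.coeff_C_mul, coeff_sigmaSeries, PowerSeries.coeff_one]
  split_ifs with h
  · simp [h]
  · simp

/-- Over F_p the Frobenius fixes coefficients, so φ(q)^p = φ(q^p). -/
lemma coeff_pow_card (φ : (ZMod p)⟦X⟧) (n : ℕ) :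
    PowerSeries.coeff n (φ ^ p) = if p ∣ n then PowerSeries.coeff (n / p) φ else 0 := by
  have hp0 : p ≠ 0 := (Fact.out : p.Prime).ne_zero
  have h := MvPowerSeries.map_frobenius_expand p hp0 (f := φ)
  rw [ZMod.frobenius_zmod] at h
  rw [← PowerSeries.coeff_expand p hp0]
  congr 1
  refine h.symm.trans ?_
  ext d
  simp
  rfl

/-- The Artin–Schreier equation satisfied modulo `p` by the series `∑ σ_{p-2}(n) q ^ n`. -/
lemma sigmaSeries_artinSchreier (hp5 : 5 ≤ p) :
    24 * (sigmaSeries (ZMod p) (p - 2) ^ p - sigmaSeries (ZMod p) (p - 2)) =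
      thetaOperator^[p - 2] (e2Series (ZMod p)) := by
  ext n
  rw [coeff_thetaOperator_iterate, ← map_ofNat PowerSeries.C 24, PowerSeries.coeff_C_mul, map_sub,
    coeff_pow_card, coeff_sigmaSeries, coeff_sigmaSeries, coeff_eisSeries]
  by_cases hn : p ∣ n
  · rw [if_pos hn, (ZMod.natCast_eq_zero_iff n p).2 hn, zero_pow (by omega),
      zero_mul]
    obtain ⟨m, rfl⟩ := hn
    rw [Nat.mul_div_cancel_left _ (Fact.out : p.Prime).pos]
    rcases eq_or_ne m 0 with rfl | hm
    · simp
    · rw [natCast_sigma_prime_mul _ (by omega) hm, sub_self, mul_zero]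
  · have hn0 : n ≠ 0 := by rintro rfl; simp at hn
    rw [if_neg hn, if_neg hn0, natCast_sigma_sub_two hp5 hn]
    ring

/-- This is the source of the form D with θE_{p-1} = pD modulo p²: up to constants D is θ^{p-1}E₂
modulo p. -/
lemma thetaOperator_sigmaSeries (hp5 : 5 ≤ p) :
    -24 * thetaOperator (sigmaSeries (ZMod p) (p - 2)) =
      thetaOperator^[p - 1] (e2Series (ZMod p)) := by
  ext n
  rw [coeff_thetaOperator_iterate, ← map_ofNat PowerSeries.C 24, ← map_neg,
    PowerSeries.coeff_C_mul, coeff_thetaOperator, coeff_sigmaSeries, coeff_eisSeries]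
  by_cases hn : p ∣ n
  · rw [(ZMod.natCast_eq_zero_iff n p).2 hn, zero_pow (by omega)]
    ring
  · have hn0 : n ≠ 0 := by rintro rfl; simp at hn
    rw [if_neg hn0, natCast_sigma_sub_two hp5 hn, show p - 1 = p - 2 + 1 by omega]
    ring

end SigmaCongruences

/-! ### The series S is not a quotient of forms modulo p -/

section ThetaLift

open MvPolynomial

variable {p : ℕ} [Fact p.Prime] {A : MvPolynomial (Fin 2) (ZMod p)}

/-- Iterated theta derivatives of `E₂` modulo `p` as isobaric polynomials. -/
lemma exists_thetaOperator_iterate_e2Series (hA : Isobaric A (p - 1))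
    (hqA : qEval _ A = 1) (j : ℕ) :
    ∃ Y Z, Isobaric Y ((j + 1) * (p + 1)) ∧
      qEval _ Y = 12 ^ j * thetaOperator^[j] (e2Series (ZMod p)) ∧
      Y = (j.factorial : MvPolynomial (Fin 2) (ZMod p)) * serreDer _ A ^ (j + 1) + A * Z := by
  have hp1 := (Fact.out : p.Prime).one_le
  induction j with
  | zero =>
    exact ⟨serreDer _ A, 0, (isobaric_serreDer hA).cast (by omega), by
      simp [qEval_serreDer_hasse hA hqA], by simp⟩
  | succ j ih =>
    obtain ⟨Y, Z, hY, hqY, hYZ⟩ := ih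
    have hB : Isobaric (serreDer _ A) (p + 1) := (isobaric_serreDer hA).cast (by omega)
    have hw : (((j + 1) * (p + 1) : ℕ) : ZMod p) = (j + 1 : ℕ) := by push_cast; simp
    -- The weight of Y is j + 1 modulo p, so 12θ acts as ∂Y + (j+1)E₂Y. Replacing E₂ by ∂A and
    -- multiplying ∂Y by A makes this isobaric.
    refine ⟨A * serreDer _ Y + ((j + 1 : ℕ) : MvPolynomial (Fin 2) (ZMod p)) * (serreDer _ A * Y),
      serreDer _ Y + ((j + 1 : ℕ) : MvPolynomial (Fin 2) (ZMod p)) * (serreDer _ A * Z), ?_, ?_, ?_⟩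
    · refine ((hA.mul (isobaric_serreDer hY)).cast ?_).add (((hB.mul hY).natCast_mul _).cast (by ring))
      have : (j + 1 + 1) * (p + 1) = (j + 1) * (p + 1) + (p + 1) := by ring
      omega
    · have h := thetaOperator_qEval hY
      have hw' : (((j + 1) * (p + 1) : ℕ) : (ZMod p)⟦X⟧) = (j + 1 : ℕ) := by
        rw [← map_natCast (PowerSeries.C (R := ZMod p)), hw, map_natCast]
      rw [hw', hqY, ← map_ofNat PowerSeries.C 12, ← map_pow, thetaOperator_C_mul] at h
      rw [map_add, map_mul, map_mul, map_mul, map_natCast, hqA, qEval_serreDer_hasse hA hqA, hqY,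
        Function.iterate_succ_apply', ← map_ofNat PowerSeries.C 12, ← map_pow, ← map_pow, pow_succ,
        map_mul]
      linear_combination -h
    · rw [Nat.factorial_succ]
      push_cast
      linear_combination ((j : MvPolynomial (Fin 2) (ZMod p)) + 1) * serreDer _ A * hYZ

/-- The series `∑ σ_{p-2}(n) q ^ n` is not a quotient of modular forms modulo `p` whose weights
are congruent modulo `p - 1`. -/
theorem sigmaSeries_mul_qEval_ne (hp5 : 5 ≤ p) (hA : Isobaric A (p - 1)) (hqA : qEval _ A = 1)
    {y h : MvPolynomial (Fin 2) (ZMod p)} {w s : ℕ} (hs : s ≠ 0) (hy : Isobaric y (w + s * (p - 1)))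
    (hh : Isobaric h w) (h0 : h ≠ 0) :
    qEval _ y ≠ sigmaSeries (ZMod p) (p - 2) * qEval _ h := by
  intro heq
  have hp1 := (Fact.out : p.Prime).one_le
  obtain ⟨π, A₁, hπ, hA₁, hπA, hπB⟩ := exists_prime_hasse hp5 hA hqA
  obtain ⟨Y, Z, hY, hqY, hYZ⟩ := exists_thetaOperator_iterate_e2Series hA hqA (p - 2)
  obtain ⟨q, rfl⟩ : ∃ q, p = q + 1 := ⟨p - 1, by omega⟩
  -- The exponent n = ps - 1 is the power of A that makes the Artin–Schreier equation isobaric; it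
  -- is prime to p, which gives the contradiction below.
  obtain ⟨n, hn⟩ : ∃ n, (q + 1) * s = n + 1 :=
    ⟨(q + 1) * s - 1, by have := Nat.mul_pos q.add_one_pos (Nat.pos_of_ne_zero hs); omega⟩
  simp only [Nat.add_sub_cancel, show q + 1 - 2 + 1 = q by omega] at *
  set κ : ZMod (q + 1) := 12 ^ (q + 1 - 2) * 24 with hκ
  have hκ0 : κ ≠ 0 := mul_ne_zero (pow_ne_zero _ (ZMod.twelve_ne_zero hp5)) (ZMod.ofNat_24_ne_zero hp5)
  have hAS : PowerSeries.C κ * (sigmaSeries (ZMod (q + 1)) (q + 1 - 2) ^ (q + 1) -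
      sigmaSeries (ZMod (q + 1)) (q + 1 - 2)) = qEval _ Y := by
    rw [hqY, ← sigmaSeries_artinSchreier hp5, hκ, map_mul, map_pow, map_ofNat, map_ofNat]
    ring
  -- The equation κ(S^p - S) = Y with S = y/h, multiplied by h^p and homogenized by powers of A.
  have key : C κ * (y ^ (q + 1) * A ^ (q + 1) - y * h ^ q * A ^ (q * s + (q + 1))) =
      h ^ (q + 1) * Y * A ^ n := by
    refine (((hy.pow (q + 1)).mul (hA.pow (q + 1))).sub
      ((((hy.mul (hh.pow q)).mul (hA.pow (q * s + (q + 1)))).cast ?_))).C_mul κ |>.ext_qEval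
      (isUnit_1728_zmod hp5) (((hh.pow (q + 1)).mul hY).mul (hA.pow n) |>.cast ?_) ?_
    · ring
    · linear_combination q * hn.symm
    · simp only [map_mul, map_sub, map_pow, hqA, one_pow, mul_one, qEval_C, heq, ← hAS]
      ring
  have hπY : ¬ π ∣ Y := by
    rw [hYZ, dvd_add_left ((Dvd.intro _ hA₁.symm).mul_right Z)]
    refine hπ.not_dvd_mul (fun h => hπ.not_isUnit (isUnit_of_dvd_unit h ?_)) (hπ.not_dvd_pow hπB _)
    rw [← map_natCast C]
    refine IsUnit.map C (IsUnit.mk0 _ (ZMod.natCast_ne_zero_of_coprime fun h => ?_))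
    have := ((Fact.out : (q + 1).Prime).dvd_factorial).1 h
    omega
  have hh0 := hπ.exists_eq_pow_mul h0
  have hY0 : Y ≠ 0 := fun h => hπY (h ▸ dvd_zero _)
  have hy0 : y ≠ 0 := by
    rintro rfl
    refine mul_ne_zero (mul_ne_zero (pow_ne_zero (q + 1) h0) hY0)
      (pow_ne_zero n (hasse_ne_zero hqA)) ?_
    rw [← key]; simp
  obtain ⟨a, y₁, rfl, hy₁⟩ := hπ.exists_eq_pow_mul hy0
  obtain ⟨b, h₁, rfl, hh₁⟩ := hh0
  have hU : ¬ π ∣ h₁ ^ (q + 1) * Y * A₁ ^ n :=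
    hπ.not_dvd_mul (hπ.not_dvd_mul (hπ.not_dvd_pow hh₁ _) hπY) (hπ.not_dvd_pow hπA _)
  rw [hA₁] at key
  -- Orders at π: the right side has pb + n = p(b+s) - 1, and the two terms on the left have pa + p
  -- and a + (p-1)(b+s) + p. If a ≥ b + s, both of these exceed the right side. If a < b + s, the
  -- first is the strict minimum, so pa + p = pb + n and p | n, against n + 1 = ps.
  rcases le_or_gt (b + s) a with hab | hab
  · obtain ⟨d, rfl⟩ := Nat.exists_eq_add_of_le hab
    refine hU ⟨C κ * (π ^ (d * (q + 1) + (q + 1)) * (y₁ ^ (q + 1) * A₁ ^ (q + 1)) -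
      π ^ (d + (q + 1)) * (y₁ * h₁ ^ q * A₁ ^ (q * s + (q + 1)))), ?_⟩
    refine mul_left_cancel₀ (pow_ne_zero (b * (q + 1) + n) hπ.ne_zero) ?_
    have e1 : (π ^ (b + s + d)) ^ (q + 1) * π ^ (q + 1) =
        π ^ (b * (q + 1) + n) * π * π ^ (d * (q + 1) + (q + 1)) := by
      rw [← pow_mul, ← pow_succ, ← pow_add, ← pow_add]
      congr 1; linear_combination hn
    have e2 : π ^ (b + s + d) * (π ^ b) ^ q * π ^ (q * s + (q + 1)) =
        π ^ (b * (q + 1) + n) * π * π ^ (d + (q + 1)) := by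
      rw [← pow_mul, ← pow_succ, ← pow_add, ← pow_add, ← pow_add]
      congr 1; linear_combination hn
    have e3 : (π ^ b) ^ (q + 1) * π ^ n = π ^ (b * (q + 1) + n) := by
      rw [← pow_mul, ← pow_add]
    simp only [mul_pow] at key
    linear_combination -key - h₁ ^ (q + 1) * Y * A₁ ^ n * e3 +
      C κ * (y₁ ^ (q + 1) * A₁ ^ (q + 1)) * e1 - C κ * (y₁ * h₁ ^ q * A₁ ^ (q * s + (q + 1))) * e2
  · obtain ⟨d, hd⟩ := Nat.exists_eq_add_of_le (Nat.succ_le_of_lt hab)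
    have e1 : (π ^ a) ^ (q + 1) * π ^ (q + 1) = π ^ (a * (q + 1) + (q + 1)) := by
      rw [← pow_mul, ← pow_add]
    have e2 : π ^ a * (π ^ b) ^ q * π ^ (q * s + (q + 1)) =
        π ^ (a * (q + 1) + (q + 1)) * π ^ (q * (1 + d)) := by
      rw [← pow_mul, ← pow_add, ← pow_add, ← pow_add]
      congr 1; simp only [Nat.succ_eq_add_one] at hd; linear_combination q * hd
    have e3 : (π ^ b) ^ (q + 1) * π ^ n = π ^ (b * (q + 1) + n) := by
      rw [← pow_mul, ← pow_add]
    simp only [mul_pow] at key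
    have h3 : π ^ (a * (q + 1) + (q + 1)) * (C κ * (y₁ ^ (q + 1) * A₁ ^ (q + 1) -
        π ^ (q * (1 + d)) * (y₁ * h₁ ^ q * A₁ ^ (q * s + (q + 1))))) =
        π ^ (b * (q + 1) + n) * (h₁ ^ (q + 1) * Y * A₁ ^ n) := by
      linear_combination key + h₁ ^ (q + 1) * Y * A₁ ^ n * e3 -
        C κ * (y₁ ^ (q + 1) * A₁ ^ (q + 1)) * e1 +
        C κ * (y₁ * h₁ ^ q * A₁ ^ (q * s + (q + 1))) * e2
    have hV : ¬ π ∣ C κ * (y₁ ^ (q + 1) * A₁ ^ (q + 1) -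
        π ^ (q * (1 + d)) * (y₁ * h₁ ^ q * A₁ ^ (q * s + (q + 1)))) := by
      refine hπ.not_dvd_mul (fun h => hπ.not_isUnit (isUnit_of_dvd_unit h (hκ0.isUnit.map C))) fun h => ?_
      have : π ∣ π ^ (q * (1 + d)) := dvd_pow_self _ (mul_ne_zero (by omega) (by omega))
      exact hπ.not_dvd_mul (hπ.not_dvd_pow hy₁ _) (hπ.not_dvd_pow hπA _)
        ((dvd_sub_left (this.mul_right _)).1 h)
    have h4 := hπ.eq_of_pow_mul_eq h3 hV hU
    have h5 : q + 1 ∣ n := (Nat.dvd_add_right (dvd_mul_left _ b)).1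
      (h4 ▸ ⟨a + 1, by ring⟩)
    have h6 : q + 1 ∣ 1 := (Nat.dvd_add_right h5).1 (hn ▸ dvd_mul_right _ _)
    have := Nat.le_of_dvd one_pos h6
    omega

end ThetaLift

/-! ### Reduction modulo p and lifting of isobaric polynomials -/

section Lifting

open MvPolynomial pIntegralRationals

/-- With x = p this gives E_{p-1}^n = 1 + npcS modulo p², which is 1 when p | n. -/
lemma sq_dvd_one_add_mul_pow_sub {S : Type*} [CommRing S] (x y : S) (n : ℕ) :
    x ^ 2 ∣ (1 + x * y) ^ n - (1 + n * (x * y)) := by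
  induction n with
  | zero => simp
  | succ n ih =>
    obtain ⟨z, hz⟩ := ih
    refine ⟨z * (1 + x * y) + n * y ^ 2, ?_⟩
    rw [pow_succ]
    push_cast
    linear_combination (1 + x * y) * hz

variable {p : ℕ}

lemma powerSeriesCongr_iff (m : ℕ) (f g : (pIntegralRationals p)⟦X⟧) :
    PowerSeriesCongr p m f g ↔ (p : (pIntegralRationals p)⟦X⟧) ^ m ∣ f - g := by
  constructor
  · intro h
    choose y hy using h
    refine ⟨PowerSeries.mk y, ?_⟩
    ext1 n
    rw [← map_natCast (PowerSeries.C (R := pIntegralRationals p)), ← map_pow,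
      PowerSeries.coeff_C_mul, PowerSeries.coeff_mk, ← hy, map_sub]
  · rintro ⟨y, hy⟩ n
    refine ⟨PowerSeries.coeff n y, ?_⟩
    rw [← map_sub, hy, ← map_natCast (PowerSeries.C (R := pIntegralRationals p)), ← map_pow,
      PowerSeries.coeff_C_mul]

lemma weightFiltration_eq {m W : ℕ} {f : (pIntegralRationals p)⟦X⟧}
    (h : ∃ g ∈ pIntegralModularForms p W, PowerSeriesCongr p m f g)
    (h' : ∀ w < W, ∀ g ∈ pIntegralModularForms p w, ¬ PowerSeriesCongr p m f g) :
    weightFiltration p m f = W := by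
  refine le_antisymm (iInf₂_le W h) (le_iInf₂ fun w hw => ?_)
  obtain ⟨g, hg, hfg⟩ := hw
  by_contra! hlt
  exact h' w (by exact_mod_cast hlt) g hg hfg

lemma not_powerSeriesCongr_of_lt {m W w : ℕ} {f g : (pIntegralRationals p)⟦X⟧}
    (h : weightFiltration p m f = W) (hw : w < W) (hg : g ∈ pIntegralModularForms p w) :
    ¬ PowerSeriesCongr p m f g := fun hfg =>
  (h ▸ iInf₂_le w ⟨g, hg, hfg⟩ : (W : ℕ∞) ≤ w).not_gt (by exact_mod_cast hw)

variable [Fact p.Prime]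

lemma Isobaric.exists_lift {P : MvPolynomial (Fin 2) (ZMod p)} {w : ℕ} (hP : Isobaric P w) :
    ∃ P' : MvPolynomial (Fin 2) (pIntegralRationals p), Isobaric P' w ∧
      MvPolynomial.map (reduction p) P' = P := by
  obtain ⟨P', hP'⟩ := MvPolynomial.map_surjective (σ := Fin 2) (reduction p) reduction_surjective P
  refine ⟨weightedHomogeneousComponent ![4, 6] w P', weightedHomogeneousComponent_isWeightedHomogeneous _ _, ?_⟩
  ext d
  rw [coeff_map, coeff_weightedHomogeneousComponent, ← hP']
  split_ifs with h
  · rw [coeff_map]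
  · rw [map_zero, hP', hP.coeff_eq_zero d h]

lemma Isobaric.exists_eq_natCast_mul {P : MvPolynomial (Fin 2) (pIntegralRationals p)} {w : ℕ}
    (hP : Isobaric P w) (h : MvPolynomial.map (reduction p) P = 0) :
    ∃ P', Isobaric P' w ∧ P = (p : MvPolynomial (Fin 2) (pIntegralRationals p)) * P' := by
  have h1 : C (p : pIntegralRationals p) ∣ P := by
    rw [C_dvd_iff_dvd_coeff]
    intro d
    rw [← reduction_eq_zero_iff, ← coeff_map, h, coeff_zero]
  obtain ⟨P', rfl⟩ := h1
  refine ⟨P', fun d hd => hP ?_, by rw [map_natCast]⟩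
  rw [coeff_C_mul]
  exact mul_ne_zero natCast_self_ne_zero hd

lemma map_reduction_eq_zero_iff (f : (pIntegralRationals p)⟦X⟧) :
    PowerSeries.map (reduction p) f = 0 ↔ (p : (pIntegralRationals p)⟦X⟧) ∣ f := by
  constructor
  · intro h
    have h1 : ∀ n, ∃ y, PowerSeries.coeff n f = p * y := fun n => by
      have := congrArg (PowerSeries.coeff n) h
      rw [PowerSeries.coeff_map, map_zero, reduction_eq_zero_iff] at this
      exact this
    choose y hy using h1
    refine ⟨PowerSeries.mk y, ?_⟩
    ext1 n
    rw [← map_natCast (PowerSeries.C (R := pIntegralRationals p)), PowerSeries.coeff_C_mul, hy,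
      PowerSeries.coeff_mk]
  · rintro ⟨y, rfl⟩
    rw [map_mul, map_natCast, ← map_natCast (PowerSeries.C (R := ZMod p)), CharP.cast_eq_zero,
      map_zero, zero_mul]

lemma map_reduction_eq_iff (f g : (pIntegralRationals p)⟦X⟧) :
    PowerSeries.map (reduction p) f = PowerSeries.map (reduction p) g ↔
      (p : (pIntegralRationals p)⟦X⟧) ∣ f - g := by
  rw [← map_reduction_eq_zero_iff, map_sub, sub_eq_zero]

lemma natCast_powerSeries_ne_zero : (p : (pIntegralRationals p)⟦X⟧) ≠ 0 := by
  rw [← map_natCast (PowerSeries.C (R := pIntegralRationals p))]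
  exact (map_ne_zero_iff _ PowerSeries.C_injective).2 natCast_self_ne_zero

end Lifting

/-! ### Weights and filtrations modulo p² -/

section HasseLift

open MvPolynomial pIntegralRationals

variable {p : ℕ} {c : pIntegralRationals p} {A : MvPolynomial (Fin 2) (pIntegralRationals p)}

lemma qEval_hasse (hqA : qEval _ A = eisSeries _ (p * c) (p - 2)) :
    qEval _ A = 1 + (p : (pIntegralRationals p)⟦X⟧) *
      (PowerSeries.C c * sigmaSeries (pIntegralRationals p) (p - 2)) := by
  rw [hqA, eisSeries_eq, map_mul, map_natCast, mul_assoc]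

variable [Fact p.Prime]

lemma qEval_map_hasse (hqA : qEval _ A = eisSeries _ (p * c) (p - 2)) :
    qEval _ (map (reduction p) A) = 1 := by
  rw [← map_qEval, ← map_one (PowerSeries.map (reduction p)), map_reduction_eq_iff,
    qEval_hasse hqA, add_sub_cancel_left]
  exact dvd_mul_right _ _

/-- Forms that agree modulo `p ^ 2` and do not vanish modulo `p` have weights that are congruent
modulo `p * (p - 1)`. -/
theorem dvd_weight_sub_of_sq_dvd (hp5 : 5 ≤ p) (hc : reduction p c ≠ 0) (hA : Isobaric A (p - 1))
    (hqA : qEval _ A = eisSeries _ (p * c) (p - 2))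
    {G H : MvPolynomial (Fin 2) (pIntegralRationals p)} {w t : ℕ} (hG : Isobaric G (w + t))
    (hH : Isobaric H w) (h : (p : (pIntegralRationals p)⟦X⟧) ^ 2 ∣ qEval _ G - qEval _ H)
    (h0 : map (reduction p) G ≠ 0) : p * (p - 1) ∣ t := by
  have hqA1 := qEval_map_hasse hqA
  have hGH : qEval _ (map (reduction p) G) = qEval _ (map (reduction p) H) := by
    rw [← map_qEval, ← map_qEval, map_reduction_eq_iff]
    exact (dvd_pow_self _ two_ne_zero).trans h
  obtain ⟨s, rfl⟩ := dvd_weight_sub_of_qEval_eq hp5 (hA.map _) hqA1 (hG.map _) (hH.map _) hGH h0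
  rw [mul_comm (p - 1)] at hG ⊢
  refine mul_dvd_mul_right ?_ _
  by_contra hs
  have hs0 : s ≠ 0 := by rintro rfl; simp at hs
  have hH0 : map (reduction p) H ≠ 0 := by
    intro hH0
    rw [hH0, map_zero] at hGH
    exact h0 ((hG.map _).eq_zero_of_qEval_eq_zero (isUnit_1728_zmod hp5) hGH)
  -- If p does not divide s, then G - HA^s = pY and A^s = 1 + spcS modulo p² give Y = -scSH modulo
  -- p. This exhibits S as a quotient of forms whose weights differ by s(p-1).
  have hd : map (reduction p) (G - H * A ^ s) = 0 := by
    refine ((hG.sub (hH.mul (hA.pow s))).map _).eq_zero_of_qEval_eq_zero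
      (isUnit_1728_zmod hp5) ?_
    simp only [map_sub, map_mul, map_pow, hqA1, hGH, one_pow, mul_one, sub_self]
  obtain ⟨Y, hY, hGY⟩ := (hG.sub (hH.mul (hA.pow s))).exists_eq_natCast_mul hd
  obtain ⟨e, he⟩ := h
  obtain ⟨e', he'⟩ := sq_dvd_one_add_mul_pow_sub (p : (pIntegralRationals p)⟦X⟧)
    (PowerSeries.C c * sigmaSeries (pIntegralRationals p) (p - 2)) s
  rw [← qEval_hasse hqA] at he'
  have hq := congrArg (qEval (pIntegralRationals p)) hGY
  simp only [map_sub, map_mul, map_pow, map_natCast] at hq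
  have h1 : qEval _ Y + s * (PowerSeries.C c * sigmaSeries (pIntegralRationals p) (p - 2)) *
      qEval _ H = (p : (pIntegralRationals p)⟦X⟧) * (e - qEval _ H * e') := by
    refine mul_left_cancel₀ natCast_powerSeries_ne_zero ?_
    linear_combination he - hq - qEval _ H * he'
  have h2 := (map_reduction_eq_zero_iff _).2 (Dvd.intro _ h1.symm)
  rw [map_add, map_mul, map_mul, map_mul, map_natCast, map_sigmaSeries, PowerSeries.map_C,
    map_qEval, map_qEval] at h2
  have hsc : -((s : ZMod p) * reduction p c) ≠ 0 :=
    neg_ne_zero.2 (mul_ne_zero (ZMod.natCast_ne_zero_of_coprime hs) hc)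
  refine sigmaSeries_mul_qEval_ne hp5 (hA.map _) hqA1 hs0
    ((hY.map (reduction p)).C_mul (-((s : ZMod p) * reduction p c))⁻¹) (hH.map _) hH0 ?_
  have h3 : PowerSeries.C (-((s : ZMod p) * reduction p c))⁻¹ *
      PowerSeries.C (-((s : ZMod p) * reduction p c)) = 1 := by
    rw [← map_mul, inv_mul_cancel₀ hsc, map_one]
  have h4 : PowerSeries.C (-((s : ZMod p) * reduction p c)) =
      -((s : (ZMod p)⟦X⟧) * PowerSeries.C (reduction p c)) := by
    rw [map_neg, map_mul, map_natCast]
  rw [map_mul, qEval_C]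
  linear_combination PowerSeries.C (-((s : ZMod p) * reduction p c))⁻¹ * h2 +
    (sigmaSeries (ZMod p) (p - 2) * qEval _ (map (reduction p) H)) * h3 -
    PowerSeries.C (-((s : ZMod p) * reduction p c))⁻¹ * sigmaSeries (ZMod p) (p - 2) *
      qEval _ (map (reduction p) H) * h4

/-- The weight filtration modulo `p ^ 2` of a form `A ^ p G + p H`. -/
theorem weightFiltration_two_eq (hp5 : 5 ≤ p) (hc : reduction p c ≠ 0) (hA : Isobaric A (p - 1))
    (hqA : qEval _ A = eisSeries _ (p * c) (p - 2))
    {G H : MvPolynomial (Fin 2) (pIntegralRationals p)} {W : ℕ} (hG : Isobaric G W)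
    (hH : Isobaric H (W + p * (p - 1))) (hG0 : map (reduction p) G ≠ 0)
    (hH0 : ¬ map (reduction p) A ^ p ∣ map (reduction p) H)
    {u : pIntegralRationals p} (hu : IsUnit u) {g : (pIntegralRationals p)⟦X⟧}
    (hg : (p : (pIntegralRationals p)⟦X⟧) ^ 2 ∣
      PowerSeries.C u * g - (qEval _ G + p * qEval _ H)) :
    weightFiltration p 2 g = (W + p * (p - 1) : ℕ) := by
  have hqA1 := qEval_map_hasse hqA
  have hAp : ∀ n : ℕ, (p : (pIntegralRationals p)⟦X⟧) ^ 2 ∣ qEval _ A ^ (p * n) - 1 := by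
    intro n
    obtain ⟨e, he⟩ := sq_dvd_one_add_mul_pow_sub (p : (pIntegralRationals p)⟦X⟧)
      (PowerSeries.C c * sigmaSeries (pIntegralRationals p) (p - 2)) (p * n)
    refine ⟨e + n * (PowerSeries.C c * sigmaSeries (pIntegralRationals p) (p - 2)), ?_⟩
    rw [qEval_hasse hqA]
    push_cast at he ⊢
    linear_combination he
  have hF : Isobaric (A ^ p * G + (p : MvPolynomial (Fin 2) (pIntegralRationals p)) * H)
      (W + p * (p - 1)) := (((hA.pow p).mul hG).cast (by ring)).add (hH.natCast_mul p)
  have hgF : (p : (pIntegralRationals p)⟦X⟧) ^ 2 ∣ PowerSeries.C u * g -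
      qEval _ (A ^ p * G + (p : MvPolynomial (Fin 2) (pIntegralRationals p)) * H) := by
    obtain ⟨e, he⟩ := hg
    obtain ⟨e', he'⟩ := hAp 1
    rw [mul_one] at he'
    refine ⟨e - e' * qEval _ G, ?_⟩
    simp only [map_add, map_mul, map_pow, map_natCast]
    linear_combination he - qEval _ G * he'
  have hp0 : map (reduction p) (p : MvPolynomial (Fin 2) (pIntegralRationals p)) = 0 := by
    rw [map_natCast, ← map_natCast C, CharP.cast_eq_zero, map_zero]
  obtain ⟨v, hv⟩ := hu.exists_left_inv
  have hvC : PowerSeries.C v * PowerSeries.C u = 1 := by rw [← map_mul, hv, map_one]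
  refine weightFiltration_eq ⟨_, (mem_pIntegralModularForms_iff hp5).2 ⟨_, hF.C_mul v, rfl⟩,
    (powerSeriesCongr_iff _ _ _).2 ?_⟩ ?_
  · obtain ⟨e, he⟩ := hgF
    refine ⟨PowerSeries.C v * e, ?_⟩
    rw [map_mul (qEval _) (C v), qEval_C]
    linear_combination PowerSeries.C v * he - g * hvC
  · intro w hw g' hg' hgg'
    obtain ⟨H', hH', rfl⟩ := (mem_pIntegralModularForms_iff hp5).1 hg'
    rw [powerSeriesCongr_iff] at hgg'
    obtain ⟨t, ht⟩ := Nat.exists_eq_add_of_lt hw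
    have hcongr : (p : (pIntegralRationals p)⟦X⟧) ^ 2 ∣
        qEval _ (A ^ p * G + (p : MvPolynomial (Fin 2) (pIntegralRationals p)) * H) -
          qEval _ (C u * H') := by
      rw [map_mul (qEval _) (C u), qEval_C]
      have := dvd_sub (hgg'.mul_left (PowerSeries.C u)) hgF
      convert this using 1
      ring
    have hFm : map (reduction p)
        (A ^ p * G + (p : MvPolynomial (Fin 2) (pIntegralRationals p)) * H) =
        map (reduction p) A ^ p * map (reduction p) G := by
      rw [map_add, map_mul, map_mul, map_pow, hp0, zero_mul, add_zero]
    obtain ⟨s, hs⟩ := dvd_weight_sub_of_sq_dvd hp5 hc hA hqA (hF.cast (ht.trans (add_assoc _ _ _)))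
      (hH'.C_mul u) hcongr (hFm ▸ mul_ne_zero (pow_ne_zero _ (hasse_ne_zero hqA1)) hG0)
    -- The weight drops by at least p(p-1), so w ≤ W and G can itself be compared with uH'A^{ps} in
    -- weight W.
    obtain ⟨s, rfl⟩ : ∃ s', s = s' + 1 := Nat.exists_eq_succ_of_ne_zero (by
      rintro rfl; omega)
    have hW : W = w + p * s * (p - 1) := by
      have : p * (p - 1) * (s + 1) = p * s * (p - 1) + p * (p - 1) := by ring
      omega
    have hd : map (reduction p) (G - C u * H' * A ^ (p * s)) = 0 := by
      refine ((hG.sub (((hH'.C_mul u).mul (hA.pow (p * s))).cast hW.symm)).map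
        _).eq_zero_of_qEval_eq_zero (isUnit_1728_zmod hp5) ?_
      have h1 : PowerSeries.map (reduction p) _ = PowerSeries.map (reduction p) _ :=
        (map_reduction_eq_iff _ _).2 ((dvd_pow_self _ two_ne_zero).trans hcongr)
      rw [map_qEval, map_qEval, hFm, map_mul, map_pow, hqA1, one_pow, one_mul] at h1
      rw [map_sub, map_sub, h1, map_mul _ _ (A ^ _), map_mul (qEval _) _ (map _ (A ^ _)), map_pow,
        map_pow, hqA1, one_pow, mul_one, sub_self]
    obtain ⟨Y, hY, hGY⟩ := (hG.sub (((hH'.C_mul u).mul (hA.pow (p * s))).cast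
      hW.symm)).exists_eq_natCast_mul hd
    -- Modulo p², A^pG + pH = uH' = uH'A^{p(s+1)}. Subtracting A^p(G - uH'A^{ps}) = pA^pY and
    -- dividing by p leaves this identity.
    have hz : map (reduction p) (A ^ p * Y + H) = 0 := by
      refine ((((hA.pow p).mul hY).cast (add_comm _ _)).add hH |>.map
        _).eq_zero_of_qEval_eq_zero (isUnit_1728_zmod hp5) ?_
      rw [← map_qEval, map_reduction_eq_zero_iff]
      obtain ⟨e, he⟩ := hcongr
      obtain ⟨e', he'⟩ := hAp (s + 1)
      refine ⟨e - qEval _ (C u * H') * e', mul_left_cancel₀ natCast_powerSeries_ne_zero ?_⟩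
      have hq := congrArg (qEval (pIntegralRationals p)) hGY
      simp only [map_sub, map_add, map_mul, map_pow, map_natCast] at hq he ⊢
      rw [mul_add p s, pow_add, mul_one] at he'
      linear_combination he - qEval _ A ^ p * hq - qEval _ (C u) * qEval _ H' * he'
    refine hH0 ⟨-map (reduction p) Y, ?_⟩
    rw [map_add, map_mul, map_pow] at hz
    linear_combination hz

end HasseLift

/-! ### Expansion of θ^i in powers of E₂ -/

section ThetaExpansion

open MvPolynomial pIntegralRationals

lemma Nat.ascFactorial_succ_left (n m : ℕ) :
    n.ascFactorial (m + 1) = n * (n + 1).ascFactorial m := by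
  rw [Nat.ascFactorial_succ, ← Nat.succ_ascFactorial]

/-- The coefficients `(i choose r) (k + r) ⋯ (k + i - 1)` of the expansion of the `i`-th theta
derivative of a form of weight `k` in powers of `E₂`. -/
def thetaCoeff (k i r : ℕ) : ℕ := i.choose r * (k + r).ascFactorial (i - r)

lemma thetaCoeff_self (k i : ℕ) : thetaCoeff k i i = 1 := by simp [thetaCoeff]

lemma thetaCoeff_eq_zero {k i r : ℕ} (h : i < r) : thetaCoeff k i r = 0 := by
  simp [thetaCoeff, Nat.choose_eq_zero_of_lt h]

lemma thetaCoeff_succ_zero (k i : ℕ) : thetaCoeff k (i + 1) 0 = thetaCoeff k i 0 * (i + k) := by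
  simp only [thetaCoeff, Nat.choose_zero_right, Nat.sub_zero, Nat.add_zero, Nat.ascFactorial_succ]
  ring

/-- This ratio of neighbouring coefficients is what cancels the E₄ terms in the expansion of θ^i. -/
lemma thetaCoeff_succ_mul (k i r : ℕ) :
    thetaCoeff k i (r + 1) * ((r + 1) * (r + k)) = thetaCoeff k i r * (i - r) := by
  rcases le_or_gt i r with h | h
  · rw [thetaCoeff_eq_zero (by omega), Nat.sub_eq_zero_of_le h, zero_mul, mul_zero]
  · obtain ⟨m, rfl⟩ := Nat.exists_eq_add_of_le (Nat.succ_le_of_lt h)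
    have h1 := Nat.choose_succ_right_eq (r.succ + m) r
    have h2 := Nat.ascFactorial_succ_left (k + r) m
    simp only [thetaCoeff, Nat.succ_eq_add_one] at *
    rw [show r + 1 + m - r = m + 1 by omega, show r + 1 + m - (r + 1) = m by omega] at *
    rw [h2, show k + (r + 1) = k + r + 1 by ring]
    linear_combination (k + r + 1).ascFactorial m * (k + r) * h1

lemma thetaCoeff_succ_succ (k i r : ℕ) :
    thetaCoeff k (i + 1) (r + 1) = thetaCoeff k i (r + 1) * (i + k + (r + 1)) + thetaCoeff k i r := by
  rcases lt_trichotomy i r with h | rfl | h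
  · rw [thetaCoeff_eq_zero (by omega), thetaCoeff_eq_zero (by omega), thetaCoeff_eq_zero h, zero_mul]
  · rw [thetaCoeff_self, thetaCoeff_eq_zero (by omega), thetaCoeff_self, zero_mul]
  · obtain ⟨m, rfl⟩ := Nat.exists_eq_add_of_le (Nat.succ_le_of_lt h)
    have h1 := Nat.choose_succ_right_eq (r.succ + m) r
    have h2 := Nat.ascFactorial_succ_left (k + r) m
    have h3 := Nat.ascFactorial_succ (n := k + r + 1) (k := m)
    have h4 := Nat.choose_succ_succ (r.succ + m) r
    simp only [thetaCoeff, Nat.succ_eq_add_one] at *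
    rw [show r + 1 + m + 1 - (r + 1) = m + 1 by omega, show r + 1 + m - r = m + 1 by omega,
      show r + 1 + m - (r + 1) = m by omega, h2, h4, show k + (r + 1) = k + r + 1 by ring, h3] at *
    linear_combination (k + r + 1).ascFactorial m * h1.symm

/-- The sequence `f₀ = P`, `f_{r+1} = ∂ f_r - r (r + k - 1) Q f_{r-1}`. -/
noncomputable def serreSeq {K : Type*} [CommRing K] (k : ℕ) (P : MvPolynomial (Fin 2) K) :
    ℕ → MvPolynomial (Fin 2) K
  | 0 => P
  | 1 => serreDer K P
  | r + 2 => serreDer K (serreSeq k P (r + 1)) -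
      (((r + 1) * (r + k) : ℕ) : MvPolynomial (Fin 2) K) * (X 0 * serreSeq k P r)

variable {K L : Type*} [CommRing K] [CommRing L] {P : MvPolynomial (Fin 2) K} {k : ℕ}

lemma isobaric_serreSeq (hP : Isobaric P k) (r : ℕ) : Isobaric (serreSeq k P r) (k + 2 * r) := by
  induction r using Nat.twoStepInduction with
  | zero => exact hP
  | one => exact isobaric_serreDer hP
  | more r h h' =>
    exact (isobaric_serreDer h').sub
      (((isobaric_Q.mul h).natCast_mul _).cast (by ring))

lemma map_serreSeq (φ : K →+* L) (k : ℕ) (P : MvPolynomial (Fin 2) K) (r : ℕ) :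
    map φ (serreSeq k P r) = serreSeq k (map φ P) r := by
  induction r using Nat.twoStepInduction with
  | zero => rfl
  | one => exact map_serreDer φ P
  | more r h h' => simp only [serreSeq, map_sub, map_mul, map_natCast, map_X, map_serreDer, h, h']

/-- The recursion solved for ∂f_r. At r = 0 the truncated index r - 1 is harmless, since its
coefficient has the factor r. -/
lemma thetaOperator_qEval_serreSeq (hP : Isobaric P k) (r : ℕ) :
    12 * thetaOperator (qEval K (serreSeq k P r)) = qEval K (serreSeq k P (r + 1)) +
      ((r * (r + k - 1) : ℕ) : K⟦X⟧) * (e4Series K * qEval K (serreSeq k P (r - 1))) +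
      ((k + 2 * r : ℕ) : K⟦X⟧) * e2Series K * qEval K (serreSeq k P r) := by
  rw [thetaOperator_qEval (isobaric_serreSeq hP r)]
  rcases r with _ | r
  · simp [serreSeq]
  · rw [serreSeq, map_sub, map_mul, map_mul, map_natCast, qEval_Q, Nat.add_sub_cancel,
      show r + 1 + k - 1 = r + k by omega]
    ring

lemma thetaOperator_iterate_qEval (hP : Isobaric P k) (i : ℕ) :
    12 ^ i * thetaOperator^[i] (qEval K P) = ∑ r ∈ Finset.range (i + 1),
      (thetaCoeff k i r : K⟦X⟧) * (e2Series K ^ (i - r) * qEval K (serreSeq k P r)) := by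
  induction i with
  | zero => simp [thetaCoeff_self, serreSeq]
  | succ i ih =>
    have h12 : (12 : K⟦X⟧) ^ (i + 1) * thetaOperator^[i + 1] (qEval K P) =
        12 * thetaOperator (12 ^ i * thetaOperator^[i] (qEval K P)) := by
      rw [← Nat.cast_ofNat, ← Nat.cast_pow, ← Nat.cast_pow, thetaOperator_natCast_mul,
        Function.iterate_succ_apply', pow_succ]
      push_cast
      ring
    rw [h12, ih, thetaOperator_sum, Finset.mul_sum]
    set e := e2Series K
    set g : ℕ → K⟦X⟧ := fun r => qEval K (serreSeq k P r) with hg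
    have he : 12 * thetaOperator e = e ^ 2 - e4Series K := thetaOperator_e2Series
    have hterm : ∀ r ∈ Finset.range (i + 1),
        12 * thetaOperator ((thetaCoeff k i r : K⟦X⟧) * (e ^ (i - r) * g r)) =
        (thetaCoeff k i r : K⟦X⟧) * ((i + k + r : ℕ) * (e ^ (i + 1 - r) * g r)) +
        (thetaCoeff k i r : K⟦X⟧) * (e ^ (i - r) * g (r + 1)) +
        (((thetaCoeff k i r : K⟦X⟧) * ((r * (r + k - 1) : ℕ) *
          (e4Series K * (e ^ (i - r) * g (r - 1))))) -
        (thetaCoeff k i r : K⟦X⟧) * ((i - r : ℕ) * (e4Series K * (e ^ (i - r - 1) * g r)))) := by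
      intro r hr
      have hri : r ≤ i := Nat.lt_succ_iff.1 (Finset.mem_range.1 hr)
      obtain ⟨j, rfl⟩ := Nat.exists_eq_add_of_le hri
      rw [thetaOperator_natCast_mul, thetaOperator_mul, thetaOperator_pow,
        show r + j - r = j by omega, show r + j + 1 - r = j + 1 by omega]
      have h1 := thetaOperator_qEval_serreSeq hP r
      have h2 : (j : K⟦X⟧) * (e ^ (j - 1) * e ^ 2) = j * e ^ (j + 1) := by
        rcases j with _ | j
        · simp
        · rw [← pow_add]; rfl
      simp only [hg] at *
      push_cast at h1 ⊢
      linear_combination (thetaCoeff k (r + j) r : K⟦X⟧) * e ^ j * h1 +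
        (thetaCoeff k (r + j) r : K⟦X⟧) * (j * e ^ (j - 1)) * qEval K (serreSeq k P r) * he +
        (thetaCoeff k (r + j) r : K⟦X⟧) * qEval K (serreSeq k P r) * h2
    rw [Finset.sum_congr rfl hterm, Finset.sum_add_distrib, Finset.sum_add_distrib,
      Finset.sum_sub_distrib]
    -- The E₄ terms coming from the recursion for f_r cancel those coming from 12θE₂ = E₂² - E₄; the
    -- correction term in `serreSeq` is chosen for this.
    have hcancel : ∑ r ∈ Finset.range (i + 1), (thetaCoeff k i r : K⟦X⟧) * ((r * (r + k - 1) : ℕ) *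
          (e4Series K * (e ^ (i - r) * g (r - 1)))) =
        ∑ r ∈ Finset.range (i + 1),
          (thetaCoeff k i r : K⟦X⟧) * ((i - r : ℕ) * (e4Series K * (e ^ (i - r - 1) * g r))) := by
      rw [Finset.sum_range_succ', Finset.sum_range_succ]
      simp only [zero_mul, Nat.cast_zero, mul_zero, Nat.sub_self, add_zero]
      refine Finset.sum_congr rfl fun r _ => ?_
      have h1 := congrArg (Nat.cast (R := K⟦X⟧)) (thetaCoeff_succ_mul k i r)
      push_cast at h1
      rw [Nat.add_sub_cancel, show r + 1 + k - 1 = r + k by omega, Nat.sub_sub]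
      push_cast
      linear_combination (e4Series K * (e ^ (i - (r + 1)) * g r)) * h1
    rw [hcancel, sub_self, add_zero, Finset.sum_range_succ' _ (i + 1)]
    have h0 : ∑ r ∈ Finset.range (i + 1),
        (thetaCoeff k i r : K⟦X⟧) * ((i + k + r : ℕ) * (e ^ (i + 1 - r) * g r)) =
        ∑ r ∈ Finset.range (i + 2),
        (thetaCoeff k i r : K⟦X⟧) * ((i + k + r : ℕ) * (e ^ (i + 1 - r) * g r)) := by
      rw [Finset.sum_range_succ _ (i + 1), thetaCoeff_eq_zero (Nat.lt_succ_self i), Nat.cast_zero,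
        zero_mul, add_zero]
    rw [h0, Finset.sum_range_succ' _ (i + 1), add_right_comm, ← Finset.sum_add_distrib]
    congr 1
    · refine Finset.sum_congr rfl fun r _ => ?_
      rw [thetaCoeff_succ_succ, Nat.add_sub_add_right]
      push_cast
      ring
    · rw [thetaCoeff_succ_zero]
      push_cast
      ring

end ThetaExpansion

/-! ### Divisibility of the expansion coefficients by p -/

section ThetaCoeffDivisibility

open MvPolynomial pIntegralRationals

variable {p : ℕ} [Fact p.Prime]

lemma prime_dvd_ascFactorial_iff {n m : ℕ} : p ∣ n.ascFactorial m ↔ ∃ t < m, p ∣ n + t := by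
  induction m with
  | zero => simpa using (Fact.out : p.Prime).one_lt.ne'
  | succ m ih =>
    rw [Nat.ascFactorial_succ, (Fact.out : p.Prime).dvd_mul, ih]
    constructor
    · rintro (h | ⟨t, ht, h⟩)
      · exact ⟨m, Nat.lt_succ_self m, h⟩
      · exact ⟨t, by omega, h⟩
    · rintro ⟨t, ht, h⟩
      rcases Nat.lt_succ_iff_lt_or_eq.1 ht with ht | rfl
      · exact Or.inr ⟨t, ht, h⟩
      · exact Or.inl h

lemma prime_not_dvd_ascFactorial {n m : ℕ} (a : ℕ) (h : p * a < n) (h' : n + m ≤ p * (a + 1)) :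
    ¬ p ∣ n.ascFactorial m := by
  rw [prime_dvd_ascFactorial_iff]
  rintro ⟨t, ht, s, hs⟩
  have h1 : a < s := lt_of_mul_lt_mul_left (a := p) (by omega) (Nat.zero_le _)
  have h2 : s < a + 1 := lt_of_mul_lt_mul_left (a := p) (by omega) (Nat.zero_le _)
  omega

lemma prime_not_dvd_choose {i r : ℕ} (hi : i < p) (hr : r ≤ i) : ¬ p ∣ i.choose r := by
  intro h
  have h1 : p ∣ i.factorial := by
    rw [← Nat.choose_mul_factorial_mul_factorial hr, mul_assoc]
    exact h.mul_right _
  have := ((Fact.out : p.Prime).dvd_factorial).1 h1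
  omega

variable {k : ℕ}

lemma not_dvd_thetaCoeff_zero (hk0 : 0 < k) {i : ℕ} (hi : k + i ≤ p) : ¬ p ∣ thetaCoeff k i 0 := by
  simp only [thetaCoeff, Nat.choose_zero_right, one_mul, Nat.sub_zero, add_zero]
  exact prime_not_dvd_ascFactorial 0 (by omega) (by omega)

/-- The factor p itself occurs in the product (k+r)⋯(k+i-1). -/
lemma dvd_thetaCoeff {i r : ℕ} (hr : k + r ≤ p) (hi : p < k + i) : p ∣ thetaCoeff k i r := by
  refine dvd_mul_of_dvd_right (prime_dvd_ascFactorial_iff.2 ⟨p - k - r, by omega, ?_⟩) _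
  rw [show k + r + (p - k - r) = p by omega]

lemma dvd_thetaCoeff_prime {r : ℕ} (hk0 : 0 < k) (hkp : k < p) (hr : r < p) :
    p ∣ thetaCoeff k p r := by
  rcases Nat.eq_zero_or_pos r with rfl | h
  · exact dvd_thetaCoeff hkp.le (by omega)
  · exact dvd_mul_of_dvd_left ((Fact.out : p.Prime).dvd_choose_self h.ne' hr) _

/-- The product starts just after p and stops before 2p. -/
lemma not_dvd_thetaCoeff {i r : ℕ} (hr : k + r = p + 1) (hri : r ≤ i) (hi : i < p) :
    ¬ p ∣ thetaCoeff k i r := by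
  refine (Fact.out : p.Prime).not_dvd_mul (prime_not_dvd_choose hi hri) ?_
  exact prime_not_dvd_ascFactorial 1 (by omega) (by omega)

/-- Since k + i - 1 < 2p, the only multiple of p among the factors k, …, k+i-1 is p itself. -/
lemma not_sq_dvd_thetaCoeff_zero (hk0 : 0 < k) (hkp : k < p) {i : ℕ} (hi : p < k + i) (hip : i ≤ p) :
    ¬ p ^ 2 ∣ thetaCoeff k i 0 := by
  obtain ⟨m, rfl⟩ : ∃ m, i = p - k + (m + 1) := ⟨i - (p - k) - 1, by omega⟩
  simp only [thetaCoeff, Nat.choose_zero_right, one_mul, Nat.sub_zero, add_zero]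
  rw [← Nat.ascFactorial_mul_ascFactorial, show k + (p - k) = p by omega,
    Nat.ascFactorial_succ_left p m, mul_left_comm, sq]
  intro h
  have := Nat.dvd_of_mul_dvd_mul_left (Fact.out : p.Prime).pos h
  refine (Fact.out : p.Prime).not_dvd_mul ?_ ?_ this
  · exact prime_not_dvd_ascFactorial 0 (by omega) (by omega)
  · exact prime_not_dvd_ascFactorial 1 (by omega) (by omega)

end ThetaCoeffDivisibility

/-! ### Powers of E₂ modulo p² -/

section EisensteinPowers

open MvPolynomial pIntegralRationals

/-- Applied modulo p² with x = p, a = E_{p-1}, e = E₂, n = p. Multiplying e^j by a^n = 1 allows e·a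
to be expanded. As x absorbs powers of a, the exponent n - 1 - j only fixes the weight, and its
truncation at j = n does no harm. -/
lemma pow_eq_of_mul_eq_sub {S : Type*} [CommRing S] {x a b d e : S} (hx : x ^ 2 = 0) {n : ℕ}
    (han : a ^ n = 1) (hxa : x * a = x) (he : e * a = b - x * d) {j : ℕ} (hj : j ≤ n) :
    e ^ j = a ^ (n - j) * b ^ j - j * x * (a ^ (n - 1 - j) * b ^ (j - 1) * d) := by
  have h1 : ∀ m, x * a ^ m = x := fun m => by
    induction m with
    | zero => simp
    | succ m ih => rw [pow_succ, ← mul_assoc, ih, hxa]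
  have h2 : (b - x * d) ^ j = b ^ j - j * x * (b ^ (j - 1) * d) := by
    clear hj
    induction j with
    | zero => simp
    | succ j ih =>
      have h3 : (j : S) * (b ^ (j - 1) * b) = j * b ^ j := by
        rcases j with _ | j
        · simp
        · rw [← pow_succ]; rfl
      rw [pow_succ, ih, Nat.add_sub_cancel, pow_succ]
      push_cast
      linear_combination j * b ^ (j - 1) * d ^ 2 * hx - x * d * h3
  calc e ^ j = a ^ (n - j) * (e * a) ^ j := by
        rw [mul_pow, mul_left_comm, ← pow_add, Nat.sub_add_cancel hj, han, mul_one]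
    _ = _ := by
        rw [he, h2]
        linear_combination -j * (b ^ (j - 1) * d) * h1 (n - j) +
          j * (b ^ (j - 1) * d) * h1 (n - 1 - j)

variable {p : ℕ} [Fact p.Prime] {c : pIntegralRationals p}
  {A : MvPolynomial (Fin 2) (pIntegralRationals p)}

/-- The theta derivative of the Hasse lift is `p` times a form of weight `p * (p + 1)` that is
prime to the Hasse invariant. -/
lemma exists_thetaOperator_qEval_hasse (hp5 : 5 ≤ p) (hc : reduction p c ≠ 0)
    (hA : Isobaric A (p - 1)) (hqA : qEval _ A = eisSeries _ (p * c) (p - 2)) :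
    ∃ D, Isobaric D (p * (p + 1)) ∧
      IsRelPrime (map (reduction p) A) (map (reduction p) D) ∧
      (p : (pIntegralRationals p)⟦X⟧) ^ 2 ∣ thetaOperator (qEval _ A) - p * qEval _ D := by
  have hqA1 := qEval_map_hasse hqA
  have hp1 := (Fact.out : p.Prime).one_le
  obtain ⟨Y, Z, hY, hqY, hYZ⟩ := exists_thetaOperator_iterate_e2Series (hA.map _) hqA1 (p - 1)
  rw [Nat.sub_add_cancel hp1] at hY hYZ
  rw [← thetaOperator_sigmaSeries hp5] at hqY
  set κ : ZMod p := 12 ^ (p - 1) * -24 with hκ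
  have hκ0 : κ ≠ 0 := mul_ne_zero (pow_ne_zero _ (ZMod.twelve_ne_zero hp5))
    (neg_ne_zero.2 (ZMod.ofNat_24_ne_zero hp5))
  have hqY' : qEval _ Y = PowerSeries.C κ * thetaOperator (sigmaSeries (ZMod p) (p - 2)) := by
    rw [hqY, hκ, map_mul, map_pow, map_neg, map_ofNat, map_ofNat]
    ring
  obtain ⟨D, hD, hDY⟩ := (hY.C_mul (reduction p c * κ⁻¹)).exists_lift
  refine ⟨D, hD, ?_, ?_⟩
  · rw [hDY, hYZ]
    have hu : IsUnit (C (σ := Fin 2) (reduction p c * κ⁻¹)) :=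
      (IsUnit.mk0 _ (mul_ne_zero hc (inv_ne_zero hκ0))).map C
    have hf : IsUnit (((p - 1).factorial : ℕ) : MvPolynomial (Fin 2) (ZMod p)) := by
      rw [← map_natCast C]
      refine IsUnit.map C (IsUnit.mk0 _ (ZMod.natCast_ne_zero_of_coprime fun h => ?_))
      have := ((Fact.out : p.Prime).dvd_factorial).1 h
      omega
    rw [isRelPrime_mul_unit_left_right hu, IsRelPrime.add_mul_left_right_iff,
      isRelPrime_mul_unit_left_right hf]
    exact (isRelPrime_hasse hp5 (hA.map _) hqA1).pow_right
  · have h1 : thetaOperator (qEval _ A) = p *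
        thetaOperator (PowerSeries.C c * sigmaSeries (pIntegralRationals p) (p - 2)) := by
      rw [qEval_hasse hqA, thetaOperator_add, thetaOperator_one, zero_add, thetaOperator_natCast_mul]
    rw [h1, ← mul_sub, sq]
    refine mul_dvd_mul_left _ ((map_reduction_eq_iff _ _).1 ?_)
    rw [map_qEval, hDY, map_mul, qEval_C, hqY', map_thetaOperator, map_mul, PowerSeries.map_C,
      map_sigmaSeries, thetaOperator_C_mul, ← mul_assoc, ← map_mul, mul_assoc,
      inv_mul_cancel₀ hκ0, mul_one]

/-- The powers of `E₂` modulo `p ^ 2` as modular forms. -/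
lemma exists_e2Series_pow (hp5 : 5 ≤ p) (hc : reduction p c ≠ 0)
    (hA : Isobaric A (p - 1)) (hqA : qEval _ A = eisSeries _ (p * c) (p - 2)) :
    ∃ B D, Isobaric B (p + 1) ∧ Isobaric D (p * (p + 1)) ∧
      map (reduction p) B = serreDer _ (map (reduction p) A) ∧
      IsRelPrime (map (reduction p) A) (map (reduction p) D) ∧
      ∀ j ≤ p, (p : (pIntegralRationals p)⟦X⟧) ^ 2 ∣ e2Series _ ^ j -
        (qEval _ A ^ (p - j) * qEval _ B ^ j -
          (j : (pIntegralRationals p)⟦X⟧) * (p : (pIntegralRationals p)⟦X⟧) * (qEval _ A ^ (p - 1 - j) * qEval _ B ^ (j - 1) * (12 * qEval _ D))) := by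
  have hp1 := (Fact.out : p.Prime).one_le
  obtain ⟨D, hD, hAD, hθ⟩ := exists_thetaOperator_qEval_hasse hp5 hc hA hqA
  -- From 12θA = ∂A + (p-1)E₂A, multiplication by 1 + p turns p - 1 into -1 modulo p², so E₂A =
  -- (1+p)∂A - 12pD.
  refine ⟨((1 + p : ℕ) : MvPolynomial (Fin 2) (pIntegralRationals p)) * serreDer _ A, D,
    ((isobaric_serreDer hA).cast (by omega)).natCast_mul _, hD, ?_, hAD, fun j hj => ?_⟩
  · rw [map_mul, map_natCast, map_serreDer, ← map_natCast C,
      show ((1 + p : ℕ) : ZMod p) = 1 by simp, map_one, one_mul]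
  · set I : Ideal (pIntegralRationals p)⟦X⟧ := Ideal.span {(p : (pIntegralRationals p)⟦X⟧) ^ 2}
    have hI : ∀ x y : (pIntegralRationals p)⟦X⟧,
        Ideal.Quotient.mk I x = Ideal.Quotient.mk I y ↔ (p : (pIntegralRationals p)⟦X⟧) ^ 2 ∣ x - y :=
      fun x y => by rw [Ideal.Quotient.eq, Ideal.mem_span_singleton]
    have hp2 : (Ideal.Quotient.mk I p) ^ 2 = 0 := by
      rw [← map_pow, ← map_zero (Ideal.Quotient.mk I), hI, sub_zero]
    obtain ⟨e, he⟩ := sq_dvd_one_add_mul_pow_sub (p : (pIntegralRationals p)⟦X⟧)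
      (PowerSeries.C c * sigmaSeries (pIntegralRationals p) (p - 2)) p
    rw [← hI]
    have hap : (Ideal.Quotient.mk I (qEval _ A)) ^ p = 1 := by
      rw [← map_pow, ← map_one (Ideal.Quotient.mk I), hI, qEval_hasse hqA]
      exact ⟨e + PowerSeries.C c * sigmaSeries (pIntegralRationals p) (p - 2),
        by linear_combination he⟩
    have hpa : Ideal.Quotient.mk I p * Ideal.Quotient.mk I (qEval _ A) = Ideal.Quotient.mk I p := by
      rw [← map_mul, hI, qEval_hasse hqA]
      exact ⟨PowerSeries.C c * sigmaSeries (pIntegralRationals p) (p - 2), by ring⟩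
    have hea : Ideal.Quotient.mk I (e2Series _) * Ideal.Quotient.mk I (qEval _ A) =
        Ideal.Quotient.mk I (qEval _ (((1 + p : ℕ) :
          MvPolynomial (Fin 2) (pIntegralRationals p)) * serreDer _ A)) -
        Ideal.Quotient.mk I p * Ideal.Quotient.mk I (12 * qEval _ D) := by
      rw [← map_mul, ← map_mul, ← map_sub, hI]
      obtain ⟨z, hz⟩ := hθ
      have h1 := thetaOperator_qEval hA
      rw [Nat.cast_pred hp1] at h1
      refine ⟨e2Series _ * qEval _ A - 12 * qEval _ D - 12 * (1 + (p : (pIntegralRationals p)⟦X⟧)) * z, ?_⟩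
      rw [map_mul, map_natCast]
      push_cast
      linear_combination (1 + p : (pIntegralRationals p)⟦X⟧) * h1 -
        12 * (1 + p : (pIntegralRationals p)⟦X⟧) * hz
    have := pow_eq_of_mul_eq_sub hp2 hap hpa hea hj
    simp only [← map_natCast (Ideal.Quotient.mk I), ← map_mul, ← map_pow, ← map_sub] at this ⊢
    exact this

end EisensteinPowers

/-! ### Nonvanishing modulo p and the obstruction -/

section ThetaModP

open MvPolynomial pIntegralRationals

lemma exists_sum_range_pow_mul_eq {S : Type*} [CommRing S] (a : S) (y : ℕ → S) (n : ℕ) :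
    ∃ T, ∑ l ∈ Finset.range (n + 2), a ^ l * y l = y 0 + a * y 1 + a ^ 2 * T := by
  refine ⟨∑ l ∈ Finset.range n, a ^ l * y (l + 2), ?_⟩
  rw [Finset.sum_range_succ', Finset.sum_range_succ', Finset.mul_sum,
    Finset.sum_congr rfl fun l _ => show a ^ (l + 1 + 1) * y (l + 1 + 1) = a ^ 2 * (a ^ l * y (l + 2)) by ring]
  ring

variable {p : ℕ} [Fact p.Prime] {A : MvPolynomial (Fin 2) (ZMod p)}
  {P : MvPolynomial (Fin 2) (ZMod p)} {k : ℕ}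

/-- In F_p one has n^i = 0 only if n = 0, so i = 1 suffices. If θP = 0, then A∂P + k(∂A)P = 0, and
A, being prime to ∂A, would divide P. -/
lemma thetaOperator_iterate_qEval_ne_zero (hp5 : 5 ≤ p) (hA : Isobaric A (p - 1))
    (hqA : qEval _ A = 1) (hP : Isobaric P k) (hAP : ¬ A ∣ P) (hk : ¬ p ∣ k) (i : ℕ) :
    thetaOperator^[i] (qEval _ P) ≠ 0 := by
  rcases Nat.eq_zero_or_pos i with rfl | hi
  · intro h
    exact hAP ((hP.eq_zero_of_qEval_eq_zero (isUnit_1728_zmod hp5) h) ▸ dvd_zero A)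
  · intro h
    have h1 : thetaOperator (qEval _ P) = 0 := by
      ext n
      have := congrArg (PowerSeries.coeff n) h
      rw [coeff_thetaOperator_iterate, map_zero, mul_eq_zero, pow_eq_zero_iff hi.ne'] at this
      rw [coeff_thetaOperator, map_zero, mul_eq_zero]
      exact this
    have h2 : A * serreDer _ P + ((k : ℕ) : MvPolynomial (Fin 2) (ZMod p)) * (serreDer _ A * P) = 0 := by
      have hp1 := (Fact.out : p.Prime).one_le
      refine ((hA.mul (isobaric_serreDer hP)).add ((((isobaric_serreDer hA).mul hP).natCast_mul
        k).cast (by ring))).eq_zero_of_qEval_eq_zero (isUnit_1728_zmod hp5) ?_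
      have h3 := thetaOperator_qEval hP
      rw [h1, mul_zero] at h3
      rw [map_add, map_mul, map_mul, map_mul, map_natCast, hqA, qEval_serreDer_hasse hA hqA]
      linear_combination -h3
    have hu : IsUnit ((k : ℕ) : MvPolynomial (Fin 2) (ZMod p)) := by
      rw [← map_natCast C]
      exact IsUnit.map C (IsUnit.mk0 _ (ZMod.natCast_ne_zero_of_coprime hk))
    have h3 : A ∣ ((k : ℕ) : MvPolynomial (Fin 2) (ZMod p)) * (serreDer _ A * P) :=
      ⟨-serreDer _ P, by linear_combination h2⟩
    exact hAP ((isRelPrime_hasse hp5 hA hqA).dvd_of_dvd_mul_left (hu.dvd_mul_left.1 h3))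

/-- The sum that controls the weight filtration modulo `p ^ 2` of the `i`-th theta derivative. -/
noncomputable def thetaObstruction (k i : ℕ) (A P : MvPolynomial (Fin 2) (ZMod p)) :
    MvPolynomial (Fin 2) (ZMod p) :=
  ∑ r ∈ Finset.range (i + 1), ((thetaCoeff k i r * (i - r) : ℕ) : MvPolynomial (Fin 2) (ZMod p)) *
    (A ^ r * serreDer _ A ^ (i - r - 1) * serreSeq k P r)

lemma isUnit_natCast_mvPolynomial {n : ℕ} (h : ¬ p ∣ n) :
    IsUnit (n : MvPolynomial (Fin 2) (ZMod p)) := by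
  rw [← map_natCast C]
  exact IsUnit.map C (IsUnit.mk0 _ (ZMod.natCast_ne_zero_of_coprime h))

lemma natCast_mvPolynomial_eq_zero {n : ℕ} (h : p ∣ n) :
    (n : MvPolynomial (Fin 2) (ZMod p)) = 0 := by
  rw [← map_natCast C, (ZMod.natCast_eq_zero_iff n p).2 h, map_zero]

/-- Modulo A only the term r = 0 remains: a unit times (∂A)^{i-1}P. -/
lemma not_dvd_thetaObstruction_of_le (hp5 : 5 ≤ p) (hA : Isobaric A (p - 1))
    (hqA : qEval _ A = 1) (hAP : ¬ A ∣ P) (hk0 : 0 < k) {i : ℕ} (hi : 0 < i) (hki : k + i ≤ p) :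
    ¬ A ∣ thetaObstruction k i A P := by
  rw [thetaObstruction, Finset.sum_range_succ']
  intro h
  rw [dvd_add_right (Finset.dvd_sum fun r _ => ?_)] at h
  · have hu := isUnit_natCast_mvPolynomial ((Fact.out : p.Prime).not_dvd_mul
      (not_dvd_thetaCoeff_zero hk0 hki) (n := i - 0)
      (fun h => by have := Nat.le_of_dvd (by omega) h; omega))
    rw [hu.dvd_mul_left, pow_zero, one_mul] at h
    exact hAP ((isRelPrime_hasse hp5 hA hqA).pow_right.dvd_of_dvd_mul_left h)
  · exact (((dvd_pow_self A r.succ_ne_zero).mul_right _).mul_right _).mul_left _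

/-- For `r = p - k + 1` the form `f_r` represents the theta derivative. -/
lemma qEval_serreSeq_of_add_eq (hP : Isobaric P k) {r : ℕ} (hr : k + r = p + 1) :
    qEval _ (serreSeq k P r) = 12 ^ r * thetaOperator^[r] (qEval _ P) := by
  rw [thetaOperator_iterate_qEval hP, Finset.sum_range_succ, Finset.sum_eq_zero, thetaCoeff_self,
    Nat.sub_self]
  · simp
  · intro s hs
    have := Finset.mem_range.1 hs
    rw [← map_natCast (PowerSeries.C (R := ZMod p)), (ZMod.natCast_eq_zero_iff _ p).2
      (dvd_thetaCoeff (by omega) (by omega)), map_zero, zero_mul]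

/-- The weight of f_r is 2p + 2 - k, so the quotient by A² would have weight 4 - k < 4 and be a
constant. But f_r represents 12^r θ^r P, which is nonzero without constant term. -/
lemma sq_not_dvd_serreSeq (hp5 : 5 ≤ p) (hA : Isobaric A (p - 1)) (hqA : qEval _ A = 1)
    (hP : Isobaric P k) (hAP : ¬ A ∣ P) (hk0 : 0 < k) (hkp : k < p) {r : ℕ} (hr : k + r = p + 1) :
    ¬ A ^ 2 ∣ serreSeq k P r := by
  rintro ⟨h, hh⟩
  have hq := qEval_serreSeq_of_add_eq hP hr
  have hne : (12 : (ZMod p)⟦X⟧) ^ r * thetaOperator^[r] (qEval _ P) ≠ 0 := by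
    refine mul_ne_zero (pow_ne_zero _ ?_) (thetaOperator_iterate_qEval_ne_zero hp5 hA hqA hP hAP
      (fun h => by have := Nat.le_of_dvd hk0 h; omega) r)
    rw [← map_ofNat PowerSeries.C 12]
    exact (map_ne_zero_iff _ PowerSeries.C_injective).2 (ZMod.twelve_ne_zero hp5)
  have hf0 : serreSeq k P r ≠ 0 := by
    intro h0
    rw [h0, map_zero] at hq
    exact hne hq.symm
  obtain ⟨v, v', hvv, hv, hv'⟩ := (isobaric_serreSeq hP r).exists_of_eq_mul hf0 hh
  have hvA := IsWeightedHomogeneous.inj_right (pow_ne_zero 2 (hasse_ne_zero hqA)) (hA.pow 2) hv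
  have hC : ∃ x, h = C x := by
    rcases Nat.eq_zero_or_pos v' with rfl | h0
    · exact ⟨_, hv'.eq_C⟩
    · exact ⟨0, by rw [map_zero]; exact hv'.eq_zero_of_forall fun a b => by omega⟩
  obtain ⟨x, rfl⟩ := hC
  rw [hh, map_mul, map_pow, hqA, one_pow, one_mul, qEval_C] at hq
  have h0 := congrArg (PowerSeries.coeff 0) hq
  rw [← map_ofNat PowerSeries.C 12, ← map_pow, PowerSeries.coeff_C_mul, coeff_thetaOperator_iterate,
    Nat.cast_zero, zero_pow (by omega), zero_mul, mul_zero, PowerSeries.coeff_zero_C] at h0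
  rw [h0, map_zero] at hq
  exact hne hq.symm

/-- The terms before r = p + 1 - k vanish modulo p. The two leading terms after that decide:
divisibility forces first A | f_r, then A² | f_r. -/
lemma not_dvd_thetaObstruction_of_lt (hp5 : 5 ≤ p) (hA : Isobaric A (p - 1))
    (hqA : qEval _ A = 1) (hP : Isobaric P k) (hAP : ¬ A ∣ P) (hk0 : 0 < k) (hkp : k < p) {i : ℕ}
    (hi : p + 1 < k + i) (hip : i < p) : ¬ A ^ (i + 1) ∣ thetaObstruction k i A P := by
  obtain ⟨r, hr⟩ : ∃ r, k + r = p + 1 := ⟨p + 1 - k, by omega⟩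
  obtain ⟨n, rfl⟩ : ∃ n, i = r + (n + 1) := ⟨i - r - 1, by omega⟩
  have hA0 := hasse_ne_zero hqA
  have hrel := isRelPrime_hasse hp5 hA hqA
  have hsum : thetaObstruction k (r + (n + 1)) A P = A ^ r * ∑ l ∈ Finset.range (n + 2), A ^ l *
      (((thetaCoeff k (r + (n + 1)) (r + l) * (n + 1 - l) : ℕ) : MvPolynomial (Fin 2) (ZMod p)) *
        (serreDer _ A ^ (n - l) * serreSeq k P (r + l))) := by
    rw [thetaObstruction, show r + (n + 1) + 1 = r + (n + 2) by ring, Finset.sum_range_add,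
      Finset.sum_eq_zero, zero_add, Finset.mul_sum]
    · refine Finset.sum_congr rfl fun l _ => ?_
      rw [show r + (n + 1) - (r + l) = n + 1 - l by omega, show n + 1 - l - 1 = n - l by omega, pow_add]
      ring
    · intro s hs
      have := Finset.mem_range.1 hs
      rw [natCast_mvPolynomial_eq_zero ((dvd_thetaCoeff (by omega) (by omega)).mul_right _), zero_mul]
  obtain ⟨T, hT⟩ := exists_sum_range_pow_mul_eq A (fun l =>
    ((thetaCoeff k (r + (n + 1)) (r + l) * (n + 1 - l) : ℕ) : MvPolynomial (Fin 2) (ZMod p)) *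
      (serreDer _ A ^ (n - l) * serreSeq k P (r + l))) n
  rw [hT] at hsum
  simp only [Nat.sub_zero, Nat.add_zero, Nat.add_sub_cancel] at hsum
  intro hdvd
  rw [hsum, show r + (n + 1) + 1 = r + (n + 2) by ring, pow_add,
    mul_dvd_mul_iff_left (pow_ne_zero r hA0)] at hdvd
  have hd2 : A ^ 2 ∣ ((thetaCoeff k (r + (n + 1)) r * (n + 1) : ℕ) : MvPolynomial (Fin 2) (ZMod p)) *
        (serreDer _ A ^ n * serreSeq k P r) +
      A * (((thetaCoeff k (r + (n + 1)) (r + 1) * n : ℕ) : MvPolynomial (Fin 2) (ZMod p)) *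
        (serreDer _ A ^ (n - 1) * serreSeq k P (r + 1))) :=
    (dvd_add_left (dvd_mul_right _ _)).1 ((pow_dvd_pow A (by omega)).trans hdvd)
  have hc : ¬ p ∣ thetaCoeff k (r + (n + 1)) r * (n + 1) :=
    (Fact.out : p.Prime).not_dvd_mul (not_dvd_thetaCoeff hr (by omega) hip)
      (fun h => by have := Nat.le_of_dvd (by omega) h; omega)
  have hd1 : A ∣ serreSeq k P r := by
    have h1 := (dvd_add_left (dvd_mul_right A _)).1 ((dvd_pow_self A two_ne_zero).trans hd2)
    exact hrel.pow_right.dvd_of_dvd_mul_left ((isUnit_natCast_mvPolynomial hc).dvd_mul_left.1 h1)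
  obtain ⟨h, hh⟩ := hd1
  -- The correction term of the recursion carries the factor r + k - 1 = p and disappears.
  have hnext : serreSeq k P (r + 1) = A * serreDer _ h + serreDer _ A * h := by
    obtain ⟨s, rfl⟩ : ∃ s, r = s + 1 := ⟨r - 1, by omega⟩
    rw [serreSeq, hh, Derivation.leibniz, natCast_mvPolynomial_eq_zero
      (Dvd.dvd.mul_left (show p ∣ s + k by rw [show s + k = p by omega]) _)]
    simp only [smul_eq_mul]
    ring
  -- Since r + k is 1 modulo p, `thetaCoeff_succ_mul` shows that r + 1 times this sum is t_r(n+1)i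
  -- modulo p, with i = r + n + 1 < p.
  have hcomb : ¬ p ∣ thetaCoeff k (r + (n + 1)) r * (n + 1) +
      thetaCoeff k (r + (n + 1)) (r + 1) * n := by
    intro hd
    have h1 := thetaCoeff_succ_mul k (r + (n + 1)) r
    rw [show r + k = p + 1 by omega, show r + (n + 1) - r = n + 1 by omega] at h1
    have h2 : (r + 1) * (thetaCoeff k (r + (n + 1)) r * (n + 1) +
      thetaCoeff k (r + (n + 1)) (r + 1) * n) + p * (thetaCoeff k (r + (n + 1)) (r + 1) * (r + 1) * n) =
      thetaCoeff k (r + (n + 1)) r * (n + 1) * (r + (n + 1)) := by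
      linear_combination n * h1
    have h3 : p ∣ thetaCoeff k (r + (n + 1)) r * (n + 1) * (r + (n + 1)) :=
      h2 ▸ dvd_add (hd.mul_left _) (dvd_mul_right _ _)
    refine (Fact.out : p.Prime).not_dvd_mul hc (fun h => ?_) h3
    have := Nat.le_of_dvd (by omega) h
    omega
  have hd3 : A ∣ ((thetaCoeff k (r + (n + 1)) r * (n + 1) +
      thetaCoeff k (r + (n + 1)) (r + 1) * n : ℕ) : MvPolynomial (Fin 2) (ZMod p)) *
      (serreDer _ A ^ n * h) := by
    have hB : ((n : ℕ) : MvPolynomial (Fin 2) (ZMod p)) * (serreDer _ A ^ (n - 1) * serreDer _ A) =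
        n * serreDer _ A ^ n := by
      rcases n with _ | n
      · simp
      · rw [← pow_succ]; rfl
    obtain ⟨z, hz⟩ := hd2
    rw [hh, hnext] at hz
    refine ⟨z - ((thetaCoeff k (r + (n + 1)) (r + 1) * n : ℕ) : MvPolynomial (Fin 2) (ZMod p)) *
      (serreDer _ A ^ (n - 1) * serreDer _ h), mul_left_cancel₀ hA0 ?_⟩
    push_cast at hz ⊢
    linear_combination hz - A * h *
      (thetaCoeff k (r + (n + 1)) (r + 1) : MvPolynomial (Fin 2) (ZMod p)) * hB
  have hAh := hrel.pow_right.dvd_of_dvd_mul_left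
    ((isUnit_natCast_mvPolynomial hcomb).dvd_mul_left.1 hd3)
  refine sq_not_dvd_serreSeq hp5 hA hqA hP hAP hk0 hkp hr ?_
  rw [hh, sq]
  exact mul_dvd_mul_left A hAh

end ThetaModP

/-! ### Filtrations of the theta derivatives -/

section ThetaFiltration

open MvPolynomial pIntegralRationals

variable {p : ℕ} {c : pIntegralRationals p}
  {A P : MvPolynomial (Fin 2) (pIntegralRationals p)} {k : ℕ}

lemma twelve_pow_mul_thetaOperator (hP : Isobaric P k) (i : ℕ) :
    PowerSeries.C ((12 : pIntegralRationals p) ^ i) * thetaOperator^[i] (qEval _ P) =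
      ∑ r ∈ Finset.range (i + 1), (thetaCoeff k i r : (pIntegralRationals p)⟦X⟧) *
        (e2Series _ ^ (i - r) * qEval _ (serreSeq k P r)) := by
  rw [map_pow, map_ofNat, thetaOperator_iterate_qEval hP]

variable [Fact p.Prime]

lemma map_qEval_ne_zero_of_sq_dvd {G H : MvPolynomial (Fin 2) (pIntegralRationals p)}
    {u : pIntegralRationals p} (hu : IsUnit u) {g : (pIntegralRationals p)⟦X⟧}
    (hg : (p : (pIntegralRationals p)⟦X⟧) ^ 2 ∣
      PowerSeries.C u * g - (qEval _ G + p * qEval _ H))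
    (hg0 : PowerSeries.map (reduction p) g ≠ 0) : map (reduction p) G ≠ 0 := by
  intro hG
  have h1 : PowerSeries.map (reduction p) _ = PowerSeries.map (reduction p) _ :=
    (map_reduction_eq_iff _ _).2 ((dvd_pow_self _ two_ne_zero).trans hg)
  rw [map_add, map_mul, map_mul, map_qEval, hG, map_zero, zero_add, PowerSeries.map_C,
    (map_reduction_eq_zero_iff (p : (pIntegralRationals p)⟦X⟧)).2 dvd_rfl, zero_mul] at h1
  refine mul_ne_zero ?_ hg0 h1
  exact (map_ne_zero_iff _ PowerSeries.C_injective).2 (hu.map (reduction p)).ne_zero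

lemma isUnit_twelve_pow (hp5 : 5 ≤ p) (i : ℕ) : IsUnit ((12 : pIntegralRationals p) ^ i) := by
  refine IsUnit.pow i (isUnit_of_reduction_ne_zero ?_)
  rw [map_ofNat]
  exact ZMod.twelve_ne_zero hp5

/-- The filtration of the `i`-th theta derivative if it is not lowered. -/
theorem weightFiltration_thetaOperator_of_not_dvd (hp5 : 5 ≤ p) (hc : reduction p c ≠ 0)
    (hA : Isobaric A (p - 1)) (hqA : qEval _ A = eisSeries _ (p * c) (p - 2)) (hP : Isobaric P k)
    {i : ℕ} (hip : i < p) (h0 : PowerSeries.map (reduction p) (thetaOperator^[i] (qEval _ P)) ≠ 0)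
    (hobs : ¬ map (reduction p) A ^ (i + 1) ∣
      thetaObstruction k i (map (reduction p) A) (map (reduction p) P)) :
    weightFiltration p 2 (thetaOperator^[i] (qEval _ P)) = (k + 2 * i + 2 * p * (p - 1) : ℕ) := by
  obtain ⟨q, rfl⟩ : ∃ q, p = q + 1 := ⟨p - 1, by omega⟩
  obtain ⟨B, D, hB, hD, hBA, hAD, hE⟩ := exists_e2Series_pow hp5 hc hA hqA
  set G := ∑ r ∈ Finset.range (i + 1), (thetaCoeff k i r :
    MvPolynomial (Fin 2) (pIntegralRationals (q + 1))) *
      (A ^ (q + 1 - (i - r)) * B ^ (i - r) * serreSeq k P r) with hGdef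
  set H := ∑ r ∈ Finset.range (i + 1), ((thetaCoeff k i r * (i - r) : ℕ) :
    MvPolynomial (Fin 2) (pIntegralRationals (q + 1))) *
      (A ^ (q - (i - r)) * B ^ (i - r - 1) * D * serreSeq k P r) with hHdef
  have hG : Isobaric G (k + 2 * i + (q + 1) * q) := by
    refine Isobaric.sum fun r hr => Isobaric.natCast_mul ((((hA.pow _).mul (hB.pow _)).mul
      (isobaric_serreSeq hP r)).cast ?_) _
    obtain ⟨j, rfl⟩ := Nat.exists_eq_add_of_le (Nat.lt_succ_iff.1 (Finset.mem_range.1 hr))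
    obtain ⟨l, hl⟩ := Nat.exists_eq_add_of_le (show j ≤ q + 1 by omega)
    rw [show r + j - r = j by omega, show q + 1 - j = l by omega, Nat.add_sub_cancel]
    linear_combination q * hl.symm
  have hH : Isobaric H (k + 2 * i + (q + 1) * q + (q + 1) * (q + 1 - 1)) := by
    refine Isobaric.sum fun r hr => ?_
    obtain ⟨j, rfl⟩ := Nat.exists_eq_add_of_le (Nat.lt_succ_iff.1 (Finset.mem_range.1 hr))
    rw [show r + j - r = j by omega]
    rcases j with _ | j
    · rw [mul_zero, Nat.cast_zero, zero_mul]
      exact isobaric_zero _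
    · refine Isobaric.natCast_mul (((((hA.pow _).mul (hB.pow _)).mul hD).mul
        (isobaric_serreSeq hP r)).cast ?_) _
      obtain ⟨l, hl⟩ := Nat.exists_eq_add_of_le (show j + 1 ≤ q by omega)
      rw [show q - (j + 1) = l by omega, Nat.add_sub_cancel, Nat.add_sub_cancel]
      linear_combination q * hl.symm
  have hg : ((q + 1 : ℕ) : (pIntegralRationals (q + 1))⟦X⟧) ^ 2 ∣
      PowerSeries.C ((12 : pIntegralRationals (q + 1)) ^ i) * thetaOperator^[i] (qEval _ P) -
        (qEval _ G + ((q + 1 : ℕ) : (pIntegralRationals (q + 1))⟦X⟧) * qEval _ (C (-12) * H)) := by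
    have e1 : qEval _ G + ((q + 1 : ℕ) : (pIntegralRationals (q + 1))⟦X⟧) * qEval _ (C (-12) * H) =
        ∑ r ∈ Finset.range (i + 1), (thetaCoeff k i r : (pIntegralRationals (q + 1))⟦X⟧) *
          ((qEval _ A ^ (q + 1 - (i - r)) * qEval _ B ^ (i - r) -
          ((i - r : ℕ) : (pIntegralRationals (q + 1))⟦X⟧) *
            ((q + 1 : ℕ) : (pIntegralRationals (q + 1))⟦X⟧) *
            (qEval _ A ^ (q + 1 - 1 - (i - r)) * qEval _ B ^ (i - r - 1) * (12 * qEval _ D))) *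
            qEval _ (serreSeq k P r)) := by
      rw [map_mul, qEval_C, map_neg, map_ofNat, hGdef, hHdef, map_sum, map_sum, Finset.mul_sum,
        Finset.mul_sum, ← Finset.sum_add_distrib]
      refine Finset.sum_congr rfl fun r _ => ?_
      simp only [map_mul, map_pow, map_natCast, Nat.cast_mul, Nat.add_sub_cancel]
      ring
    rw [twelve_pow_mul_thetaOperator hP, e1, ← Finset.sum_sub_distrib]
    refine Finset.dvd_sum fun r _ => ?_
    rw [← mul_sub, ← sub_mul]
    exact ((hE (i - r) (by omega)).mul_right _).mul_left _
  -- The common factor A^{p-1-i} leaves A^{i+1} of the required A^p; D drops out because it is prime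
  -- to A.
  have hHm : map (reduction (q + 1)) (C (-12) * H) = C (-12) * (map (reduction (q + 1)) A ^ (q - i) *
      map (reduction (q + 1)) D * thetaObstruction k i (map (reduction (q + 1)) A)
        (map (reduction (q + 1)) P)) := by
    rw [map_mul, map_C, map_neg, map_ofNat, hHdef, map_sum, thetaObstruction, Finset.mul_sum,
      Finset.mul_sum, Finset.mul_sum]
    refine Finset.sum_congr rfl fun r hr => ?_
    have := Finset.mem_range.1 hr
    rw [map_mul, map_natCast, map_mul, map_mul, map_mul, map_pow, map_pow, hBA, map_serreSeq,
      show q - (i - r) = q - i + r by omega, pow_add]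
    ring
  refine (weightFiltration_two_eq hp5 hc hA hqA hG (hH.C_mul (-12))
    (map_qEval_ne_zero_of_sq_dvd (isUnit_twelve_pow hp5 i) hg h0) ?_
    (isUnit_twelve_pow hp5 i) hg).trans ?_
  · have hu : IsUnit (C (σ := Fin 2) (-12 : ZMod (q + 1))) :=
      (IsUnit.mk0 _ (neg_ne_zero.2 (ZMod.twelve_ne_zero hp5))).map C
    have hexp : map (reduction (q + 1)) A ^ (q + 1) =
        map (reduction (q + 1)) A ^ (q - i) * map (reduction (q + 1)) A ^ (i + 1) := by
      rw [← pow_add]; congr 1; omega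
    rw [hHm, hu.dvd_mul_left, hexp, mul_assoc,
      mul_dvd_mul_iff_left (pow_ne_zero _ (hasse_ne_zero (qEval_map_hasse hqA)))]
    exact fun h => hobs (hAD.pow_left.dvd_of_dvd_mul_left h)
  · congr 1
    rw [Nat.add_sub_cancel]
    ring

/-- The filtration of the `i`-th theta derivative if it is lowered once. -/
theorem weightFiltration_thetaOperator_of_dvd (hp5 : 5 ≤ p) (hc : reduction p c ≠ 0)
    (hA : Isobaric A (p - 1)) (hqA : qEval _ A = eisSeries _ (p * c) (p - 2)) (hP : Isobaric P k)
    (hAP : ¬ map (reduction p) A ∣ map (reduction p) P)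
    {i : ℕ} (hi : 0 < i) (hip : i ≤ p)
    (h0 : PowerSeries.map (reduction p) (thetaOperator^[i] (qEval _ P)) ≠ 0)
    (hdvd : ∀ r < i, p ∣ thetaCoeff k i r) (hsq : ¬ p ^ 2 ∣ thetaCoeff k i 0) :
    weightFiltration p 2 (thetaOperator^[i] (qEval _ P)) = (k + 2 * i + p * (p - 1) : ℕ) := by
  have hqA1 := qEval_map_hasse hqA
  have hp1 := (Fact.out : p.Prime).one_le
  obtain ⟨B, D, hB, -, hBA, -, hE⟩ := exists_e2Series_pow hp5 hc hA hqA
  set H := ∑ r ∈ Finset.range i, ((thetaCoeff k i r / p : ℕ) :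
    MvPolynomial (Fin 2) (pIntegralRationals p)) *
      (A ^ (p - (i - r)) * B ^ (i - r) * serreSeq k P r) with hHdef
  have hH : Isobaric H (k + 2 * i + p * (p - 1)) := by
    refine Isobaric.sum fun r hr => Isobaric.natCast_mul ((((hA.pow _).mul (hB.pow _)).mul
      (isobaric_serreSeq hP r)).cast ?_) _
    obtain ⟨q, rfl⟩ : ∃ q, p = q + 1 := ⟨p - 1, by omega⟩
    obtain ⟨j, rfl⟩ := Nat.exists_eq_add_of_le (Finset.mem_range.1 hr).le
    obtain ⟨l, hl⟩ := Nat.exists_eq_add_of_le (show j ≤ q + 1 by omega)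
    rw [show r + j - r = j by omega, show q + 1 - j = l by omega, Nat.add_sub_cancel]
    linear_combination q * hl.symm
  have hg : (p : (pIntegralRationals p)⟦X⟧) ^ 2 ∣
      PowerSeries.C ((12 : pIntegralRationals p) ^ i) * thetaOperator^[i] (qEval _ P) -
        (qEval _ (serreSeq k P i) + p * qEval _ H) := by
    rw [twelve_pow_mul_thetaOperator hP, Finset.sum_range_succ, thetaCoeff_self, Nat.sub_self,
      pow_zero, Nat.cast_one, one_mul, one_mul, add_comm (qEval _ _), add_sub_add_right_eq_sub,
      hHdef, map_sum, Finset.mul_sum, ← Finset.sum_sub_distrib]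
    refine Finset.dvd_sum fun r hr => ?_
    obtain ⟨z, hz⟩ := hE (i - r) (by omega)
    obtain ⟨n, hn⟩ := hdvd r (Finset.mem_range.1 hr)
    rw [hn, Nat.mul_div_cancel_left _ (Fact.out : p.Prime).pos]
    refine ⟨n * qEval _ (serreSeq k P r) * (p * z - ((i - r : ℕ) : (pIntegralRationals p)⟦X⟧) *
      (qEval _ A ^ (p - 1 - (i - r)) * qEval _ B ^ (i - r - 1) * (12 * qEval _ D))), ?_⟩
    simp only [map_mul, map_pow, map_natCast, Nat.cast_mul]
    linear_combination (p : (pIntegralRationals p)⟦X⟧) * n * qEval _ (serreSeq k P r) * hz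
  refine weightFiltration_two_eq hp5 hc hA hqA (isobaric_serreSeq hP i) hH
    (map_qEval_ne_zero_of_sq_dvd (isUnit_twelve_pow hp5 i) hg h0) ?_ (isUnit_twelve_pow hp5 i) hg
  -- Modulo A the remaining sum reduces to its term r = 0, whose coefficient t_0/p is a unit.
  have hHm : map (reduction p) H = map (reduction p) A ^ (p - i) * ∑ r ∈ Finset.range i,
      ((thetaCoeff k i r / p : ℕ) : MvPolynomial (Fin 2) (ZMod p)) * (map (reduction p) A ^ r *
        serreDer _ (map (reduction p) A) ^ (i - r) * serreSeq k (map (reduction p) P) r) := by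
    rw [hHdef, map_sum, Finset.mul_sum]
    refine Finset.sum_congr rfl fun r hr => ?_
    have := Finset.mem_range.1 hr
    rw [map_mul, map_natCast, map_mul, map_mul, map_pow, map_pow, hBA, map_serreSeq,
      show p - (i - r) = p - i + r by omega, pow_add]
    ring
  have hexp : map (reduction p) A ^ p = map (reduction p) A ^ (p - i) * map (reduction p) A ^ i := by
    rw [← pow_add, Nat.sub_add_cancel hip]
  rw [hHm, hexp, mul_dvd_mul_iff_left (pow_ne_zero _ (hasse_ne_zero hqA1))]
  intro h
  replace h := (dvd_pow_self _ hi.ne').trans h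
  obtain ⟨i, rfl⟩ := Nat.exists_eq_succ_of_ne_zero hi.ne'
  rw [Finset.sum_range_succ', dvd_add_right (Finset.dvd_sum fun r _ => ?_)] at h
  · have hc0 : ¬ p ∣ thetaCoeff k (i + 1) 0 / p := fun h => hsq (by
      rw [← Nat.mul_div_cancel' (hdvd 0 hi), sq]
      exact mul_dvd_mul_left p h)
    rw [(isUnit_natCast_mvPolynomial hc0).dvd_mul_left, pow_zero, one_mul] at h
    exact hAP ((isRelPrime_hasse hp5 (hA.map _) hqA1).pow_right.dvd_of_dvd_mul_left h)
  · exact (((dvd_pow_self _ r.succ_ne_zero).mul_right _).mul_right _).mul_left _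

/-- Dividing by A lowers the weight without changing the q-expansion modulo p. The case P = 0 modulo
p is covered by the zero form of weight 0 < k. -/
lemma not_hasse_dvd_of_weightFiltration (hp5 : 5 ≤ p) (hA : Isobaric A (p - 1))
    (hqA : qEval _ A = eisSeries _ (p * c) (p - 2)) (hP : Isobaric P k) (hk0 : 0 < k)
    (hfk : weightFiltration p 1 (qEval _ P) = k) :
    ¬ map (reduction p) A ∣ map (reduction p) P := by
  have hqA1 := qEval_map_hasse hqA
  rintro ⟨h, hh⟩
  suffices ∃ w < k, ∃ P', Isobaric P' w ∧ qEval _ (map (reduction p) P') =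
      qEval _ (map (reduction p) P) by
    obtain ⟨w, hw, P', hP', he⟩ := this
    refine not_powerSeriesCongr_of_lt hfk hw ((mem_pIntegralModularForms_iff hp5).2 ⟨P', hP', rfl⟩) ?_
    rw [powerSeriesCongr_iff, pow_one, ← map_reduction_eq_iff, map_qEval, map_qEval, he]
  rcases eq_or_ne (map (reduction p) P) 0 with hP0 | hP0
  · exact ⟨0, hk0, 0, isobaric_zero 0, by rw [hP0, map_zero]⟩
  · obtain ⟨v, v', hv, hAv, hhv⟩ := (hP.map (reduction p)).exists_of_eq_mul hP0 hh
    have hvA := IsWeightedHomogeneous.inj_right (hasse_ne_zero hqA1) (hA.map _) hAv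
    obtain ⟨P', hP', rfl⟩ := hhv.exists_lift
    exact ⟨v', by omega, P', hP', by rw [hh, map_mul, hqA1, one_mul]⟩

end ThetaFiltration

/-! ### The five ranges of i -/

theorem theoremA (p : ℕ) (hp : p.Prime) (hp5 : 5 ≤ p) (k : ℕ) (hk0 : 0 < k) (hkp : k < p)
    (f : (pIntegralRationals p)⟦X⟧) (hf : f ∈ pIntegralModularForms p k)
    (hfk : weightFiltration p 1 f = (k : ℕ∞)) :
    weightFiltration p 2 f = (k : ℕ∞) ∧
    (∀ i : ℕ, 0 < i → i < p - k + 1 →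
      weightFiltration p 2 (thetaOperator^[i] f) = ((k + 2 * i + 2 * p * (p - 1) : ℕ) : ℕ∞)) ∧
    (∀ i : ℕ, i = p - k + 1 →
      weightFiltration p 2 (thetaOperator^[i] f) = ((k + 2 * i + p * (p - 1) : ℕ) : ℕ∞)) ∧
    (∀ i : ℕ, p - k + 1 < i → i < p →
      weightFiltration p 2 (thetaOperator^[i] f) = ((k + 2 * i + 2 * p * (p - 1) : ℕ) : ℕ∞)) ∧
    (∀ i : ℕ, i = p →
      weightFiltration p 2 (thetaOperator^[i] f) = ((k + 2 * i + p * (p - 1) : ℕ) : ℕ∞)) := by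
  have : Fact p.Prime := ⟨hp⟩
  obtain ⟨P, hP, rfl⟩ := (mem_pIntegralModularForms_iff hp5).1 hf
  obtain ⟨c, A, hc, hA, hqA⟩ := exists_hasse hp5
  have hqA1 := qEval_map_hasse hqA
  have hAP := not_hasse_dvd_of_weightFiltration hp5 hA hqA hP hk0 hfk
  have h0 : ∀ i, PowerSeries.map (pIntegralRationals.reduction p)
      (thetaOperator^[i] (qEval _ P)) ≠ 0 := fun i => by
    rw [map_thetaOperator_iterate, map_qEval]
    exact thetaOperator_iterate_qEval_ne_zero hp5 (hA.map _) hqA1 (hP.map _) hAP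
      (fun h => by have := Nat.le_of_dvd hk0 h; omega) i
  refine ⟨?_, fun i hi hik => ?_, fun i hi => ?_, fun i hi hip => ?_, fun i hi => ?_⟩
  -- For i = 0 a congruence modulo p² in smaller weight would hold modulo p as well.
  · refine weightFiltration_eq ⟨_, hf, (powerSeriesCongr_iff _ _ _).2 (by rw [sub_self]; exact dvd_zero _)⟩
      fun w hw g hg hfg => not_powerSeriesCongr_of_lt hfk hw hg ?_
    rw [powerSeriesCongr_iff] at hfg ⊢
    exact (pow_dvd_pow _ one_le_two).trans hfg
  · refine weightFiltration_thetaOperator_of_not_dvd hp5 hc hA hqA hP (by omega) (h0 i) fun h => ?_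
    exact not_dvd_thetaObstruction_of_le hp5 (hA.map _) hqA1 hAP hk0 hi (by omega)
      ((dvd_pow_self _ i.succ_ne_zero).trans h)
  · exact weightFiltration_thetaOperator_of_dvd hp5 hc hA hqA hP hAP (by omega) (by omega) (h0 i)
      (fun r hr => dvd_thetaCoeff (by omega) (by omega))
      (not_sq_dvd_thetaCoeff_zero hk0 hkp (by omega) (by omega))
  · exact weightFiltration_thetaOperator_of_not_dvd hp5 hc hA hqA hP hip (h0 i)
      (not_dvd_thetaObstruction_of_lt hp5 (hA.map _) hqA1 (hP.map _) hAP hk0 hkp (by omega) hip)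
  · subst hi
    exact weightFiltration_thetaOperator_of_dvd hp5 hc hA hqA hP hAP (by omega) le_rfl (h0 _)
      (fun r hr => dvd_thetaCoeff_prime hk0 hkp hr)
      (not_sq_dvd_thetaCoeff_zero hk0 hkp (by omega) le_rfl)
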